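/- **Theorem (associated family for $-2(p+q)<c<0$).** *The sphere.* Let $p\ge 2$, $\frac1p+\frac1q=1$, $-2(p+q)<c<0$, $\alpha>0$, and let $\phi:(-\alpha,1)\to\mathbb R$ be a smooth solution of Hildebrand's equation $$e^{-\phi}\dot\phi\,(t\dot\phi+p+1)(t\dot\phi+q+1)=(p+q)\,t\,e^{\phi}+c,\qquad t\dot\phi>-\tfrac23(p+q)-\tfrac13,\qquad \ddot\phi>\frac{\dot\phi^2(p+q-1+t\dot\phi)}{2(p+q)+1+3t\dot\phi},$$ with $\phi\to+\infty$ at both ends. It defines the complete hyperbolic affine sphere $$S(t,\mu)=e^{\phi(t)/3}\big(e^{\frac{q+1}{3q}\mu},\;e^{-\frac{p+1}{3p}\mu},\;t\,e^{-\frac{p-q}{3(p+q)}\mu}\big),\qquad (t,\mu)\in(-\alpha,1)\times\mathbb R,$$ asymptotic to the boundary of the cone $\{-\alpha x^{1/p}y^{1/q}\le z\le x^{1/p}y^{1/q},\ x,y\ge0\}$. *Notation.* A surface $r(x,y)$ in $\mathbb R^3$ with isothermal coordinates $z=x+iy$ has affine metric $g=|LN-M^2|^{-1/4}(L\,dx^2+2M\,dx\,dy+N\,dy^2)$,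 where $L,M,N=|r_x,r_y,r_{xx}|,|r_x,r_y,r_{xy}|,|r_x,r_y,r_{yy}|$. Its affine normal is $\xi=\frac12\Delta^g r$, its affine mean curvature $H$ is given by $\xi=-Hr$, and its affine cubic form is $U\,dz^3+\bar U\,d\bar z^3$ with $U=i|r_z,r_{zz},r|$. Write $$\tfrac{c^2}{4(p+q)}+(\xi-1)(\xi+p)(\xi+q)=\xi^3+3b_1\xi^2+3b_2\xi+b_3,\quad g_2=\tfrac34(b_1^2-b_2),\quad g_3=\tfrac1{16}(3b_1b_2-2b_1^3-b_3).$$ Let $\wp,\zeta,\sigma$ be the Weierstrass functions of the lattice with invariants $g_2,g_3$, and let $2\omega_1$ be its smallest positive real period. Put $D=(-\omega_1,\omega_1)\times\mathbb R$ with coordinates $(\xi_2,y_3)$, $E=\frac{p^2-p+1}{p-1}$, and $$g=\Big(\wp(\xi_2+\omega_1)+\tfrac{2(p+q-1)-3b_1}{12}\Big)(d\xi_2^2+dy_3^2),\qquad U'=\sqrt{\tfrac{c^2(p-1)}{(32p)^2}+\tfrac{(p-2)^2(2p-1)^2(p+1)^2}{4(12(p-1))^3}}.$$ For $t\in\mathbb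 R$ with $\cos 3t\neq0$ let $s=-\operatorname{sgn}(\cos 3t)$, $\theta=\frac13\arccos\frac{-U'\sin 3t}{\sqrt{(E/12)^3}}$, and $$f_1=-\tfrac{1}{\sqrt3}\sqrt E\,\sin(\tfrac\pi6+\theta),\qquad f_2=-\tfrac{1}{\sqrt3}\sqrt E\,\cos(\tfrac\pi3+\theta),\qquad f_3=\tfrac{1}{\sqrt3}\sqrt E\,\cos\theta .$$ *Claims.* 1. $\wp(\xi_2+\omega_1)$ is real for $|\xi_2|<\omega_1$. There is a smooth bijection $\Phi:D\to(-\alpha,1)\times\mathbb R$ with nowhere vanishing Jacobian such that the homothetic sphere $\frac1{\sqrt3}S\circ\Phi$ has affine metric $g$ (positive definite), $H=-1$ and $$U=U_0:=\frac{c\sqrt{p-1}}{32p}-i\,\frac{(p-2)(2p-1)(p+1)}{2(12(p-1))^{3/2}}.$$ Moreover $U_0=e^{3it_0}U'$ for some $t_0\in[0,\frac{2\pi}3]$ with $\cos 3t_0\ne0$. 2. Let $\cos3t\neq0$. For $i=1,2,3$ there are $m_i\in\mathbb C$ (not periods) with $$\wp(m_i)+\frac{b_1}4-\frac{2U'\sin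 3t}{f_i(t)}=0,\qquad \wp'(m_i)<0$$ (if $f_i(t)=0$, the quotient is replaced by its limit $E/4$). For every choice of such $m_i$ the vector $$r_\lambda=\begin{pmatrix}\frac1{3p}\,\frac{\sigma(\xi_2+\omega_1-sm_1)\,\sigma(\omega_1)}{\sigma(\xi_2+\omega_1)\,\sigma(\omega_1-sm_1)}\,e^{s\zeta(m_1)\xi_2+f_1(t)y_3}\\[4pt] \frac1{3p}\,\frac{\sigma(\xi_2+\omega_1-sm_2)\,\sigma(\omega_1)}{\sigma(\xi_2+\omega_1)\,\sigma(\omega_1-sm_2)}\,e^{s\zeta(m_2)\xi_2+f_2(t)y_3}\\[4pt] \frac{\sqrt3(p-1)c}2\,\frac{\sigma(\xi_2+\omega_1-sm_3)\,\sigma(\omega_1)}{\sigma(\xi_2+\omega_1)\,\sigma(\omega_1-sm_3)}\,e^{s\zeta(m_3)\xi_2+f_3(t)y_3}\end{pmatrix}$$ is real on $D$. With $g=2e^\psi dz\,d\bar z$, $z=\xi_2+iy_3$, $H=-1$ and $\lambda=e^{3it}$, the frame $F=(r_z,r_{\bar z},\xi)$ of $r=r_\lambda$, $\xi=-Hr$,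 solves $$F_z=F\begin{pmatrix}\psi_z&0&-H\\-\lambda U'e^{-\psi}&0&0\\0&e^\psi&0\end{pmatrix},\qquad F_{\bar z}=F\begin{pmatrix}0&-\lambda^{-1}U'e^{-\psi}&0\\0&\psi_{\bar z}&-H\\e^\psi&0&0\end{pmatrix}.$$ 3. For $\cos 3t\ne 0$ and every such choice of $m_i$, let $$\delta(t)=-\frac{12\sqrt3\,p^2\,U'\cos3t}{(p-1)\,c\,\sqrt{E^3/16-108\,U'^2\sin^23t}}.$$ Then $\mathrm{diag}(1,1,\delta(t))\,r_\lambda$ has on $D$ the affine metric $g$, $H=-1$ and cubic coefficient $U=e^{3it}U'$. Every smooth surface on $D$ with these invariants equals $A\,\mathrm{diag}(1,1,\delta(t))\,r_\lambda$ for some constant $3\times3$ matrix $A$ with $\det A=1$. So, up to unimodular linear maps, these surfaces are the members with $\cos 3t\neq0$ of the associated family of $\frac1{\sqrt3}S$, which itself occurs at $t=t_0$. -/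

import Mathlib

open Set Filter
open scoped Topology ContDiff

noncomputable section

namespace AffineSphere

/-! ### Affine differential geometry of a parametrized surface `r : ℝ × ℝ → ℝ³` -/

/-- Partial derivative in the first coordinate. -/
def dx {V : Type*} [NormedAddCommGroup V] [NormedSpace ℝ V] (f : ℝ × ℝ → V) (z : ℝ × ℝ) : V :=
  deriv (fun u => f (u, z.2)) z.1

/-- Partial derivative in the second coordinate. -/
def dy {V : Type*} [NormedAddCommGroup V] [NormedSpace ℝ V] (f : ℝ × ℝ → V) (z : ℝ × ℝ) : V :=
  deriv (fun u => f (z.1, u)) z.2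

/-- `∂/∂z = (∂/∂x - i ∂/∂y) / 2`. -/
def dz (f : ℝ × ℝ → ℂ) (z : ℝ × ℝ) : ℂ := (dx f z - Complex.I * dy f z) / 2

/-- `∂/∂z̄ = (∂/∂x + i ∂/∂y) / 2`. -/
def dzbar (f : ℝ × ℝ → ℂ) (z : ℝ × ℝ) : ℂ := (dx f z + Complex.I * dy f z) / 2

/-- The determinant `|a, b, c|` of three vectors. -/
def det3 {R : Type*} [CommRing R] (a b c : Fin 3 → R) : R := Matrix.det (Matrix.of ![a, b, c])

/-- `L = |r_x, r_y, r_xx|`. -/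
def coeffL (r : ℝ × ℝ → Fin 3 → ℝ) (z : ℝ × ℝ) : ℝ := det3 (dx r z) (dy r z) (dx (dx r) z)

/-- `M = |r_x, r_y, r_xy|`. -/
def coeffM (r : ℝ × ℝ → Fin 3 → ℝ) (z : ℝ × ℝ) : ℝ := det3 (dx r z) (dy r z) (dy (dx r) z)

/-- `N = |r_x, r_y, r_yy|`. -/
def coeffN (r : ℝ × ℝ → Fin 3 → ℝ) (z : ℝ × ℝ) : ℝ := det3 (dx r z) (dy r z) (dy (dy r) z)

/-- The common denominator `|L N - M²|^(1/4)` of the Blaschke metric. -/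
def blaschkeDenom (r : ℝ × ℝ → Fin 3 → ℝ) (z : ℝ × ℝ) : ℝ :=
  |coeffL r z * coeffN r z - coeffM r z ^ 2| ^ (1 / 4 : ℝ)

/-- Coefficient of `dx²` in the affine (Blaschke) metric
`(L dx² + 2 M dx dy + N dy²) / |L N - M²|^(1/4)`. -/
def blaschkeE (r : ℝ × ℝ → Fin 3 → ℝ) (z : ℝ × ℝ) : ℝ := coeffL r z / blaschkeDenom r z

/-- Coefficient of `2 dx dy` in the affine metric. -/
def blaschkeF (r : ℝ × ℝ → Fin 3 → ℝ) (z : ℝ × ℝ) : ℝ := coeffM r z / blaschkeDenom r z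

/-- Coefficient of `dy²` in the affine metric. -/
def blaschkeG (r : ℝ × ℝ → Fin 3 → ℝ) (z : ℝ × ℝ) : ℝ := coeffN r z / blaschkeDenom r z

/-- The Laplace–Beltrami operator of the metric `E dx² + 2 F dx dy + G dy²`, in coordinates,
applied componentwise to a vector-valued function. -/
def laplaceBeltrami (E F G : ℝ × ℝ → ℝ) (f : ℝ × ℝ → Fin 3 → ℝ) (z : ℝ × ℝ) : Fin 3 → ℝ :=
  (√(E z * G z - F z ^ 2))⁻¹ •
    (dx (fun w => (√(E w * G w - F w ^ 2))⁻¹ • (G w • dx f w - F w • dy f w)) z +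
      dy (fun w => (√(E w * G w - F w ^ 2))⁻¹ • (E w • dy f w - F w • dx f w)) z)

/-- The affine normal `ξ = (1/2) Δ^g r`, with `g` the affine metric of `r`. -/
def affineNormal (r : ℝ × ℝ → Fin 3 → ℝ) (z : ℝ × ℝ) : Fin 3 → ℝ :=
  (1 / 2 : ℝ) • laplaceBeltrami (blaschkeE r) (blaschkeF r) (blaschkeG r) r z

/-- The coefficient `U = i |r_z, r_zz, r|` of the affine cubic form `U dz³ + Ū dz̄³`. -/
def cubicCoeff (r : ℝ × ℝ → Fin 3 → ℝ) (z : ℝ × ℝ) : ℂ :=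
  Complex.I * det3 (fun i => dz (fun w => (r w i : ℂ)) z)
    (fun i => dz (dz fun w => (r w i : ℂ)) z) (fun i => (r z i : ℂ))

/-- On the open set `D`, the coordinates `(x, y)` are isothermal for the surface `r`, its affine
metric is `W (dx² + dy²)` with `W > 0`, it is a proper affine sphere centred at the origin with
affine mean curvature `H` (that is, `ξ = - H r`), and its affine cubic form is
`U (dx + i dy)³ +` conjugate, with `U` constant. -/
structure HasInvariants (D : Set (ℝ × ℝ)) (r : ℝ × ℝ → Fin 3 → ℝ) (W : ℝ × ℝ → ℝ) (H : ℝ)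
    (U : ℂ) : Prop where
  smooth : ContDiffOn ℝ ∞ r D
  pos : ∀ z ∈ D, 0 < W z
  metricE : ∀ z ∈ D, blaschkeE r z = W z
  metricF : ∀ z ∈ D, blaschkeF r z = 0
  metricG : ∀ z ∈ D, blaschkeG r z = W z
  normal : ∀ z ∈ D, affineNormal r z = (-H) • r z
  cubic : ∀ z ∈ D, cubicCoeff r z = U

/-- The frame `(r_z, r_z̄, ξ)`, written in columns, with `ξ = - H r`. -/
def frame (r : ℝ × ℝ → Fin 3 → ℝ) (H : ℝ) (z : ℝ × ℝ) : Matrix (Fin 3) (Fin 3) ℂ :=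
  Matrix.of fun i => ![dz (fun w => (r w i : ℂ)) z, dzbar (fun w => (r w i : ℂ)) z,
    -(H : ℂ) * (r z i : ℂ)]

/-- The frame equations with spectral parameter `lam`, for the metric `2 e^ψ dz dz̄`, the affine
mean curvature `H` and the cubic coefficient `U`. -/
structure SolvesFrameEquations (D : Set (ℝ × ℝ)) (r : ℝ × ℝ → Fin 3 → ℝ) (ψ : ℝ × ℝ → ℝ)
    (H : ℝ) (U lam : ℂ) : Prop where
  smooth : ContDiffOn ℝ ∞ r D
  eq_z : ∀ z ∈ D, (Matrix.of fun i j => dz (fun w => frame r H w i j) z) =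
    frame r H z * !![dz (fun w => (ψ w : ℂ)) z, 0, -(H : ℂ);
      -lam * U * (Real.exp (-ψ z) : ℂ), 0, 0;
      0, (Real.exp (ψ z) : ℂ), 0]
  eq_zbar : ∀ z ∈ D, (Matrix.of fun i j => dzbar (fun w => frame r H w i j) z) =
    frame r H z * !![0, -lam⁻¹ * (starRingEnd ℂ) U * (Real.exp (-ψ z) : ℂ), 0;
      0, dzbar (fun w => (ψ w : ℂ)) z, -(H : ℂ);
      (Real.exp (ψ z) : ℂ), 0, 0]

/-! ### Hildebrand's affine spheres -/

/-- `φ` solves Hildebrand's ordinary differential equation with integration constant `c` on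
`(-α, 1)`, with the convexity inequalities, and tends to `+∞` at both ends (so that the affine
sphere below is asymptotic to the boundary of the cone
`{(x, y, z) | -α x^(1/p) y^(1/q) ≤ z ≤ x^(1/p) y^(1/q), x ≥ 0, y ≥ 0}`). -/
structure IsHildebrandSolution (p q c α : ℝ) (φ : ℝ → ℝ) : Prop where
  smooth : ContDiffOn ℝ ∞ φ (Ioo (-α) 1)
  ode : ∀ t ∈ Ioo (-α) 1,
    Real.exp (-φ t) * deriv φ t * (t * deriv φ t + p + 1) * (t * deriv φ t + q + 1) =
      (p + q) * t * Real.exp (φ t) + c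
  ineq_first : ∀ t ∈ Ioo (-α) 1, -(2 / 3) * (p + q) - 1 / 3 < t * deriv φ t
  ineq_second : ∀ t ∈ Ioo (-α) 1,
    deriv φ t ^ 2 * (p + q - 1 + t * deriv φ t) / (2 * (p + q) + 1 + 3 * t * deriv φ t) <
      deriv (deriv φ) t
  tendsto_left : Tendsto φ (𝓝[>] (-α)) atTop
  tendsto_right : Tendsto φ (𝓝[<] 1) atTop

/-- Hildebrand's affine sphere, parametrized by `(t, μ)`. -/
def hildebrandSphere (p q : ℝ) (φ : ℝ → ℝ) (w : ℝ × ℝ) : Fin 3 → ℝ :=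
  Real.exp (φ w.1 / 3) • ![Real.exp ((q + 1) / (3 * q) * w.2),
    Real.exp (-((p + 1) / (3 * p)) * w.2),
    Real.exp (-((p - q) / (3 * (p + q))) * w.2) * w.1]

/-! ### Weierstrass functions -/

/-- The Weierstrass zeta function `1/z + ∑_{l ≠ 0} (1/(z - l) + 1/l + z/l²)`
(the term `l = 0` of the sum is `1/z`, because `1 / 0 = 0` and `z / 0 = 0`). -/
def weierstrassZeta (L : PeriodPair) (z : ℂ) : ℂ :=
  ∑' l : L.lattice, (1 / (z - l) + 1 / (l : ℂ) + z / (l : ℂ) ^ 2)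

/-- The Weierstrass sigma function `z ∏_{l ≠ 0} (1 - z/l) exp (z/l + z²/(2 l²))`
(the factor `l = 0` of the product is `1`, because `z / 0 = 0`). -/
def weierstrassSigma (L : PeriodPair) (z : ℂ) : ℂ :=
  z * ∏' l : L.lattice, (1 - z / (l : ℂ)) * Complex.exp (z / (l : ℂ) + z ^ 2 / (2 * (l : ℂ) ^ 2))

/-! ### The constants; `c²/(4(p+q)) + (ξ-1)(ξ+p)(ξ+q) = ξ³ + 3 b₁ ξ² + 3 b₂ ξ + b₃` -/

def b1 (p q : ℝ) : ℝ := (p + q - 1) / 3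

def b2 (p q : ℝ) : ℝ := (p * q - p - q) / 3

def b3 (p q c : ℝ) : ℝ := c ^ 2 / (4 * (p + q)) - p * q

/-- The cubic above has these coefficients. -/
theorem cubic_expansion (p q c ξ : ℝ) :
    c ^ 2 / (4 * (p + q)) + (ξ - 1) * (ξ + p) * (ξ + q) =
      ξ ^ 3 + 3 * b1 p q * ξ ^ 2 + 3 * b2 p q * ξ + b3 p q c := by
  unfold b1 b2 b3; ring

def invg2 (p q : ℝ) : ℝ := 3 / 4 * (b1 p q ^ 2 - b2 p q)

def invg3 (p q c : ℝ) : ℝ := 1 / 16 * (3 * b1 p q * b2 p q - 2 * b1 p q ^ 3 - b3 p q c)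

/-- The conformal factor `℘(ξ₂ + ω₁) + (2(p + q - 1) - 3 b₁)/12`. -/
def conformalFactor (p q : ℝ) (L : PeriodPair) (ω₁ : ℝ) (z : ℝ × ℝ) : ℝ :=
  (L.weierstrassP ((z.1 : ℂ) + (ω₁ : ℂ))).re + (2 * (p + q - 1) - 3 * b1 p q) / 12

/-- The constant `U'`, the modulus of the cubic coefficient. -/
def modU (p c : ℝ) : ℝ :=
  √(c ^ 2 * (p - 1) / (32 * p) ^ 2 +
    (p - 2) ^ 2 * (2 * p - 1) ^ 2 * (p + 1) ^ 2 / (4 * (12 * (p - 1)) ^ 3))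

/-- The cubic coefficient `U` of Hildebrand's affine sphere. -/
def hildebrandU (p c : ℝ) : ℂ :=
  ((c * √(p - 1) / (32 * p) : ℝ) : ℂ) - Complex.I *
    (((p - 2) * (2 * p - 1) * (p + 1) / (2 * (12 * (p - 1)) ^ (3 / 2 : ℝ)) : ℝ) : ℂ)

/-- The angle `arccos (U' H sin(3t) / √(((p² - p + 1)/(12 (p - 1)))³))` with `H = -1`. -/
def angle (p c t : ℝ) : ℝ :=
  Real.arccos (modU p c * (-1) * Real.sin (3 * t) / √(((p ^ 2 - p + 1) / (12 * (p - 1))) ^ 3))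

/-- The exponents `f₁(t), f₂(t), f₃(t)`. -/
def expo (p c t : ℝ) : Fin 3 → ℝ :=
  ![-(1 / √3) * √((p ^ 2 - p + 1) / (p - 1)) * Real.sin (Real.pi / 6 + 1 / 3 * angle p c t),
    -(1 / √3) * √((p ^ 2 - p + 1) / (p - 1)) * Real.cos (Real.pi / 3 + 1 / 3 * angle p c t),
    1 / √3 * √((p ^ 2 - p + 1) / (p - 1)) * Real.cos (1 / 3 * angle p c t)]

/-- `s = - sgn (cos 3t)`. -/
def sgnS (t : ℝ) : ℝ := -Real.sign (Real.cos (3 * t))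

/-- `m` is an admissible parameter for the exponent `f`: it is not a pole of `℘`, it solves
`℘(m) + b₁/4 - 2 U' sin(3t) / f = 0` (for `f = 0`, where the quotient is not defined, with the
quotient replaced by its limit value `(p² - p + 1)/(4 (p - 1))`), and `℘'(m)` is real negative. -/
def IsParameter (p q c t : ℝ) (L : PeriodPair) (f : ℝ) (m : ℂ) : Prop :=
  m ∉ L.lattice ∧
  (f ≠ 0 → L.weierstrassP m + ((b1 p q / 4 - 2 * modU p c * Real.sin (3 * t) / f : ℝ) : ℂ) = 0) ∧
  (f = 0 → L.weierstrassP m + ((b1 p q / 4 - (p ^ 2 - p + 1) / (4 * (p - 1)) : ℝ) : ℂ) = 0) ∧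
  (L.derivWeierstrassP m).im = 0 ∧ (L.derivWeierstrassP m).re < 0

/-- The coordinates
`k σ(ξ₂ + ω₁ - s m) σ(ω₁) / (σ(ξ₂ + ω₁) σ(ω₁ - s m)) exp (s ζ(m) ξ₂ + f y₃)` of the family, with
the constants `k = 1/(3p), 1/(3p), √3 (p - 1) c / 2`, as complex numbers. -/
def familyC (p c t : ℝ) (L : PeriodPair) (ω₁ : ℝ) (m : Fin 3 → ℂ) (z : ℝ × ℝ) (i : Fin 3) : ℂ :=
  ((![1 / (3 * p), 1 / (3 * p), √3 * (p - 1) * c / 2] i : ℝ) : ℂ) *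
    (weierstrassSigma L (z.1 + ω₁ - sgnS t * m i) * weierstrassSigma L ω₁ /
      (weierstrassSigma L (z.1 + ω₁) * weierstrassSigma L (ω₁ - sgnS t * m i))) *
    Complex.exp (sgnS t * weierstrassZeta L (m i) * z.1 + expo p c t i * z.2)

/-- The vector `r_λ` of the family. -/
def family (p c t : ℝ) (L : PeriodPair) (ω₁ : ℝ) (m : Fin 3 → ℂ) (z : ℝ × ℝ) (i : Fin 3) : ℝ :=
  (familyC p c t L ω₁ m z i).re

/-- The constant `δ(t)` by which the third coordinate has to be multiplied for the frame
`(r_x, r_y, ξ)` to be unimodular with respect to the metric; it is `± 1` at the value of `t`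
that belongs to Hildebrand's affine sphere. -/
def unimodularFactor (p c t : ℝ) : ℝ :=
  -(12 * √3 * p ^ 2 * modU p c * Real.cos (3 * t)) / ((p - 1) * c *
    √(((p ^ 2 - p + 1) / (p - 1)) ^ 3 / 16 - 108 * modU p c ^ 2 * Real.sin (3 * t) ^ 2))

/-- The vector `diag(1, 1, δ(t)) r_λ`. -/
def normalizedFamily (p c t : ℝ) (L : PeriodPair) (ω₁ : ℝ) (m : Fin 3 → ℂ) (z : ℝ × ℝ)
    (i : Fin 3) : ℝ :=
  ![1, 1, unimodularFactor p c t] i * family p c t L ω₁ m z i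

end AffineSphere

end

open AffineSphere

noncomputable section

namespace AffineSphere

/-! ### The Weierstrass zeta function -/

/-! Write E = p + q - 1 (`shape`) and W(x) = ℘(x + ω₁) + E/12 (`factor`). For H = -1, metric
W(x)(dx² + dy²) and constant cubic coefficient A + iB, the structure equations are a linear system
(`GaussSystem`) that acts on each coordinate of r separately. A surface with these invariants solves
it and satisfies |r_x, r_y, r| = W (`HasInvariants.det_and_gaussSystem`), and conversely
(`GaussSystem.hasInvariants`). The system expresses the derivatives of (r_x, r_y, r) linearly
through (r_x, r_y, r). Hence a solution is determined by its frame at one point, the determinant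
condition has to be checked at one point only (`GaussSystem.det_eq`), and two surfaces with the same
invariants differ by a unimodular map (`GaussSystem.exists_matrix`). What remains is to find three
scalar solutions and to compute one determinant.

Since W does not depend on y, one looks for solutions X(x) exp(f y). If f (E/4 - f²) = 2B, the
system follows from X'' = (2W - f²) X and (W - (E/4 - f²)) X' = (W' + 4A) X / 2. These are the two
differential equations of the Lamé function σ(u - a)/σ(u) exp(ζ(a) u) at u = x + ω₁, provided that
℘(a) = E/4 - f² - E/12 and ℘'(a) = 4A (`lame_first_order`, `lame_second_order`; the first one is the
addition theorem of ζ). The two conditions on a are compatible: W'² = 4W³ - E W² + 16 U'² with U'² =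
A² + B², and at W = E/4 - f² the right side is 16 U'² - 4 (fW)² = 16 A². The range of c gives U'² <
E³/1728, so the cubic for f has three distinct real roots for every phase t; it also gives W > E/6,
whence W'' = W (6W - E) > 0. The coordinates are real because their imaginary parts solve a real
linear equation with zero initial data (`normLame_im`).

For Hildebrand's sphere put K = t φ' + 1. Multiplication of the equation for φ by t exp φ gives K³ +
E K² + b₃ = (p + q)(t exp φ + c/(2(p + q)))². This is the equation of W under K = 4W - 2E/3 and W' -
4A = √(p + q) t exp φ / 4, with A = c/(32 √(p + q)). Both t exp φ and W' are diffeomorphisms onto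
the line, so these relations define t as a function of x (`exists_hildebrand_reparametrization`).
After a shear of μ the coordinates of the sphere are separated solutions of the same system
(`exists_hildebrand_map`). -/

lemma norm_zeta_summand_le {r : ℝ} (hr : 0 < r) {s : ℂ} (hs : ‖s‖ < r) {l : ℂ}
    (h : 2 * r ≤ ‖l‖) : ‖1 / (s - l) + 1 / l + s / l ^ 2‖ ≤ 2 * r ^ 2 * ‖l‖ ^ (-3 : ℝ) := by
  have hsl : s - l ≠ 0 := by
    intro e
    rw [sub_eq_zero.mp e] at hs
    linarith
  have hl : 0 < ‖l‖ := by linarith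
  have hl0 : l ≠ 0 := norm_pos_iff.mp hl
  have e : 1 / (s - l) + 1 / l + s / l ^ 2 = s ^ 2 / ((s - l) * l ^ 2) := by
    field_simp
    ring
  have h1 : ‖l‖ / 2 ≤ ‖s - l‖ := by
    rw [norm_sub_rev]
    exact .trans (by linarith) (norm_sub_norm_le l s)
  rw [e, norm_div, norm_mul, norm_pow, norm_pow]
  calc ‖s‖ ^ 2 / (‖s - l‖ * ‖l‖ ^ 2) ≤ r ^ 2 / (‖l‖ / 2 * ‖l‖ ^ 2) := by gcongr
    _ = 2 * r ^ 2 * (‖l‖ ^ 3)⁻¹ := by field_simp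
    _ = _ := by norm_cast

/-- The Weierstrass zeta function without its pole at the origin. -/
def zetaRegular (L : PeriodPair) (z : ℂ) : ℂ :=
  ∑' l : L.lattice, if (l : ℂ) = 0 then 0 else (1 / (z - l) + 1 / (l : ℂ) + z / (l : ℂ) ^ 2)

lemma hasSumLocallyUniformly_zetaRegular (L : PeriodPair) :
    HasSumLocallyUniformly (fun (l : L.lattice) (z : ℂ) => if (l : ℂ) = 0 then 0 else
      (1 / (z - l) + 1 / (l : ℂ) + z / (l : ℂ) ^ 2)) (zetaRegular L) := by
  refine L.hasSumLocallyUniformly_aux (u := fun r l => 2 * r ^ 2 * ‖l‖ ^ (-3 : ℝ)) _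
    (fun _ _ => (ZLattice.summable_norm_rpow _ _ (by simp; norm_num)).mul_left _) fun r hr =>
    eventually_atTop.mpr ⟨2 * r, ?_⟩
  rintro _ h s hs l rfl
  split_ifs
  · rw [norm_zero]; positivity
  · exact norm_zeta_summand_le hr hs h

lemma weierstrassZeta_eq (L : PeriodPair) (z : ℂ) :
    weierstrassZeta L z = 1 / z + zetaRegular L z := by
  have h1 : HasSum (fun l : L.lattice => if l = 0 then 1 / z else 0) (1 / z) :=
    hasSum_ite_eq 0 (1 / z)
  have h2 := (hasSumLocallyUniformly_zetaRegular L).hasSum (x := z)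
  rw [weierstrassZeta, ← (h1.add h2).tsum_eq]
  congr 1
  ext l
  by_cases hl : l = 0
  · simp [hl]
  · simp [hl]

/-- Termwise differentiation: the differentiated series is the regular part of -℘ and converges
locally uniformly. The origin is allowed, since the polar term has been removed; the expansion at 0
in the addition theorem needs this. -/
lemma hasDerivAt_zetaRegular (L : PeriodPair) {z : ℂ} (hz : z ∈ ((L.lattice : Set ℂ) \ {0})ᶜ) :
    HasDerivAt (zetaRegular L) (-L.weierstrassPExcept 0 z) z := by
  have hz' := hz
  refine hasDerivAt_of_tendstoLocallyUniformlyOn (f := fun (t : Finset L.lattice) z =>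
      ∑ l ∈ t, if (l : ℂ) = 0 then (0 : ℂ) else (1 / (z - l) + 1 / (l : ℂ) + z / (l : ℂ) ^ 2))
    (f' := fun (t : Finset L.lattice) z =>
      -∑ l ∈ t, if (l : ℂ) = 0 then (0 : ℂ) else (1 / (z - l) ^ 2 - 1 / (l : ℂ) ^ 2))
    (g' := fun z => -L.weierstrassPExcept 0 z) (l := atTop)
    L.isOpen_compl_lattice_sdiff ?_ (.of_forall fun t x hx => ?_) (fun x _ => ?_) hz'
  · have := (L.hasSumLocallyUniformly_weierstrassPExcept 0).tendstoLocallyUniformlyOn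
      (s := ((L.lattice : Set ℂ) \ {0})ᶜ)
    exact this.neg
  · rw [← Finset.sum_neg_distrib]
    refine HasDerivAt.fun_sum fun l _ => ?_
    by_cases hl : (l : ℂ) = 0
    · simpa [hl] using hasDerivAt_const x (0 : ℂ)
    · have hxl : x - l ≠ 0 := by
        intro e
        rw [sub_eq_zero.mp e] at hx
        simp [hl] at hx
      simp only [hl, if_false]
      have := ((((hasDerivAt_id x).sub_const (l : ℂ)).inv hxl).add_const (1 / (l : ℂ))).add
        ((hasDerivAt_id x).div_const ((l : ℂ) ^ 2))
      refine (this.congr_deriv ?_).congr_of_eventuallyEq (.of_forall fun y => ?_)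
      · simp; ring
      · simp
  · exact (hasSumLocallyUniformly_zetaRegular L).hasSum

lemma hasDerivAt_weierstrassZeta (L : PeriodPair) {z : ℂ} (hz : z ∉ L.lattice) :
    HasDerivAt (weierstrassZeta L) (-L.weierstrassP z) z := by
  have h0 : z ≠ 0 := by rintro rfl; simp at hz
  have h1 := ((hasDerivAt_inv h0).add (hasDerivAt_zetaRegular L (z := z) (by simp [hz])))
  have h2 := L.weierstrassPExcept_add 0 z
  refine (h1.congr_deriv ?_).congr_of_eventuallyEq (.of_forall fun y => ?_)
  · rw [← h2]; simp
  · simp [weierstrassZeta_eq]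

lemma weierstrassZeta_neg (L : PeriodPair) (z : ℂ) :
    weierstrassZeta L (-z) = -weierstrassZeta L z := by
  simp only [weierstrassZeta]
  rw [← (Equiv.neg L.lattice).tsum_eq, ← tsum_neg]
  congr with l
  have : (-z - -(l : ℂ)) = -(z - l) := by ring
  simp only [Equiv.neg_apply, NegMemClass.coe_neg, this, one_div, inv_neg]
  ring

lemma zetaRegular_zero (L : PeriodPair) : zetaRegular L 0 = 0 := by
  have : (fun l : L.lattice => if (l : ℂ) = 0 then (0 : ℂ) else
      (1 / (0 - (l : ℂ)) + 1 / (l : ℂ) + 0 / (l : ℂ) ^ 2)) = fun _ => 0 := by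
    ext l
    split_ifs
    · rfl
    · rw [zero_sub, one_div_neg_eq_neg_one_div, zero_div]; ring
  rw [zetaRegular, this, tsum_zero]

/-! ### The Weierstrass sigma function -/

/-- The third canonical factor `(1 - w) exp (w + w² / 2)` in the variable `w = z / l`. -/
def sigmaFactor (l z : ℂ) : ℂ := (1 - z / l) * Complex.exp (z / l + z ^ 2 / (2 * l ^ 2))

/-- The derivative of (1 - v) exp(v + v²/2) is -v² exp(v + v²/2), so the mean value inequality on
the disc of radius ‖w‖ gives the cubic bound. On that disc the exponential is at most e ≤ 3. -/
lemma norm_canonicalFactor_sub_one_le {w : ℂ} (hw : ‖w‖ ≤ 1 / 2) :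
    ‖(1 - w) * Complex.exp (w + w ^ 2 / 2) - 1‖ ≤ 3 * ‖w‖ ^ 3 := by
  have hd : ∀ v ∈ Metric.closedBall (0 : ℂ) ‖w‖,
      HasDerivWithinAt (fun v : ℂ => (1 - v) * Complex.exp (v + v ^ 2 / 2))
        (-v ^ 2 * Complex.exp (v + v ^ 2 / 2)) (Metric.closedBall 0 ‖w‖) v := by
    intro v _
    have h1 : HasDerivAt (fun v : ℂ => v + v ^ 2 / 2) (1 + v) v := by
      refine ((hasDerivAt_id v).add ((hasDerivAt_pow 2 v).div_const 2)).congr_deriv ?_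
      simp
    refine ((((hasDerivAt_id v).const_sub 1).mul h1.cexp).congr_deriv ?_).hasDerivWithinAt
    simp; ring
  have hb : ∀ v ∈ Metric.closedBall (0 : ℂ) ‖w‖,
      ‖-v ^ 2 * Complex.exp (v + v ^ 2 / 2)‖ ≤ 3 * ‖w‖ ^ 2 := by
    intro v hv
    have hv' : ‖v‖ ≤ ‖w‖ := by simpa using hv
    have hv2 : ‖v‖ ≤ 1 / 2 := hv'.trans hw
    rw [norm_mul, norm_neg, norm_pow, Complex.norm_exp, mul_comm]
    have h1 : (v + v ^ 2 / 2).re ≤ 1 := by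
      refine (Complex.re_le_norm _).trans ((norm_add_le _ _).trans ?_)
      rw [norm_div, norm_pow, Complex.norm_ofNat]
      nlinarith [norm_nonneg v]
    have h2 : Real.exp (v + v ^ 2 / 2).re ≤ 3 :=
      (Real.exp_le_exp.mpr h1).trans (by linarith [Real.exp_one_lt_d9])
    gcongr
  have := (convex_closedBall (0 : ℂ) ‖w‖).norm_image_sub_le_of_norm_hasDerivWithin_le hd hb
    (x := 0) (y := w) (by simp) (by simp)
  simp only [sub_zero] at this
  calc _ = ‖(1 - w) * Complex.exp (w + w ^ 2 / 2) - 1 * Complex.exp (0 + 0 ^ 2 / 2)‖ := by simp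
    _ ≤ _ := this
    _ = _ := by ring

lemma norm_sigmaFactor_sub_one_le {r : ℝ} (hr : 0 < r) {z : ℂ} (hz : ‖z‖ ≤ r) {l : ℂ}
    (h : 2 * r ≤ ‖l‖) : ‖sigmaFactor l z - 1‖ ≤ 3 * r ^ 3 * ‖l‖ ^ (-3 : ℝ) := by
  have hl : 0 < ‖l‖ := by linarith
  have hl0 : l ≠ 0 := norm_pos_iff.mp hl
  have e : z / l + z ^ 2 / (2 * l ^ 2) = z / l + (z / l) ^ 2 / 2 := by field_simp
  have h1 : ‖z / l‖ ≤ r / ‖l‖ := by rw [norm_div]; gcongr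
  have h2 : r / ‖l‖ ≤ 1 / 2 := by rw [div_le_div_iff₀ hl (by norm_num)]; linarith
  rw [sigmaFactor, e]
  refine (norm_canonicalFactor_sub_one_le (h1.trans h2)).trans ?_
  calc 3 * ‖z / l‖ ^ 3 ≤ 3 * (r / ‖l‖) ^ 3 := by gcongr
    _ = 3 * r ^ 3 * (‖l‖ ^ 3)⁻¹ := by rw [div_pow]; ring
    _ = _ := by norm_cast

lemma finite_norm_lattice_lt (L : PeriodPair) (R : ℝ) : {l : L.lattice | ‖(l : ℂ)‖ < R}.Finite := by
  refine (isCompact_iff_finite.mp (isCompact_closedBall (0 : L.lattice) R)).subset fun l hl => ?_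
  simpa using (le_of_lt hl : ‖(l : ℂ)‖ ≤ R)

lemma summable_norm_lattice (L : PeriodPair) :
    Summable fun l : L.lattice => ‖(l : ℂ)‖ ^ (-3 : ℝ) :=
  ZLattice.summable_norm_rpow L.lattice (-3) (by simp; norm_num)

lemma differentiable_sigmaFactor (l : ℂ) : Differentiable ℂ (sigmaFactor l) := by
  unfold sigmaFactor
  fun_prop

lemma hasProdLocallyUniformlyOn_sigmaFactor (L : PeriodPair) (r : ℝ) (hr : 0 < r) :
    HasProdLocallyUniformlyOn (fun (l : L.lattice) z => sigmaFactor l z)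
      (fun z => ∏' l : L.lattice, sigmaFactor l z) (Metric.ball 0 r) := by
  have := Summable.hasProdLocallyUniformlyOn_one_add (K := Metric.ball (0 : ℂ) r)
    (f := fun (l : L.lattice) z => sigmaFactor l z - 1)
    (u := fun l : L.lattice => 3 * r ^ 3 * ‖(l : ℂ)‖ ^ (-3 : ℝ)) Metric.isOpen_ball
    ((summable_norm_lattice L).mul_left _)
    ?_ (fun l => ((differentiable_sigmaFactor l).continuous.sub continuous_const).continuousOn)
  · simpa using this
  · have : ∀ᶠ l : L.lattice in cofinite, l ∉ {l : L.lattice | ‖(l : ℂ)‖ < 2 * r} :=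
      (finite_norm_lattice_lt L (2 * r)).eventually_cofinite_notMem
    filter_upwards [this] with l hl z hz
    exact norm_sigmaFactor_sub_one_le hr (by simpa using (mem_ball_zero_iff.mp hz).le)
      (by simpa using hl)

lemma weierstrassSigma_eq (L : PeriodPair) (z : ℂ) :
    weierstrassSigma L z = z * ∏' l : L.lattice, sigmaFactor l z := rfl

lemma differentiable_tprod_sigmaFactor (L : PeriodPair) :
    Differentiable ℂ fun z => ∏' l : L.lattice, sigmaFactor l z := by
  intro z
  have hr : 0 < ‖z‖ + 1 := by positivity
  refine ((hasProdLocallyUniformlyOn_sigmaFactor L _ hr).differentiableOn (.of_forall fun s => ?_)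
    Metric.isOpen_ball).differentiableAt (Metric.isOpen_ball.mem_nhds (by simp))
  have : Differentiable ℂ fun z => ∏ l ∈ s, sigmaFactor (l : ℂ) z :=
    Differentiable.fun_finsetProd fun l _ => differentiable_sigmaFactor l
  exact this.differentiableOn

lemma differentiable_weierstrassSigma (L : PeriodPair) :
    Differentiable ℂ (weierstrassSigma L) :=
  differentiable_id.mul (differentiable_tprod_sigmaFactor L)

lemma sigmaFactor_ne_zero (L : PeriodPair) {z : ℂ} (hz : z ∉ L.lattice) (l : L.lattice) :
    sigmaFactor l z ≠ 0 := by
  refine mul_ne_zero (fun h => hz ?_) (Complex.exp_ne_zero _)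
  by_cases hl : (l : ℂ) = 0
  · simp [hl] at h
  · have : z = l := by
      have := sub_eq_zero.mp h
      field_simp at this
      exact this.symm
    exact this ▸ l.2

lemma tprod_sigmaFactor_ne_zero (L : PeriodPair) {z : ℂ} (hz : z ∉ L.lattice) :
    ∏' l : L.lattice, sigmaFactor l z ≠ 0 := by
  have hr : 0 < ‖z‖ + 1 := by positivity
  have := tprod_one_add_ne_zero_of_summable (f := fun l : L.lattice => sigmaFactor l z - 1)
    (fun l => by simpa using sigmaFactor_ne_zero L hz l) ?_
  · simpa using this
  · refine Summable.of_norm_bounded_eventually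
      ((summable_norm_lattice L).mul_left (3 * (‖z‖ + 1) ^ 3)) ?_
    have : ∀ᶠ l : L.lattice in cofinite, l ∉ {l : L.lattice | ‖(l : ℂ)‖ < 2 * (‖z‖ + 1)} :=
      (finite_norm_lattice_lt L _).eventually_cofinite_notMem
    filter_upwards [this] with l hl
    rw [norm_norm]
    exact norm_sigmaFactor_sub_one_le hr (by linarith) (by simpa using hl)

lemma weierstrassSigma_ne_zero (L : PeriodPair) {z : ℂ} (hz : z ∉ L.lattice) :
    weierstrassSigma L z ≠ 0 :=
  mul_ne_zero (by rintro rfl; simp at hz) (tprod_sigmaFactor_ne_zero L hz)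

lemma logDeriv_sigmaFactor (L : PeriodPair) {z : ℂ} (hz : z ∉ L.lattice) (l : L.lattice) :
    logDeriv (sigmaFactor l) z =
      if (l : ℂ) = 0 then 0 else (1 / (z - l) + 1 / (l : ℂ) + z / (l : ℂ) ^ 2) := by
  have h1 : HasDerivAt (fun z : ℂ => z / l + z ^ 2 / (2 * (l : ℂ) ^ 2))
      (1 / l + z / (l : ℂ) ^ 2) z := by
    refine (((hasDerivAt_id z).div_const _).add ((hasDerivAt_pow 2 z).div_const _)).congr_deriv ?_
    by_cases hl : (l : ℂ) = 0
    · simp [hl]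
    · field_simp; norm_num; ring
  have h2 : HasDerivAt (sigmaFactor l) _ z :=
    (((hasDerivAt_id z).div_const (l : ℂ)).const_sub 1).mul h1.cexp
  have h3 := sigmaFactor_ne_zero L hz l
  rw [logDeriv_apply, h2.deriv]
  split_ifs with hl
  · simp [hl]
  · have h4 : z - l ≠ 0 := fun e => hz (sub_eq_zero.mp e ▸ l.2)
    have h5 : (l : ℂ) - z ≠ 0 := fun e => h4 (by rw [← neg_sub, e, neg_zero])
    rw [div_eq_iff h3, sigmaFactor]
    simp only [id]
    field_simp
    ring

/-- The logarithmic derivative of the product is the sum of the logarithmic derivatives of its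
factors, and these are the terms of the ζ series. -/
lemma hasDerivAt_weierstrassSigma (L : PeriodPair) {z : ℂ} (hz : z ∉ L.lattice) :
    HasDerivAt (weierstrassSigma L) (weierstrassZeta L z * weierstrassSigma L z) z := by
  have h0 : z ≠ 0 := by rintro rfl; simp at hz
  have hr : 0 < ‖z‖ + 1 := by positivity
  have hne := tprod_sigmaFactor_ne_zero L hz
  have h1 := logDeriv_tprod_eq_tsum (f := fun (l : L.lattice) z => sigmaFactor l z)
    (s := Metric.ball 0 (‖z‖ + 1)) (x := z) Metric.isOpen_ball (by simp)
    (sigmaFactor_ne_zero L hz) (fun l => (differentiable_sigmaFactor l).differentiableOn)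
    (by
      simp_rw [logDeriv_sigmaFactor L hz]
      exact ((hasSumLocallyUniformly_zetaRegular L).hasSum (x := z)).summable)
    ⟨_, hasProdLocallyUniformlyOn_sigmaFactor L _ hr⟩ hne
  simp_rw [logDeriv_sigmaFactor L hz] at h1
  rw [logDeriv_apply, div_eq_iff hne] at h1
  have h2 := (hasDerivAt_id z).mul ((differentiable_tprod_sigmaFactor L) z).hasDerivAt
  refine h2.congr_deriv ?_
  rw [h1, weierstrassZeta_eq, weierstrassSigma_eq, zetaRegular]
  simp only [id]
  field_simp

/-! ### Differential equations and the addition theorem -/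

lemma hasDerivAt_weierstrassP (L : PeriodPair) {z : ℂ} (hz : z ∉ L.lattice) :
    HasDerivAt L.weierstrassP (L.derivWeierstrassP z) z := by
  rw [← L.deriv_weierstrassP]
  exact (L.analyticOnNhd_weierstrassP z hz).differentiableAt.hasDerivAt

lemma isOpen_compl_lattice (L : PeriodPair) : IsOpen (L.lattice : Set ℂ)ᶜ :=
  L.isClosed_lattice.isOpen_compl

lemma countable_lattice (L : PeriodPair) : (L.lattice : Set ℂ).Countable := by
  have : Countable L.lattice := L.latticeEquivProd.toEquiv.countable_iff.mpr inferInstance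
  exact Set.countable_coe_iff.mp this

lemma isPreconnected_compl_of_countable {s : Set ℂ} (hs : s.Countable) : IsPreconnected sᶜ :=
  (hs.isConnected_compl_of_one_lt_rank (by simp)).isPreconnected

lemma eventually_notMem_lattice (L : PeriodPair) (x : ℂ) : ∀ᶠ z in 𝓝[≠] x, z ∉ L.lattice := by
  filter_upwards [mem_nhdsWithin_of_mem_nhds (L.compl_lattice_sdiff_singleton_mem_nhds x),
    self_mem_nhdsWithin] with z hz hz'
  exact fun h => hz ⟨h, hz'⟩

lemma continuousAt_weierstrassPExcept (L : PeriodPair) (l : ℂ) :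
    ContinuousAt (L.weierstrassPExcept l) l :=
  (L.analyticAt_weierstrassPExcept l).continuousAt

lemma weierstrassP_eq (L : PeriodPair) (z : ℂ) :
    L.weierstrassP z = L.weierstrassPExcept 0 z + 1 / z ^ 2 := by
  rw [← L.weierstrassPExcept_add 0 z]; simp

lemma derivWeierstrassP_eq (L : PeriodPair) (z : ℂ) :
    L.derivWeierstrassP z = L.derivWeierstrassPExcept 0 z - 2 / z ^ 3 := by
  rw [← L.derivWeierstrassPExcept_sub 0 z]; simp

/-- Near 0, ℘' is -2/z³ plus an analytic function. This non-vanishing allows ℘', or ℘ minus a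
constant, to be cancelled from an identity between analytic functions. -/
lemma exists_derivWeierstrassP_ne_zero (L : PeriodPair) :
    ∃ z, z ∉ L.lattice ∧ L.derivWeierstrassP z ≠ 0 := by
  by_contra! h
  have h1 : Tendsto (fun z : ℂ => z ^ 3 * L.derivWeierstrassPExcept 0 z) (𝓝[≠] 0) (𝓝 0) := by
    have : ContinuousAt (fun z : ℂ => z ^ 3 * L.derivWeierstrassPExcept 0 z) 0 :=
      (continuousAt_id.pow 3).mul (L.analyticAt_derivWeierstrassPExcept 0).continuousAt
    simpa using this.tendsto.mono_left nhdsWithin_le_nhds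
  have h2 : ∀ᶠ z : ℂ in 𝓝[≠] 0, z ^ 3 * L.derivWeierstrassPExcept 0 z = 2 := by
    filter_upwards [eventually_notMem_lattice L 0, self_mem_nhdsWithin] with z hz hz'
    have h3 := derivWeierstrassP_eq L z
    rw [h z hz] at h3
    have : z ≠ 0 := hz'
    rw [(sub_eq_zero.mp h3.symm)]
    field_simp
  have := tendsto_nhds_unique (h1.congr' h2) tendsto_const_nhds
  norm_num at this

/-- Differentiating ℘'² = 4℘³ - g₂℘ - g₃ gives ℘' times the claim. The factor ℘' can be cancelled
because the complement of the countable lattice is connected and analytic functions there have no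
zero divisors. -/
lemma deriv_derivWeierstrassP (L : PeriodPair) {z : ℂ} (hz : z ∉ L.lattice) :
    deriv L.derivWeierstrassP z = 6 * L.weierstrassP z ^ 2 - L.g₂ / 2 := by
  have hP := L.analyticOnNhd_weierstrassP
  have hP' := L.analyticOnNhd_derivWeierstrassP
  have key : ∀ z ∈ (L.lattice : Set ℂ)ᶜ, L.derivWeierstrassP z *
      (deriv L.derivWeierstrassP z - (6 * L.weierstrassP z ^ 2 - L.g₂ / 2)) = 0 := by
    intro z hz
    have h1 := (hP' z hz).differentiableAt.hasDerivAt.pow 2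
    have h2 := (((((hasDerivAt_weierstrassP L hz).pow 3).const_mul 4).sub
      ((hasDerivAt_weierstrassP L hz).const_mul L.g₂)).sub_const L.g₃)
    have h3 := h1.unique (h2.congr_of_eventuallyEq (by
      filter_upwards [(isOpen_compl_lattice L).mem_nhds hz] with w hw
      exact L.derivWeierstrassP_sq w hw))
    simp only [Nat.cast_ofNat, Nat.add_one_sub_one, pow_one] at h3
    linear_combination h3 / 2
  rcases AnalyticOnNhd.eq_zero_or_eq_zero_of_mul_eq_zero hP'
    ((hP'.deriv).sub (((analyticOnNhd_const (v := (6 : ℂ))).mul (hP.pow 2)).sub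
      (analyticOnNhd_const (v := L.g₂ / 2)))) key
    (isPreconnected_compl_of_countable (countable_lattice L)) with h | h
  · obtain ⟨z, hz, hz'⟩ := exists_derivWeierstrassP_ne_zero L
    exact absurd (h z hz) hz'
  · exact sub_eq_zero.mp (h z hz)

lemma hasDerivAt_derivWeierstrassP (L : PeriodPair) {z : ℂ} (hz : z ∉ L.lattice) :
    HasDerivAt L.derivWeierstrassP (6 * L.weierstrassP z ^ 2 - L.g₂ / 2) z := by
  rw [← deriv_derivWeierstrassP L hz]
  exact (L.analyticOnNhd_derivWeierstrassP z hz).differentiableAt.hasDerivAt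

lemma tendsto_weierstrassP_cobounded (L : PeriodPair) {l : ℂ} (hl : l ∈ L.lattice) :
    Tendsto L.weierstrassP (𝓝[≠] l) (Bornology.cobounded ℂ) := by
  refine tendsto_cobounded_of_meromorphicOrderAt_neg ?_
  rw [L.order_weierstrassP l hl]
  decide

/-- The Weierstrass function takes every value. -/
lemma exists_weierstrassP_eq (L : PeriodPair) (w : ℂ) :
    ∃ z, z ∉ L.lattice ∧ L.weierstrassP z = w := by
  classical
  by_contra! hw
  -- If ℘ omitted w, then 1/(℘ - w), extended by 0 over the poles, would be entire and doubly
  -- periodic, hence constant by Liouville and equal to its value 0 at the origin.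
  set h : ℂ → ℂ := fun z => if z ∈ L.lattice then 0 else (L.weierstrassP z - w)⁻¹ with hh
  have hd : ∀ z, z ∉ L.lattice → DifferentiableAt ℂ h z := by
    intro z hz
    have h1 : DifferentiableAt ℂ (fun z => (L.weierstrassP z - w)⁻¹) z :=
      ((hasDerivAt_weierstrassP L hz).differentiableAt.sub_const w).inv
        (sub_ne_zero.mpr (hw z hz))
    refine h1.congr_of_eventuallyEq ?_
    filter_upwards [(isOpen_compl_lattice L).mem_nhds hz] with y hy
    exact if_neg hy
  have hdiff : Differentiable ℂ h := by
    intro z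
    by_cases hz : z ∈ L.lattice
    · refine (Complex.analyticAt_of_differentiable_on_punctured_nhds_of_continuousAt
        ((eventually_notMem_lattice L z).mono hd) ?_).differentiableAt
      rw [continuousAt_iff_punctured_nhds]
      have h1 : Tendsto (fun y => (L.weierstrassP y - w)⁻¹) (𝓝[≠] z) (𝓝 0) := by
        refine tendsto_inv₀_cobounded.comp ?_
        have := (tendsto_weierstrassP_cobounded L hz)
        rw [← tendsto_norm_atTop_iff_cobounded] at this ⊢
        refine tendsto_atTop_mono (fun y => norm_sub_norm_le _ _) ?_
        exact tendsto_atTop_add_const_right _ _ this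
      have h2 : h z = 0 := if_pos hz
      rw [h2]
      refine h1.congr' ?_
      filter_upwards [eventually_notMem_lattice L z] with y hy
      exact (if_neg hy).symm
    · exact hd z hz
  have hb := (IsZLattice.isCompact_range_of_periodic L.lattice h hdiff.continuous (fun z v hv => by
    have e : z + v ∈ L.lattice ↔ z ∈ L.lattice := L.lattice.add_mem_iff_left hv
    have e2 := L.weierstrassP_add_coe z ⟨v, hv⟩
    simp only at e2
    simp only [hh, e, e2])).isBounded
  obtain ⟨z, hz, -⟩ := exists_derivWeierstrassP_ne_zero L
  have h1 := hdiff.apply_eq_apply_of_bounded hb z 0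
  rw [hh] at h1
  simp only [hz, if_false, zero_mem, if_true, inv_eq_zero] at h1
  exact hw z hz (sub_eq_zero.mp h1)

/-- The difference of the two sides of the addition theorem, as a function of `v` for `u = k - v`,
multiplied by `℘(u) - ℘(v)`. -/
def additionDefect (L : PeriodPair) (k v : ℂ) : ℂ :=
  (weierstrassZeta L k - weierstrassZeta L (k - v) - weierstrassZeta L v) *
    (L.weierstrassP (k - v) - L.weierstrassP v) -
    (L.derivWeierstrassP (k - v) - L.derivWeierstrassP v) / 2

lemma hasDerivAt_addition_zeta (L : PeriodPair) {k v : ℂ} (hv : v ∉ L.lattice)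
    (hkv : k - v ∉ L.lattice) : HasDerivAt
      (fun v => weierstrassZeta L k - weierstrassZeta L (k - v) - weierstrassZeta L v)
      (L.weierstrassP v - L.weierstrassP (k - v)) v := by
  have h0 := (hasDerivAt_id v).const_sub k
  have h1 := (hasDerivAt_weierstrassZeta L hkv).comp v h0
  refine ((h1.const_sub (weierstrassZeta L k)).sub
    (hasDerivAt_weierstrassZeta L hv)).congr_deriv ?_
  ring

lemma hasDerivAt_addition_den (L : PeriodPair) {k v : ℂ} (hv : v ∉ L.lattice)
    (hkv : k - v ∉ L.lattice) : HasDerivAt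
      (fun v => L.weierstrassP (k - v) - L.weierstrassP v)
      (-(L.derivWeierstrassP (k - v) + L.derivWeierstrassP v)) v := by
  have h0 := (hasDerivAt_id v).const_sub k
  refine (((hasDerivAt_weierstrassP L hkv).comp v h0).sub
    (hasDerivAt_weierstrassP L hv)).congr_deriv ?_
  ring

lemma hasDerivAt_addition_num (L : PeriodPair) {k v : ℂ} (hv : v ∉ L.lattice)
    (hkv : k - v ∉ L.lattice) : HasDerivAt
      (fun v => L.derivWeierstrassP (k - v) - L.derivWeierstrassP v)
      (L.g₂ - 6 * L.weierstrassP (k - v) ^ 2 - 6 * L.weierstrassP v ^ 2) v := by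
  have h0 := (hasDerivAt_id v).const_sub k
  refine (((hasDerivAt_derivWeierstrassP L hkv).comp v h0).sub
    (hasDerivAt_derivWeierstrassP L hv)).congr_deriv ?_
  ring

/-- With a = ℘(k - v) and b = ℘(v), the ζ part of the quotient has derivative b - a. The remaining
fraction cancels it: once both Weierstrass equations are inserted, the numerator in its quotient
rule is a multiple of (a - b)³. -/
lemma hasDerivAt_additionDefect_div (L : PeriodPair) {k v : ℂ} (hv : v ∉ L.lattice)
    (hkv : k - v ∉ L.lattice) (hne : L.weierstrassP (k - v) - L.weierstrassP v ≠ 0) :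
    HasDerivAt (fun v => additionDefect L k v / (L.weierstrassP (k - v) - L.weierstrassP v))
      0 v := by
  have h1 := hasDerivAt_addition_zeta L hv hkv
  have h2 := hasDerivAt_addition_den L hv hkv
  have h3 := hasDerivAt_addition_num L hv hkv
  refine (((h1.mul h2).sub (h3.div_const 2)).div h2 hne).congr_deriv ?_
  have e1 := L.derivWeierstrassP_sq v hv
  have e2 := L.derivWeierstrassP_sq (k - v) hkv
  simp only [Pi.sub_apply, Pi.mul_apply]
  rw [div_eq_zero_iff]
  left
  linear_combination (1 / 2) * e1 - (1 / 2) * e2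

lemma eventually_addition_domain (L : PeriodPair) {k : ℂ} (hk : k ∉ L.lattice) :
    ∀ᶠ v in 𝓝[≠] (0 : ℂ), v ∉ L.lattice ∧ k - v ∉ L.lattice ∧
      L.weierstrassP (k - v) - L.weierstrassP v ≠ 0 := by
  have hc : ContinuousAt (fun v : ℂ => k - v) 0 := by fun_prop
  have hc' : Tendsto (fun v : ℂ => k - v) (𝓝[≠] 0) (𝓝 k) := by
    simpa using hc.tendsto.mono_left nhdsWithin_le_nhds
  have h1 : ∀ᶠ v in 𝓝[≠] (0 : ℂ), k - v ∉ L.lattice :=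
    hc'.eventually ((isOpen_compl_lattice L).mem_nhds hk)
  have h2 : Tendsto (fun v => ‖L.weierstrassP (k - v)‖) (𝓝[≠] 0) (𝓝 ‖L.weierstrassP k‖) :=
    ((hasDerivAt_weierstrassP L hk).continuousAt.tendsto.comp hc').norm
  have h3 : Tendsto (fun v => ‖L.weierstrassP v‖) (𝓝[≠] 0) atTop :=
    tendsto_norm_atTop_iff_cobounded.mpr (tendsto_weierstrassP_cobounded L (zero_mem _))
  filter_upwards [eventually_notMem_lattice L 0, h1,
    h2.eventually (gt_mem_nhds (lt_add_one _)), h3.eventually_ge_atTop (‖L.weierstrassP k‖ + 1)]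
    with v hv1 hv2 hv3 hv4
  refine ⟨hv1, hv2, fun h => ?_⟩
  rw [sub_eq_zero.mp h] at hv3
  linarith

/-- Multiplying numerator and denominator by v² removes the poles: the contributions of order 1/v
from ζ(v) and ℘'(v) cancel, the numerator tends to 0 and the denominator to -1. -/
lemma tendsto_additionDefect_div (L : PeriodPair) {k : ℂ} (hk : k ∉ L.lattice) :
    Tendsto (fun v => additionDefect L k v / (L.weierstrassP (k - v) - L.weierstrassP v))
      (𝓝[≠] 0) (𝓝 0) := by
  have hc : ContinuousAt (fun v : ℂ => k - v) 0 := by fun_prop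
  have hk0 : k - 0 ∉ L.lattice := by simpa using hk
  have cz : ContinuousAt (fun v => weierstrassZeta L (k - v)) 0 :=
    ContinuousAt.comp (g := weierstrassZeta L) (hasDerivAt_weierstrassZeta L hk0).continuousAt hc
  have cP : ContinuousAt (fun v => L.weierstrassP (k - v)) 0 :=
    ContinuousAt.comp (g := L.weierstrassP) (hasDerivAt_weierstrassP L hk0).continuousAt hc
  have cP' : ContinuousAt (fun v => L.derivWeierstrassP (k - v)) 0 :=
    ContinuousAt.comp (g := L.derivWeierstrassP)
      (hasDerivAt_derivWeierstrassP L hk0).continuousAt hc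
  have c0 : ContinuousAt (zetaRegular L) 0 := (hasDerivAt_zetaRegular L (by simp)).continuousAt
  have c1 := continuousAt_weierstrassPExcept L 0
  have c2 : ContinuousAt (L.derivWeierstrassPExcept 0) 0 :=
    (L.analyticAt_derivWeierstrassPExcept 0).continuousAt
  have hden : ContinuousAt (fun v : ℂ => v ^ 2 * L.weierstrassP (k - v) - 1 -
      v ^ 2 * L.weierstrassPExcept 0 v) 0 := by fun_prop
  have hnum : ContinuousAt (fun v : ℂ =>
      (weierstrassZeta L k - weierstrassZeta L (k - v) - zetaRegular L v) *
      (v ^ 2 * L.weierstrassP (k - v) - 1 - v ^ 2 * L.weierstrassPExcept 0 v) -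
      v * (L.weierstrassP (k - v) - L.weierstrassPExcept 0 v) -
      v ^ 2 * (L.derivWeierstrassP (k - v) - L.derivWeierstrassPExcept 0 v) / 2) 0 := by fun_prop
  have h := (hnum.div hden (by simp)).tendsto.mono_left (nhdsWithin_le_nhds (s := {(0 : ℂ)}ᶜ))
  simp only [sub_zero, zetaRegular_zero, sub_self, Pi.div_apply] at h
  simp only [ne_eq, OfNat.ofNat_ne_zero, not_false_eq_true, zero_pow, zero_mul, sub_self,
    zero_div] at h
  refine h.congr' ?_
  filter_upwards [eventually_addition_domain L hk, self_mem_nhdsWithin] with v ⟨hv1, hv2, hv3⟩ hv0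
  have hv0 : v ≠ 0 := hv0
  have e : v ^ 2 * L.weierstrassP (k - v) - 1 - v ^ 2 * L.weierstrassPExcept 0 v =
      v ^ 2 * (L.weierstrassP (k - v) - L.weierstrassP v) := by
    rw [weierstrassP_eq L v]; field_simp; ring
  rw [Pi.div_apply, e, div_eq_div_iff (mul_ne_zero (pow_ne_zero 2 hv0) hv3) hv3, additionDefect,
    weierstrassZeta_eq L v, derivWeierstrassP_eq L v, weierstrassP_eq L v]
  field_simp
  ring

lemma eventually_additionDefect_eq_zero (L : PeriodPair) {k : ℂ} (hk : k ∉ L.lattice) :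
    ∀ᶠ v in 𝓝[≠] (0 : ℂ), additionDefect L k v = 0 := by
  obtain ⟨ε, hε, hball⟩ := Metric.mem_nhdsWithin_iff.mp (eventually_addition_domain L hk)
  rw [eventually_nhdsWithin_iff]
  filter_upwards [Metric.ball_mem_nhds (0 : ℂ) hε] with v hv hv0
  have hv0 : v ≠ 0 := hv0
  set D := fun v => additionDefect L k v / (L.weierstrassP (k - v) - L.weierstrassP v) with hD
  -- The quotient has zero derivative on a punctured disc. It is followed along the ray s ↦ s v for
  -- 0 < s ≤ 1, on which it is constant, and its limit as s → 0 is 0.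
  have hmem : ∀ s : ℝ, s ∈ Ioc (0 : ℝ) 1 → (s : ℂ) * v ∈ Metric.ball 0 ε ∩ {0}ᶜ := by
    intro s hs
    refine ⟨?_, mul_ne_zero (by exact_mod_cast hs.1.ne') hv0⟩
    rw [mem_ball_zero_iff] at hv ⊢
    rw [norm_mul, Complex.norm_real, Real.norm_of_nonneg hs.1.le]
    nlinarith [norm_nonneg v, hs.1, hs.2]
  have hder : ∀ s ∈ Ioc (0 : ℝ) 1, HasDerivAt (fun s : ℝ => D (s * v)) 0 s := by
    intro s hs
    obtain ⟨h1, h2, h3⟩ := hball (hmem s hs)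
    have hl : HasDerivAt (fun s : ℝ => (s : ℂ) * v) v s := by
      simpa using (Complex.ofRealCLM.hasDerivAt (x := s)).mul_const v
    have := HasDerivAt.scomp (h := fun s : ℝ => (s : ℂ) * v) s
      (hasDerivAt_additionDefect_div L h1 h2 h3) hl
    simpa [Function.comp_def] using this
  have hconst : ∀ s ∈ Ioc (0 : ℝ) 1, D (s * v) = D v := by
    intro s hs
    have := (convex_Ioc (0 : ℝ) 1).norm_image_sub_le_of_norm_hasDerivWithin_le (C := 0)
      (fun x hx => (hder x hx).hasDerivWithinAt) (by simp) hs (right_mem_Ioc.mpr one_pos)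
    simp only [zero_mul, norm_le_zero_iff, sub_eq_zero] at this
    simpa using this.symm
  have hlim : Tendsto (fun s : ℝ => D (s * v)) (𝓝[>] 0) (𝓝 0) := by
    refine (tendsto_additionDefect_div L hk).comp (tendsto_nhdsWithin_iff.mpr ⟨?_, ?_⟩)
    · have : Continuous fun s : ℝ => (s : ℂ) * v := by fun_prop
      simpa using (this.tendsto 0).mono_left nhdsWithin_le_nhds
    · filter_upwards [Ioc_mem_nhdsGT (zero_lt_one (α := ℝ))] with s hs
      exact (hmem s hs).2
  have hlim2 : Tendsto (fun s : ℝ => D (s * v)) (𝓝[>] 0) (𝓝 (D v)) := by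
    refine tendsto_const_nhds.congr' ?_
    filter_upwards [Ioc_mem_nhdsGT (zero_lt_one (α := ℝ))] with s hs
    exact (hconst s hs).symm
  have h0 := tendsto_nhds_unique hlim2 hlim
  obtain ⟨-, -, h3⟩ := hball ⟨hv, hv0⟩
  exact (div_eq_zero_iff.mp h0).resolve_right h3

/-- The addition theorem for the zeta function. -/
lemma weierstrassZeta_addition (L : PeriodPair) {k v : ℂ} (hk : k ∉ L.lattice)
    (hv : v ∉ L.lattice) (hkv : k - v ∉ L.lattice) :
    (weierstrassZeta L k - weierstrassZeta L (k - v) - weierstrassZeta L v) *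
      (L.weierstrassP (k - v) - L.weierstrassP v) =
      (L.derivWeierstrassP (k - v) - L.derivWeierstrassP v) / 2 := by
  -- Both v and k - v have to avoid the lattice. The excluded set is countable, so its complement is
  -- connected and the vanishing near 0 spreads by the identity theorem.
  set S : Set ℂ := (L.lattice : Set ℂ) ∪ (fun v => k - v) ⁻¹' (L.lattice : Set ℂ) with hS
  have hScount : S.Countable :=
    (countable_lattice L).union ((countable_lattice L).preimage (sub_right_injective))
  have hSopen : IsOpen Sᶜ := by
    rw [hS, compl_union, ← preimage_compl]
    exact (isOpen_compl_lattice L).inter ((isOpen_compl_lattice L).preimage (by fun_prop))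
  have hmem : ∀ {v}, v ∈ Sᶜ ↔ v ∉ L.lattice ∧ k - v ∉ L.lattice := by
    intro v; simp [hS]
  have han : AnalyticOnNhd ℂ (additionDefect L k) Sᶜ := by
    refine DifferentiableOn.analyticOnNhd (fun v hv => ?_) hSopen
    obtain ⟨h1, h2⟩ := hmem.mp hv
    exact (((hasDerivAt_addition_zeta L h1 h2).mul (hasDerivAt_addition_den L h1 h2)).sub
      ((hasDerivAt_addition_num L h1 h2).div_const
        2)).differentiableAt.differentiableWithinAt
  obtain ⟨ε, hε, hball⟩ := Metric.mem_nhdsWithin_iff.mp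
    ((eventually_addition_domain L hk).and (eventually_additionDefect_eq_zero L hk))
  have hz : ((ε / 2 : ℝ) : ℂ) ∈ Metric.ball (0 : ℂ) ε ∩ {0}ᶜ := by
    refine ⟨?_, by simpa using hε.ne'⟩
    rw [mem_ball_zero_iff, Complex.norm_real, Real.norm_of_nonneg (by positivity)]
    linarith
  have h0 := han.eqOn_zero_of_preconnected_of_eventuallyEq_zero
    (isPreconnected_compl_of_countable hScount)
    (hmem.mpr ⟨(hball hz).1.1, (hball hz).1.2.1⟩) (by
      filter_upwards [(Metric.isOpen_ball.inter isOpen_compl_singleton).mem_nhds hz] with y hy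
      exact (hball hy).2)
  exact sub_eq_zero.mp (h0 (hmem.mpr ⟨hv, hkv⟩))

section Conjugation

open ComplexConjugate

/-! ### Real values of the Weierstrass function -/

/-- Comparison of leading terms: if d = zⁿ g with g(0) ≠ 0, dividing by zⁿ and letting z → 0 gives n
A(0) = B(0). The equation thus has only the zero solution among analytic functions when its index is
not a natural number. -/
lemma eventually_eq_zero_of_fuchs {d A B : ℂ → ℂ} (hd : AnalyticAt ℂ d 0)
    (hA : ContinuousAt A 0) (hB : ContinuousAt B 0)
    (hAB : ∀ n : ℕ, A 0 * n ≠ B 0)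
    (h : ∀ᶠ z in 𝓝[≠] (0 : ℂ), A z * (z * deriv d z) = B z * d z) : ∀ᶠ z in 𝓝 0, d z = 0 := by
  by_contra hne
  obtain ⟨n, g, hg, hg0, hdg⟩ := hd.exists_eventuallyEq_pow_smul_nonzero_iff.mpr hne
  simp only [sub_zero, smul_eq_mul] at hdg
  have h1 : ∀ᶠ z in 𝓝[≠] (0 : ℂ), A z * (n * g z + z * deriv g z) - B z * g z = 0 := by
    filter_upwards [h, self_mem_nhdsWithin, hdg.filter_mono nhdsWithin_le_nhds,
      hdg.eventually_nhds.filter_mono nhdsWithin_le_nhds,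
      hg.eventually_analyticAt.filter_mono nhdsWithin_le_nhds] with z hz hz0 hdz hdz' hgz
    have hz0 : z ≠ 0 := hz0
    have e : deriv d z = n * z ^ (n - 1) * g z + z ^ n * deriv g z := by
      rw [EventuallyEq.deriv_eq hdz']
      exact ((hasDerivAt_pow n z).mul hgz.differentiableAt.hasDerivAt).deriv
    have e2 : z * ((n : ℂ) * z ^ (n - 1)) = n * z ^ n := by
      rcases n with _ | n
      · simp
      · simp [pow_succ]; ring
    rw [hdz, e] at hz
    have : z ^ n * (A z * (n * g z + z * deriv g z) - B z * g z) = 0 := by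
      linear_combination hz - A z * g z * e2
    exact (mul_eq_zero.mp this).resolve_left (pow_ne_zero n hz0)
  have hgd : ContinuousAt (deriv g) 0 := hg.deriv.continuousAt
  have hgc := hg.continuousAt
  have hc : ContinuousAt (fun z => A z * (n * g z + z * deriv g z) - B z * g z) 0 := by fun_prop
  have h2 := tendsto_nhds_unique ((hc.tendsto.mono_left nhdsWithin_le_nhds).congr' h1)
    tendsto_const_nhds
  simp only [zero_mul, add_zero] at h2
  have h3 : g 0 * (A 0 * n - B 0) = 0 := by linear_combination h2
  exact hAB n (sub_eq_zero.mp ((mul_eq_zero.mp h3).resolve_left hg0))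

lemma hasDerivAt_conj_comp_conj {f : ℂ → ℂ} {f' z : ℂ} (h : HasDerivAt f f' (conj z)) :
    HasDerivAt (fun z => conj (f (conj z))) (conj f') z := by
  simpa [Function.comp_def] using h.conj_conj

/-- Real invariants make ℘(z) and the conjugate of ℘ at conj z solutions of the same Weierstrass
equation with the same polar part. Subtracting the two equations yields a singular linear equation
for the difference of the regular parts, with A(0) = -4 and B(0) = 12. Its index is -3, so the
difference vanishes. No symmetry of the lattice is presupposed. -/
lemma eventually_weierstrassP_conj (L : PeriodPair) (h2 : L.g₂.im = 0) (h3 : L.g₃.im = 0) :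
    ∀ᶠ z in 𝓝[≠] (0 : ℂ), L.weierstrassP z = conj (L.weierstrassP (conj z)) := by
  have hg2 : conj L.g₂ = L.g₂ := Complex.conj_eq_iff_im.mpr h2
  have hg3 : conj L.g₃ = L.g₃ := Complex.conj_eq_iff_im.mpr h3
  have cc : ContinuousAt (fun z : ℂ => conj z) 0 := Complex.continuous_conj.continuousAt
  have tc : Tendsto (fun z : ℂ => conj z) (𝓝[≠] 0) (𝓝[≠] 0) := by
    refine tendsto_nhdsWithin_iff.mpr ⟨?_, ?_⟩
    · simpa using cc.tendsto.mono_left nhdsWithin_le_nhds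
    · filter_upwards [self_mem_nhdsWithin] with z hz
      simpa using hz
  have hP := L.analyticAt_weierstrassPExcept 0
  have c1 := hP.continuousAt
  have c2 : ContinuousAt (L.derivWeierstrassPExcept 0) 0 :=
    (L.analyticAt_derivWeierstrassPExcept 0).continuousAt
  have c1' : ContinuousAt (fun z => conj (L.weierstrassPExcept 0 (conj z))) 0 :=
    Complex.continuous_conj.continuousAt.comp
      (ContinuousAt.comp (g := L.weierstrassPExcept 0) (by simpa using c1) cc)
  have c2' : ContinuousAt (fun z => conj (L.derivWeierstrassPExcept 0 (conj z))) 0 :=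
    Complex.continuous_conj.continuousAt.comp
      (ContinuousAt.comp (g := L.derivWeierstrassPExcept 0) (by simpa using c2) cc)
  have hd : AnalyticAt ℂ
      (fun z => L.weierstrassPExcept 0 z - conj (L.weierstrassPExcept 0 (conj z))) 0 := by
    refine hP.sub (Complex.analyticAt_iff_eventually_differentiableAt.mpr ?_)
    have := cc.tendsto.eventually (p := AnalyticAt ℂ (L.weierstrassPExcept 0))
      (by simpa using hP.eventually_analyticAt)
    filter_upwards [this] with z hz
    exact (hasDerivAt_conj_comp_conj hz.differentiableAt.hasDerivAt).differentiableAt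
  have hn := eventually_notMem_lattice L 0
  have hev := eventually_eq_zero_of_fuchs hd
    (A := fun z => z ^ 3 * (L.derivWeierstrassPExcept 0 z +
      conj (L.derivWeierstrassPExcept 0 (conj z))) - 4)
    (B := fun z => 4 * ((1 + z ^ 2 * L.weierstrassPExcept 0 z) ^ 2 +
      (1 + z ^ 2 * L.weierstrassPExcept 0 z) *
        (1 + z ^ 2 * conj (L.weierstrassPExcept 0 (conj z))) +
      (1 + z ^ 2 * conj (L.weierstrassPExcept 0 (conj z))) ^ 2) - L.g₂ * z ^ 4)
    (by fun_prop) (by fun_prop) (fun n => ?_) ?_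
  · filter_upwards [hev.filter_mono nhdsWithin_le_nhds] with z hz
    rw [weierstrassP_eq, weierstrassP_eq]
    simp only [map_add, map_div₀, map_one, map_pow, Complex.conj_conj]
    rw [sub_eq_zero.mp hz]
  · simp only [ne_eq, OfNat.ofNat_ne_zero, not_false_eq_true, zero_pow, zero_mul, zero_sub,
      add_zero, mul_zero, sub_zero]
    intro h
    have h := congrArg Complex.re h
    simp only [Complex.mul_re, Complex.neg_re, Complex.neg_im, Complex.re_ofNat, Complex.im_ofNat,
      Complex.natCast_re, Complex.natCast_im, one_pow, mul_one, Complex.add_re,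
      Complex.add_im, Complex.one_re, Complex.one_im] at h
    have : (0 : ℝ) ≤ n := n.cast_nonneg
    linarith
  · filter_upwards [hn, tc.eventually hn, self_mem_nhdsWithin] with z hz hz' hz0
    have hz0 : z ≠ 0 := hz0
    have hE : HasDerivAt (L.weierstrassPExcept 0) (L.derivWeierstrassPExcept 0 z) z := by
      have hm : z ∈ ((L.lattice : Set ℂ) \ {0})ᶜ := by simp [hz]
      rw [← L.eqOn_deriv_weierstrassPExcept_derivWeierstrassPExcept 0 hm]
      exact (L.analyticOnNhd_weierstrassPExcept 0 z hm).differentiableAt.hasDerivAt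
    have hE' : HasDerivAt (L.weierstrassPExcept 0) (L.derivWeierstrassPExcept 0 (conj z))
        (conj z) := by
      have hm : conj z ∈ ((L.lattice : Set ℂ) \ {0})ᶜ := by simp [hz']
      rw [← L.eqOn_deriv_weierstrassPExcept_derivWeierstrassPExcept 0 hm]
      exact (L.analyticOnNhd_weierstrassPExcept 0 _ hm).differentiableAt.hasDerivAt
    rw [(hE.fun_sub (hasDerivAt_conj_comp_conj hE')).deriv]
    have e1 := L.derivWeierstrassP_sq z hz
    have e2 := congrArg conj (L.derivWeierstrassP_sq (conj z) hz')
    rw [weierstrassP_eq, derivWeierstrassP_eq] at e1 e2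
    simp only [map_sub, map_mul, map_pow, map_add, map_div₀, map_one, map_ofNat,
      Complex.conj_conj, hg2, hg3] at e2
    generalize L.weierstrassPExcept 0 z = a at *
    generalize L.derivWeierstrassPExcept 0 z = a' at *
    generalize conj (L.weierstrassPExcept 0 (conj z)) = b at *
    generalize conj (L.derivWeierstrassPExcept 0 (conj z)) = b' at *
    field_simp at e1 e2
    have : z ^ 2 * ((z ^ 3 * (a' + b') - 4) * (z * (a' - b')) -
      (4 * ((1 + z ^ 2 * a) ^ 2 + (1 + z ^ 2 * a) * (1 + z ^ 2 * b) + (1 + z ^ 2 * b) ^ 2) -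
        L.g₂ * z ^ 4) * (a - b)) = 0 := by
      linear_combination e1 - e2
    exact sub_eq_zero.mp ((mul_eq_zero.mp this).resolve_left (pow_ne_zero 2 hz0))

/-- With real invariants, the Weierstrass function is real on the real line. -/
lemma weierstrassP_ofReal_im (L : PeriodPair) (h2 : L.g₂.im = 0) (h3 : L.g₃.im = 0) (x : ℝ) :
    (L.weierstrassP x).im = 0 := by
  by_cases hx : (x : ℂ) ∈ L.lattice
  · rw [L.weierstrassP_coe ⟨_, hx⟩]; rfl
  set S : Set ℂ := (L.lattice : Set ℂ) ∪ (fun v => conj v) ⁻¹' (L.lattice : Set ℂ) with hS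
  have hScount : S.Countable := (countable_lattice L).union
    ((countable_lattice L).preimage (star_involutive.injective))
  have hSopen : IsOpen Sᶜ := by
    rw [hS, compl_union, ← preimage_compl]
    exact (isOpen_compl_lattice L).inter
      ((isOpen_compl_lattice L).preimage Complex.continuous_conj)
  have hmem : ∀ {v}, v ∈ Sᶜ ↔ v ∉ L.lattice ∧ conj v ∉ L.lattice := by
    intro v; simp [hS]
  have han : AnalyticOnNhd ℂ (fun z => L.weierstrassP z - conj (L.weierstrassP (conj z))) Sᶜ := by
    refine DifferentiableOn.analyticOnNhd (fun v hv => ?_) hSopen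
    obtain ⟨h1, h2⟩ := hmem.mp hv
    exact ((hasDerivAt_weierstrassP L h1).sub (hasDerivAt_conj_comp_conj
      (hasDerivAt_weierstrassP L h2))).differentiableAt.differentiableWithinAt
  have tc : Tendsto (fun z : ℂ => conj z) (𝓝[≠] 0) (𝓝[≠] 0) := by
    refine tendsto_nhdsWithin_iff.mpr ⟨?_, ?_⟩
    · have cc : ContinuousAt (fun z : ℂ => conj z) 0 := Complex.continuous_conj.continuousAt
      simpa using cc.tendsto.mono_left nhdsWithin_le_nhds
    · filter_upwards [self_mem_nhdsWithin] with z hz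
      simpa using hz
  have hn := eventually_notMem_lattice L 0
  obtain ⟨ε, hε, hball⟩ := Metric.mem_nhdsWithin_iff.mp
    ((hn.and (tc.eventually hn)).and (eventually_weierstrassP_conj L h2 h3))
  have hz : ((ε / 2 : ℝ) : ℂ) ∈ Metric.ball (0 : ℂ) ε ∩ {0}ᶜ := by
    refine ⟨?_, by simpa using hε.ne'⟩
    rw [mem_ball_zero_iff, Complex.norm_real, Real.norm_of_nonneg (by positivity)]
    linarith
  have h0 := han.eqOn_zero_of_preconnected_of_eventuallyEq_zero
    (isPreconnected_compl_of_countable hScount)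
    (hmem.mpr (hball hz).1) (by
      filter_upwards [(Metric.isOpen_ball.inter isOpen_compl_singleton).mem_nhds hz] with y hy
      exact sub_eq_zero.mpr (hball hy).2)
  have h1 := h0 (hmem.mpr ⟨hx, by simpa using hx⟩)
  simp only [Complex.conj_ofReal, Pi.zero_apply] at h1
  exact Complex.conj_eq_iff_im.mp (sub_eq_zero.mp h1).symm

/-- The Weierstrass function on the real line. -/
def realP (L : PeriodPair) (x : ℝ) : ℝ := (L.weierstrassP x).re

/-- The derivative of the Weierstrass function on the real line. -/
def realP' (L : PeriodPair) (x : ℝ) : ℝ := (L.derivWeierstrassP x).re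

lemma ofReal_realP (L : PeriodPair) (h2 : L.g₂.im = 0) (h3 : L.g₃.im = 0) (x : ℝ) :
    (realP L x : ℂ) = L.weierstrassP x :=
  Complex.ext rfl (by simp [weierstrassP_ofReal_im L h2 h3])

lemma hasDerivAt_realP (L : PeriodPair) {x : ℝ} (hx : (x : ℂ) ∉ L.lattice) :
    HasDerivAt (realP L) (realP' L x) x :=
  HasDerivAt.real_of_complex (hasDerivAt_weierstrassP L hx)

lemma ofReal_realP' (L : PeriodPair) (h2 : L.g₂.im = 0) (h3 : L.g₃.im = 0) {x : ℝ}
    (hx : (x : ℂ) ∉ L.lattice) : (realP' L x : ℂ) = L.derivWeierstrassP x := by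
  have h4 := (hasDerivAt_realP L hx).ofReal_comp
  simp_rw [ofReal_realP L h2 h3] at h4
  exact h4.unique (hasDerivAt_weierstrassP L hx).comp_ofReal

lemma hasDerivAt_realP' (L : PeriodPair) (h2 : L.g₂.im = 0) (h3 : L.g₃.im = 0)
    {x : ℝ} (hx : (x : ℂ) ∉ L.lattice) :
    HasDerivAt (realP' L) (6 * realP L x ^ 2 - L.g₂.re / 2) x := by
  have h4 : HasDerivAt (realP' L) _ x :=
    HasDerivAt.real_of_complex (hasDerivAt_derivWeierstrassP L hx)
  refine h4.congr_deriv ?_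
  have e2 : (L.g₂.re : ℂ) = L.g₂ := Complex.ext rfl (by simp [h2])
  have e : 6 * L.weierstrassP x ^ 2 - L.g₂ / 2 = ((6 * realP L x ^ 2 - L.g₂.re / 2 : ℝ) : ℂ) := by
    push_cast
    rw [ofReal_realP L h2 h3, e2]
  rw [e, Complex.ofReal_re]

lemma realP'_sq (L : PeriodPair) (h2 : L.g₂.im = 0) (h3 : L.g₃.im = 0)
    {x : ℝ} (hx : (x : ℂ) ∉ L.lattice) :
    realP' L x ^ 2 = 4 * realP L x ^ 3 - L.g₂.re * realP L x - L.g₃.re := by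
  have e2 : (L.g₂.re : ℂ) = L.g₂ := Complex.ext rfl (by simp [h2])
  have e3 : (L.g₃.re : ℂ) = L.g₃ := Complex.ext rfl (by simp [h3])
  have := L.derivWeierstrassP_sq x hx
  rw [← ofReal_realP L h2 h3, ← ofReal_realP' L h2 h3 hx, ← e2, ← e3] at this
  exact_mod_cast this

lemma continuousAt_re_comp_ofReal {f : ℂ → ℂ} (hf : ContinuousAt f 0) :
    ContinuousAt (fun x : ℝ => (f x).re) 0 :=
  Complex.continuous_re.continuousAt.comp
    (ContinuousAt.comp (g := f) (by simpa using hf) Complex.continuous_ofReal.continuousAt)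

lemma tendsto_realP_zero (L : PeriodPair) : Tendsto (realP L) (𝓝[>] 0) atTop := by
  have h1 : Tendsto (fun x : ℝ => (L.weierstrassPExcept 0 x).re) (𝓝[>] 0) (𝓝 _) :=
    (continuousAt_re_comp_ofReal (continuousAt_weierstrassPExcept L 0)).tendsto.mono_left
      nhdsWithin_le_nhds
  have h2 : Tendsto (fun x : ℝ => (x⁻¹) ^ 2) (𝓝[>] 0) atTop :=
    (tendsto_pow_atTop two_ne_zero).comp tendsto_inv_nhdsGT_zero
  refine (h1.add_atTop h2).congr fun x => ?_
  rw [realP, weierstrassP_eq, Complex.add_re]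
  congr 1
  rw [inv_pow, one_div, ← Complex.ofReal_pow, ← Complex.ofReal_inv, Complex.ofReal_re]

lemma tendsto_realP'_zero (L : PeriodPair) : Tendsto (realP' L) (𝓝[>] 0) atBot := by
  have h1 : Tendsto (fun x : ℝ => (L.derivWeierstrassPExcept 0 x).re) (𝓝[>] 0) (𝓝 _) :=
    (continuousAt_re_comp_ofReal
      (L.analyticAt_derivWeierstrassPExcept 0).continuousAt).tendsto.mono_left nhdsWithin_le_nhds
  have h2 : Tendsto (fun x : ℝ => -(2 * (x⁻¹) ^ 3)) (𝓝[>] 0) atBot :=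
    tendsto_neg_atTop_atBot.comp (((tendsto_pow_atTop three_ne_zero).comp
      tendsto_inv_nhdsGT_zero).const_mul_atTop two_pos)
  refine (h1.add_atBot h2).congr fun x => ?_
  rw [realP', derivWeierstrassP_eq, Complex.sub_re, sub_eq_add_neg]
  congr 2
  rw [inv_pow, ← div_eq_mul_inv, ← Complex.ofReal_pow, ← Complex.ofReal_ofNat,
    ← Complex.ofReal_div, Complex.ofReal_re]

end Conjugation

/-! ### Uniqueness for linear differential equations -/

/-- Grönwall's inequality on compact subintervals, where k is bounded; points to the left of x₀ are
reached by the reflection x ↦ -x. -/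
lemma eq_zero_of_norm_deriv_le {E : Type*} [NormedAddCommGroup E] [NormedSpace ℝ E]
    {f f' : ℝ → E} {k : ℝ → ℝ} {s : Set ℝ} (hs : s.OrdConnected)
    (hf : ∀ x ∈ s, HasDerivAt f (f' x) x) (hk : ContinuousOn k s)
    (hb : ∀ x ∈ s, ‖f' x‖ ≤ k x * ‖f x‖) {x₀ : ℝ} (hx₀ : x₀ ∈ s) (h0 : f x₀ = 0) :
    ∀ x ∈ s, f x = 0 := by
  intro x hx
  rcases le_total x₀ x with hle | hle
  · have hsub : Icc x₀ x ⊆ s := hs.out hx₀ hx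
    obtain ⟨K, hK⟩ := isCompact_Icc.bddAbove_image (hk.mono hsub)
    refine eq_zero_of_abs_deriv_le_mul_abs_self_of_eq_zero_right (K := K) (a := x₀) (b := x)
      (f := f) (f' := f') (fun y hy => (hf y (hsub hy)).continuousAt.continuousWithinAt)
      (fun y hy => (hf y (hsub (Ico_subset_Icc_self hy))).hasDerivWithinAt) h0
      (fun y hy => (hb y (hsub (Ico_subset_Icc_self hy))).trans ?_) x (right_mem_Icc.mpr hle)
    have := hK (mem_image_of_mem k (Ico_subset_Icc_self hy))
    gcongr
  · have hsub : Icc x x₀ ⊆ s := hs.out hx hx₀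
    obtain ⟨K, hK⟩ := isCompact_Icc.bddAbove_image (hk.mono hsub)
    have hm : ∀ y ∈ Icc (-x₀) (-x), -y ∈ Icc x x₀ := fun y hy =>
      ⟨by linarith [hy.2], by linarith [hy.1]⟩
    have hd : ∀ y ∈ Icc (-x₀) (-x), HasDerivAt (fun y => f (-y)) (-f' (-y)) y := by
      intro y hy
      have := (hf (-y) (hsub (hm y hy))).scomp y (hasDerivAt_neg y)
      simpa [Function.comp_def] using this
    have := eq_zero_of_abs_deriv_le_mul_abs_self_of_eq_zero_right (K := K) (a := -x₀) (b := -x)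
      (f := fun y => f (-y)) (f' := fun y => -f' (-y))
      (fun y hy => (hd y hy).continuousAt.continuousWithinAt)
      (fun y hy => (hd y (Ico_subset_Icc_self hy)).hasDerivWithinAt) (by simpa using h0)
      (fun y hy => by
        have hy' := hm y (Ico_subset_Icc_self hy)
        rw [norm_neg]
        refine (hb (-y) (hsub hy')).trans ?_
        have := hK (mem_image_of_mem k hy')
        gcongr) (-x) (right_mem_Icc.mpr (by linarith))
    simpa using this

lemma eq_zero_of_second_order {u u' a : ℝ → ℝ} {s : Set ℝ} (hs : s.OrdConnected)
    (hu : ∀ x ∈ s, HasDerivAt u (u' x) x) (hu' : ∀ x ∈ s, HasDerivAt u' (a x * u x) x)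
    (ha : ContinuousOn a s) {x₀ : ℝ} (hx₀ : x₀ ∈ s) (h0 : u x₀ = 0) (h1 : u' x₀ = 0) :
    ∀ x ∈ s, u x = 0 ∧ u' x = 0 := by
  intro x hx
  have := eq_zero_of_norm_deriv_le (f := fun x => (u x, u' x)) (f' := fun x => (u' x, a x * u x))
    (k := fun x => 1 + |a x|) hs (fun x hx => (hu x hx).prodMk (hu' x hx))
    (continuousOn_const.add ha.abs) (fun x hx => ?_) hx₀ (by simp [h0, h1]) x hx
  · exact ⟨congrArg Prod.fst this, congrArg Prod.snd this⟩
  · simp only [Prod.norm_def, Real.norm_eq_abs, abs_mul]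
    have h2 := le_max_left |u x| |u' x|
    have h3 := le_max_right |u x| |u' x|
    have h4 := abs_nonneg (a x)
    have h5 := abs_nonneg (u x)
    exact max_le (by nlinarith) (by nlinarith)

/-! ### Monotonicity of the Weierstrass function between real periods -/

/-- `2 w` is the smallest positive real period. -/
abbrev IsRealHalfPeriod (L : PeriodPair) (w : ℝ) : Prop :=
  IsLeast {x : ℝ | 0 < x ∧ ((2 * x : ℝ) : ℂ) ∈ L.lattice} w

lemma IsRealHalfPeriod.notMem {L : PeriodPair} {w : ℝ} (hw : IsRealHalfPeriod L w) {x : ℝ}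
    (hx : x ∈ Ioo 0 (2 * w)) : (x : ℂ) ∉ L.lattice := by
  intro h
  have := hw.2 (show x / 2 ∈ _ from ⟨by linarith [hx.1], by convert h using 2; ring⟩)
  linarith [hx.2]

lemma realP_two_mul_sub {L : PeriodPair} {w : ℝ} (hw : IsRealHalfPeriod L w) (x : ℝ) :
    realP L (2 * w - x) = realP L x := by
  have h := L.weierstrassP_add_coe (-x) ⟨_, hw.1.2⟩
  have e : ((2 * w - x : ℝ) : ℂ) = -x + ((2 * w : ℝ) : ℂ) := by push_cast; ring
  rw [realP, e, h, L.weierstrassP_neg, realP]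

lemma realP'_two_mul_sub {L : PeriodPair} {w : ℝ} (hw : IsRealHalfPeriod L w) (x : ℝ) :
    realP' L (2 * w - x) = -realP' L x := by
  have h := L.derivWeierstrassP_add_coe (-x) ⟨_, hw.1.2⟩
  have e : ((2 * w - x : ℝ) : ℂ) = -x + ((2 * w : ℝ) : ℂ) := by push_cast; ring
  rw [realP', e, h, L.derivWeierstrassP_neg, realP', Complex.neg_re]

lemma realP'_halfPeriod {L : PeriodPair} {w : ℝ} (hw : IsRealHalfPeriod L w) :
    realP' L w = 0 := by
  have := realP'_two_mul_sub hw w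
  rw [two_mul, add_sub_cancel_right] at this
  linarith

/-- If ℘'(x₀) = 0, then ℘(x₀ + h) - ℘(x₀ - h) solves a linear second order equation with zero
initial data, so ℘ is symmetric about x₀. The pole at 0 would then be reflected to 2x₀ < 2w, where ℘
is finite. -/
lemma realP'_ne_zero {L : PeriodPair} (h2 : L.g₂.im = 0) (h3 : L.g₃.im = 0) {w : ℝ}
    (hw : IsRealHalfPeriod L w) {x₀ : ℝ} (hx₀ : x₀ ∈ Ioo 0 w) : realP' L x₀ ≠ 0 := by
  intro h0
  have hmem : ∀ h ∈ Ico 0 x₀, ((x₀ + h : ℝ) : ℂ) ∉ L.lattice ∧ ((x₀ - h : ℝ) : ℂ) ∉ L.lattice :=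
    fun h hh => ⟨hw.notMem ⟨by linarith [hx₀.1, hh.1], by linarith [hx₀.2, hh.2]⟩,
      hw.notMem ⟨by linarith [hh.2], by linarith [hx₀.1, hx₀.2, hh.1]⟩⟩
  have ha : ∀ h : ℝ, HasDerivAt (fun h => x₀ + h) 1 h := fun h => (hasDerivAt_id h).const_add x₀
  have hb : ∀ h : ℝ, HasDerivAt (fun h => x₀ - h) (-1) h := fun h => (hasDerivAt_id h).const_sub x₀
  have hz := eq_zero_of_second_order (u := fun h => realP L (x₀ + h) - realP L (x₀ - h))
    (u' := fun h => realP' L (x₀ + h) + realP' L (x₀ - h))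
    (a := fun h => 6 * (realP L (x₀ + h) + realP L (x₀ - h))) (s := Ico 0 x₀) ordConnected_Ico
    (fun h hh => by
      have d1 := (hasDerivAt_realP L (hmem h hh).1).comp h (ha h)
      have d2 := (hasDerivAt_realP L (hmem h hh).2).comp h (hb h)
      exact (d1.sub d2).congr_deriv (by ring))
    (fun h hh => by
      have d1 := (hasDerivAt_realP' L h2 h3 (hmem h hh).1).comp h (ha h)
      have d2 := (hasDerivAt_realP' L h2 h3 (hmem h hh).2).comp h (hb h)
      exact (d1.add d2).congr_deriv (by ring))
    (fun h hh => by
      have d1 := (hasDerivAt_realP L (hmem h hh).1).comp h (ha h)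
      have d2 := (hasDerivAt_realP L (hmem h hh).2).comp h (hb h)
      exact (continuousAt_const.mul
        (d1.continuousAt.add d2.continuousAt)).continuousWithinAt)
    (x₀ := 0) ⟨le_rfl, hx₀.1⟩ (by simp) (by simp [h0])
  have hlim1 : Tendsto (fun h => realP L (2 * x₀ - h)) (𝓝[>] 0) (𝓝 (realP L (2 * x₀ - 0))) := by
    refine ((ContinuousAt.comp (g := realP L) (hasDerivAt_realP L ?_).continuousAt
      (by fun_prop)).tendsto).mono_left nhdsWithin_le_nhds
    exact hw.notMem ⟨by linarith [hx₀.1], by linarith [hx₀.2]⟩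
  have hlim2 := tendsto_realP_zero L
  refine not_tendsto_nhds_of_tendsto_atTop hlim2 _ (hlim1.congr' ?_)
  filter_upwards [Ioc_mem_nhdsGT hx₀.1] with h hh
  have := (hz (x₀ - h) ⟨by linarith [hh.2], by linarith [hh.1]⟩).1
  have e1 : x₀ + (x₀ - h) = 2 * x₀ - h := by ring
  have e2 : x₀ - (x₀ - h) = h := by ring
  rw [e1, e2] at this
  linarith

/-- ℘' tends to -∞ at 0 from the right and has no zero before w, so it cannot change sign. -/
lemma realP'_neg {L : PeriodPair} (h2 : L.g₂.im = 0) (h3 : L.g₃.im = 0) {w : ℝ}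
    (hw : IsRealHalfPeriod L w) {x : ℝ} (hx : x ∈ Ioo 0 w) : realP' L x < 0 := by
  by_contra! hneg
  have h1 := ((tendsto_realP'_zero L).eventually_lt_atBot 0).and (Ioc_mem_nhdsGT hx.1)
  obtain ⟨y, hy1, hy2⟩ := h1.exists
  have hsub : Icc y x ⊆ Ioo 0 w := fun z hz => ⟨hy2.1.trans_le hz.1, hz.2.trans_lt hx.2⟩
  have hc : ContinuousOn (realP' L) (Icc y x) := fun z hz =>
    (hasDerivAt_realP' L h2 h3 (hw.notMem ⟨(hsub hz).1, by
      linarith [(hsub hz).2, hx.1, hx.2]⟩)).continuousAt.continuousWithinAt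
  obtain ⟨z, hz, hz0⟩ := intermediate_value_Icc hy2.2 hc ⟨hy1.le, hneg⟩
  exact realP'_ne_zero h2 h3 hw (hsub hz) hz0

lemma realP_strictAntiOn {L : PeriodPair} (h2 : L.g₂.im = 0) (h3 : L.g₃.im = 0) {w : ℝ}
    (hw : IsRealHalfPeriod L w) : StrictAntiOn (realP L) (Ioc 0 w) := by
  refine strictAntiOn_of_deriv_neg (convex_Ioc 0 w) (fun x hx => ?_) (fun x hx => ?_)
  · exact (hasDerivAt_realP L (hw.notMem ⟨hx.1, by
      linarith [hx.1, hx.2]⟩)).continuousAt.continuousWithinAt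
  · rw [interior_Ioc] at hx
    rw [(hasDerivAt_realP L (hw.notMem ⟨hx.1, by linarith [hx.1, hx.2]⟩)).deriv]
    exact realP'_neg h2 h3 hw hx

lemma realP_halfPeriod_le {L : PeriodPair} (h2 : L.g₂.im = 0) (h3 : L.g₃.im = 0) {w : ℝ}
    (hw : IsRealHalfPeriod L w) {x : ℝ} (hx : x ∈ Ioo 0 (2 * w)) :
    realP L w ≤ realP L x := by
  have hw0 : 0 < w := hw.1.1
  rcases le_total x w with h | h
  · exact (realP_strictAntiOn h2 h3 hw).antitoneOn ⟨hx.1, h⟩ ⟨hw0, le_rfl⟩ h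
  · rw [← realP_two_mul_sub hw x]
    exact (realP_strictAntiOn h2 h3 hw).antitoneOn ⟨by linarith [hx.2], by linarith⟩
      ⟨hw0, le_rfl⟩ (by linarith)

/-- `℘(w)` is the largest real root of the cubic. -/
lemma cubic_pos_of_gt {L : PeriodPair} (h2 : L.g₂.im = 0) (h3 : L.g₃.im = 0) {w : ℝ}
    (hw : IsRealHalfPeriod L w) {v : ℝ} (hv : realP L w < v) :
    0 < 4 * v ^ 3 - L.g₂.re * v - L.g₃.re := by
  have hw0 : 0 < w := hw.1.1
  obtain ⟨y, hy1, hy2⟩ := (((tendsto_realP_zero L).eventually_gt_atTop v).and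
    (Ioc_mem_nhdsGT hw0)).exists
  have hm : ∀ x ∈ Icc y w, (x : ℂ) ∉ L.lattice := fun x hx =>
    hw.notMem ⟨hy2.1.trans_le hx.1, by linarith [hx.2]⟩
  -- Every v above ℘(w) is a value ℘(x) with 0 < x < w, and there the cubic equals ℘'(x)².
  obtain ⟨x, hx, rfl⟩ := intermediate_value_Icc' hy2.2
    (fun x hx => (hasDerivAt_realP L (hm x hx)).continuousAt.continuousWithinAt) ⟨hv.le, hy1.le⟩
  rw [← realP'_sq L h2 h3 (hm x hx)]
  have hxw : x ≠ w := by rintro rfl; exact hv.ne rfl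
  have := realP'_neg h2 h3 hw ⟨hy2.1.trans_le hx.1, lt_of_le_of_ne hx.2 hxw⟩
  exact sq_pos_of_neg this

/-! ### Lamé functions -/

/-- The Lamé function `σ(u - a) / σ(u) exp(ζ(a) u)`. -/
def lame (L : PeriodPair) (a u : ℂ) : ℂ :=
  weierstrassSigma L (u - a) / weierstrassSigma L u * Complex.exp (weierstrassZeta L a * u)

lemma eq_zero_of_continuousAt_of_countable {F : ℂ → ℂ} {S : Set ℂ} (hS : S.Countable)
    (h : ∀ u ∈ Sᶜ, F u = 0) {u : ℂ} (hF : ContinuousAt F u) : F u = 0 := by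
  have hd : Dense Sᶜ := hS.dense_compl ℂ
  have : (𝓝[Sᶜ] u).NeBot := mem_closure_iff_nhdsWithin_neBot.mp (hd u)
  have h1 : Tendsto F (𝓝[Sᶜ] u) (𝓝 (F u)) := hF.tendsto.mono_left nhdsWithin_le_nhds
  refine tendsto_nhds_unique h1 (tendsto_const_nhds.congr' ?_)
  filter_upwards [self_mem_nhdsWithin] with v hv
  exact (h v hv).symm

lemma analyticOnNhd_lame (L : PeriodPair) (a : ℂ) :
    AnalyticOnNhd ℂ (lame L a) (L.lattice : Set ℂ)ᶜ := by
  refine DifferentiableOn.analyticOnNhd (fun u hu => ?_) (isOpen_compl_lattice L)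
  have h1 := differentiable_weierstrassSigma L
  have h2 : DifferentiableAt ℂ (fun u => weierstrassSigma L (u - a)) u :=
    (h1 (u - a)).comp u (differentiableAt_id.sub_const a)
  exact ((h2.div (h1 u) (weierstrassSigma_ne_zero L hu)).mul
    (by fun_prop)).differentiableWithinAt

lemma hasDerivAt_lame (L : PeriodPair) {a u : ℂ} (hu : u ∉ L.lattice) :
    HasDerivAt (lame L a) (deriv (lame L a) u) u :=
  (analyticOnNhd_lame L a u hu).differentiableAt.hasDerivAt

lemma deriv_lame_of_sub_notMem (L : PeriodPair) {a u : ℂ} (hu : u ∉ L.lattice)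
    (hua : u - a ∉ L.lattice) : deriv (lame L a) u =
      (weierstrassZeta L (u - a) - weierstrassZeta L u + weierstrassZeta L a) * lame L a u := by
  have h0 := weierstrassSigma_ne_zero L hu
  have h1 := (hasDerivAt_weierstrassSigma L hua).comp u ((hasDerivAt_id u).sub_const a)
  have h2 := hasDerivAt_weierstrassSigma L hu
  have h3 := ((hasDerivAt_id u).const_mul (weierstrassZeta L a)).cexp
  have h4 : HasDerivAt (lame L a) _ u := (h1.div h2 h0).mul h3
  rw [h4.deriv, lame]
  simp only [Function.comp_apply, id, Pi.div_apply]
  field_simp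

/-- The logarithmic derivative is ζ(u - a) - ζ(u) + ζ(a), which the addition theorem with k = u - a
and v = -a turns into a quotient of ℘ and ℘'. At the points of a + lattice, where ζ(u - a) is not
available, the equation persists by continuity. -/
lemma lame_first_order (L : PeriodPair) {a u : ℂ} (ha : a ∉ L.lattice) (hu : u ∉ L.lattice) :
    (L.weierstrassP u - L.weierstrassP a) * deriv (lame L a) u =
      (L.derivWeierstrassP u + L.derivWeierstrassP a) / 2 * lame L a u := by
  have h1 := (hasDerivAt_weierstrassP L hu).continuousAt
  have h2 := (hasDerivAt_derivWeierstrassP L hu).continuousAt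
  have h3 := (analyticOnNhd_lame L a u hu).continuousAt
  have h4 := ((analyticOnNhd_lame L a).deriv u hu).continuousAt
  rw [← sub_eq_zero]
  refine eq_zero_of_continuousAt_of_countable (F := fun u =>
    (L.weierstrassP u - L.weierstrassP a) * deriv (lame L a) u -
      (L.derivWeierstrassP u + L.derivWeierstrassP a) / 2 * lame L a u)
    (S := (L.lattice : Set ℂ) ∪ (fun u => u - a) ⁻¹' (L.lattice : Set ℂ))
    ((countable_lattice L).union ((countable_lattice L).preimage (sub_left_injective)))
    (fun v hv => ?_) (by fun_prop)
  rw [compl_union] at hv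
  obtain ⟨hv1, hv2⟩ := hv
  have hna : -a ∉ L.lattice := fun h => ha (by simpa using neg_mem h)
  have h5 := weierstrassZeta_addition L (k := v - a) (v := -a) hv2 hna (by simpa using hv1)
  rw [sub_neg_eq_add, sub_add_cancel, weierstrassZeta_neg, L.weierstrassP_neg,
    L.derivWeierstrassP_neg] at h5
  rw [deriv_lame_of_sub_notMem L hv1 hv2]
  linear_combination lame L a v * h5

/-- The Lamé equation. -/
lemma lame_second_order (L : PeriodPair) {a u : ℂ} (ha : a ∉ L.lattice) (hu : u ∉ L.lattice) :
    deriv (deriv (lame L a)) u = (2 * L.weierstrassP u + L.weierstrassP a) * lame L a u := by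
  have hP := L.analyticOnNhd_weierstrassP
  have hl := analyticOnNhd_lame L a
  -- Differentiating the first order equation and eliminating the first derivative with it gives the
  -- Lamé equation only up to this square, which is then cancelled as a non-zero analytic function.
  have key : ∀ u ∈ (L.lattice : Set ℂ)ᶜ, (L.weierstrassP u - L.weierstrassP a) ^ 2 *
      (deriv (deriv (lame L a)) u - (2 * L.weierstrassP u + L.weierstrassP a) * lame L a u) = 0 := by
    intro u hu
    have d1 := hasDerivAt_weierstrassP L hu
    have d2 := hasDerivAt_derivWeierstrassP L hu
    have d3 := hasDerivAt_lame L (a := a) hu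
    have d4 := (hl.deriv u hu).differentiableAt.hasDerivAt
    have e1 := (d1.sub_const (L.weierstrassP a)).mul d4
    have e2 := ((d2.add_const (L.derivWeierstrassP a)).div_const 2).mul d3
    have e3 := e1.unique (e2.congr_of_eventuallyEq (by
      filter_upwards [(isOpen_compl_lattice L).mem_nhds hu] with v hv
      exact lame_first_order L ha hv))
    have e4 := lame_first_order L ha hu
    have e5 := L.derivWeierstrassP_sq u hu
    have e6 := L.derivWeierstrassP_sq a ha
    linear_combination (L.weierstrassP u - L.weierstrassP a) * e3
      - (L.derivWeierstrassP u - L.derivWeierstrassP a) / 2 * e4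
      - lame L a u / 4 * e5 + lame L a u / 4 * e6
  rcases AnalyticOnNhd.eq_zero_or_eq_zero_of_mul_eq_zero
    ((hP.sub (analyticOnNhd_const (v := L.weierstrassP a))).pow 2)
    (hl.deriv.deriv.sub ((((analyticOnNhd_const (v := (2 : ℂ))).mul hP).add
      (analyticOnNhd_const (v := L.weierstrassP a))).mul hl)) key
    (isPreconnected_compl_of_countable (countable_lattice L)) with h | h
  · exfalso
    obtain ⟨z, hz, hz'⟩ := exists_derivWeierstrassP_ne_zero L
    refine hz' ((hasDerivAt_weierstrassP L hz).unique
      ((hasDerivAt_const z (L.weierstrassP a)).congr_of_eventuallyEq ?_))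
    filter_upwards [(isOpen_compl_lattice L).mem_nhds hz] with v hv
    exact sub_eq_zero.mp (pow_eq_zero_iff two_ne_zero |>.mp (h v hv))
  · exact sub_eq_zero.mp (h u hu)

/-- The Lamé function centred at the half period and normalized there. -/
def normLame (L : PeriodPair) (w : ℝ) (a : ℂ) (x : ℝ) : ℂ :=
  weierstrassSigma L (x + w - a) * weierstrassSigma L w /
    (weierstrassSigma L (x + w) * weierstrassSigma L (w - a)) *
    Complex.exp (weierstrassZeta L a * x)

lemma normLame_eq (L : PeriodPair) (w : ℝ) (a : ℂ) (x : ℝ) :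
    normLame L w a x = weierstrassSigma L w / (weierstrassSigma L (w - a) *
      Complex.exp (weierstrassZeta L a * w)) * lame L a (x + w) := by
  have h := Complex.exp_ne_zero (weierstrassZeta L a * w)
  rw [normLame, lame, mul_add, Complex.exp_add]
  field_simp

/-- The derivative of the normalized Lamé function. -/
def normLame' (L : PeriodPair) (w : ℝ) (a : ℂ) (x : ℝ) : ℂ :=
  weierstrassSigma L w / (weierstrassSigma L (w - a) *
      Complex.exp (weierstrassZeta L a * w)) * deriv (lame L a) (x + w)

section normLame

variable {L : PeriodPair} {w : ℝ} {a : ℂ}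

lemma IsRealHalfPeriod.add_notMem (hw : IsRealHalfPeriod L w) {x : ℝ} (hx : x ∈ Ioo (-w) w) :
    (x : ℂ) + w ∉ L.lattice := by
  have := hw.notMem (x := x + w) ⟨by linarith [hx.1], by linarith [hx.2]⟩
  exact_mod_cast this

lemma hasDerivAt_normLame (hw : IsRealHalfPeriod L w) {x : ℝ} (hx : x ∈ Ioo (-w) w) :
    HasDerivAt (normLame L w a) (normLame' L w a x) x := by
  have h1 : HasDerivAt (fun x : ℝ => (x : ℂ) + w) 1 x :=
    (Complex.ofRealCLM.hasDerivAt (x := x)).add_const (w : ℂ)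
  have h2 := (hasDerivAt_lame L (a := a) (hw.add_notMem hx)).comp x h1
  have h3 := h2.const_mul (weierstrassSigma L w / (weierstrassSigma L (w - a) *
      Complex.exp (weierstrassZeta L a * w)))
  refine (h3.congr_deriv (by simp [normLame'])).congr_of_eventuallyEq
    (.of_forall fun y => normLame_eq L w a y)

lemma hasDerivAt_normLame' (hw : IsRealHalfPeriod L w) (ha : a ∉ L.lattice) {x : ℝ}
    (hx : x ∈ Ioo (-w) w) : HasDerivAt (normLame' L w a)
      ((2 * L.weierstrassP (x + w) + L.weierstrassP a) * normLame L w a x) x := by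
  have h1 : HasDerivAt (fun x : ℝ => (x : ℂ) + w) 1 x :=
    (Complex.ofRealCLM.hasDerivAt (x := x)).add_const (w : ℂ)
  have hu := hw.add_notMem hx
  have h2 := ((analyticOnNhd_lame L a).deriv _ hu).differentiableAt.hasDerivAt.comp x h1
  have h3 := h2.const_mul (weierstrassSigma L w / (weierstrassSigma L (w - a) *
      Complex.exp (weierstrassZeta L a * w)))
  refine h3.congr_deriv ?_
  rw [lame_second_order L ha hu, normLame_eq]
  ring

lemma normLame_first_order (hw : IsRealHalfPeriod L w) (ha : a ∉ L.lattice) {x : ℝ}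
    (hx : x ∈ Ioo (-w) w) : (L.weierstrassP (x + w) - L.weierstrassP a) * normLame' L w a x =
      (L.derivWeierstrassP (x + w) + L.derivWeierstrassP a) / 2 * normLame L w a x := by
  have := lame_first_order L ha (hw.add_notMem hx)
  rw [normLame_eq, normLame']
  linear_combination (weierstrassSigma L w / (weierstrassSigma L (w - a) *
      Complex.exp (weierstrassZeta L a * w))) * this

lemma contDiffAt_normLame (hw : IsRealHalfPeriod L w) {x : ℝ} (hx : x ∈ Ioo (-w) w) :
    ContDiffAt ℝ ∞ (normLame L w a) x := by
  have h1 : ContDiffAt ℝ ∞ (lame L a) (x + w) :=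
    (analyticOnNhd_lame L a _ (hw.add_notMem hx)).contDiffAt.restrict_scalars ℝ
  have h2 : ContDiffAt ℝ ∞ (fun x : ℝ => (x : ℂ) + w) x :=
    Complex.ofRealCLM.contDiff.contDiffAt.add contDiffAt_const
  have h3 := (contDiffAt_const (c := weierstrassSigma L w / (weierstrassSigma L (w - a) *
      Complex.exp (weierstrassZeta L a * w)))).mul (ContDiffAt.comp x h1 h2)
  exact h3.congr_of_eventuallyEq (.of_forall fun y => normLame_eq L w a y)

lemma halfPeriod_notMem (hw : IsRealHalfPeriod L w) : (w : ℂ) ∉ L.lattice :=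
  hw.notMem ⟨hw.1.1, by linarith [show 0 < w from hw.1.1]⟩

lemma derivWeierstrassP_halfPeriod (hw : IsRealHalfPeriod L w) : L.derivWeierstrassP w = 0 := by
  have h := L.derivWeierstrassP_add_coe (-w) ⟨_, hw.1.2⟩
  have e : -(w : ℂ) + ((2 * w : ℝ) : ℂ) = w := by push_cast; ring
  simp only [e] at h
  rw [L.derivWeierstrassP_neg] at h
  linear_combination h / 2

lemma normLame_zero (hw : IsRealHalfPeriod L w) (h0 : L.derivWeierstrassP a ≠ 0) :
    normLame L w a 0 = 1 := by
  have h1 := weierstrassSigma_ne_zero L (halfPeriod_notMem hw)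
  -- ℘' vanishes at the half period w, so a congruent to w would force ℘'(a) = 0.
  have h2 : (w : ℂ) - a ∉ L.lattice := by
    intro h
    apply h0
    have := L.derivWeierstrassP_sub_coe w ⟨_, h⟩
    simpa [derivWeierstrassP_halfPeriod hw] using this
  have h3 := weierstrassSigma_ne_zero L h2
  simp only [normLame, Complex.ofReal_zero, zero_add, mul_zero, Complex.exp_zero, mul_one]
  rw [mul_comm (weierstrassSigma L w)]
  exact div_self (mul_ne_zero h3 h1)

/-- The reality of σ, ζ or a itself is not needed. Real ℘(a) makes the imaginary part a solution of
a real second order equation. Its initial data vanish: the value at 0 is 1, and the first order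
equation at 0 makes the derivative real, as its coefficient ℘(w) - ℘(a) is real and non-zero
(equality would give ℘'(a)² = ℘'(w)² = 0). -/
lemma normLame_im (h2 : L.g₂.im = 0) (h3 : L.g₃.im = 0) (hw : IsRealHalfPeriod L w)
    (ha : a ∉ L.lattice) (hp : (L.weierstrassP a).im = 0) (hp' : (L.derivWeierstrassP a).im = 0)
    (h0 : L.derivWeierstrassP a ≠ 0) {x : ℝ} (hx : x ∈ Ioo (-w) w) :
    (normLame L w a x).im = 0 ∧ (normLame' L w a x).im = 0 := by
  have hw0 : 0 < w := hw.1.1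
  have hz : (0 : ℝ) ∈ Ioo (-w) w := ⟨by linarith, hw0⟩
  have hP : ∀ y : ℝ, L.weierstrassP ((y : ℂ) + w) = (realP L (y + w) : ℂ) := fun y => by
    rw [ofReal_realP L h2 h3]; push_cast; rfl
  have ep : L.weierstrassP a = ((L.weierstrassP a).re : ℂ) := Complex.ext rfl (by simp [hp])
  have ep' : L.derivWeierstrassP a = ((L.derivWeierstrassP a).re : ℂ) :=
    Complex.ext rfl (by simp [hp'])
  have hfirst := normLame_first_order hw ha hz
  rw [normLame_zero hw h0] at hfirst
  simp only [Complex.ofReal_zero, zero_add, mul_one, derivWeierstrassP_halfPeriod hw] at hfirst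
  have hne : realP L w - (L.weierstrassP a).re ≠ 0 := by
    intro h
    have e1 : L.weierstrassP w = L.weierstrassP a := by
      rw [ep, ← ofReal_realP L h2 h3, sub_eq_zero.mp h]
    have e2 := L.derivWeierstrassP_sq _ (halfPeriod_notMem hw)
    rw [derivWeierstrassP_halfPeriod hw, e1, ← L.derivWeierstrassP_sq a ha] at e2
    exact h0 (pow_eq_zero_iff two_ne_zero |>.mp (by rw [← e2]; simp))
  have him0 : (normLame' L w a 0).im = 0 := by
    rw [← ofReal_realP L h2 h3, ep, ep', ← Complex.ofReal_sub] at hfirst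
    have := congrArg Complex.im hfirst
    have e : ((L.derivWeierstrassP a).re : ℂ) / 2 = (((L.derivWeierstrassP a).re / 2 : ℝ) : ℂ) := by
      push_cast; rfl
    rw [Complex.im_ofReal_mul, e, Complex.ofReal_im] at this
    exact (mul_eq_zero.mp this).resolve_left hne
  refine eq_zero_of_second_order (u := fun x => (normLame L w a x).im)
    (u' := fun x => (normLame' L w a x).im)
    (a := fun x => 2 * realP L (x + w) + (L.weierstrassP a).re) ordConnected_Ioo
    (fun y hy => ?_) (fun y hy => ?_) (fun y hy => ?_) hz (by simp [normLame_zero hw h0]) him0 x hx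
  · exact Complex.imCLM.hasFDerivAt.comp_hasDerivAt y (hasDerivAt_normLame hw hy)
  · have := Complex.imCLM.hasFDerivAt.comp_hasDerivAt y (hasDerivAt_normLame' hw ha hy)
    refine this.congr_deriv ?_
    have e : (2 * L.weierstrassP (y + w) + L.weierstrassP a) =
        ((2 * realP L (y + w) + (L.weierstrassP a).re : ℝ) : ℂ) := by
      push_cast; rw [← ep, hP]
    rw [e]
    exact Complex.im_ofReal_mul _ _
  · have : ContinuousAt (fun y => realP L (y + w)) y :=
      ContinuousAt.comp (g := realP L) (hasDerivAt_realP L (hw.notMem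
        ⟨by linarith [hy.1], by linarith [hy.2]⟩)).continuousAt (by fun_prop)
    exact ((this.const_mul 2).add continuousAt_const).continuousWithinAt

end normLame

/-! ### Partial derivatives -/

section Partial

variable {V V' : Type*} [NormedAddCommGroup V] [NormedSpace ℝ V] [NormedAddCommGroup V']
  [NormedSpace ℝ V'] {f g : ℝ × ℝ → V} {z : ℝ × ℝ} {D : Set (ℝ × ℝ)}

lemma hasDerivAt_fst_of_differentiableAt (h : DifferentiableAt ℝ f z) :
    HasDerivAt (fun u => f (u, z.2)) (fderiv ℝ f z (1, 0)) z.1 := by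
  have h1 : HasDerivAt (fun u : ℝ => (u, z.2)) ((1 : ℝ), (0 : ℝ)) z.1 :=
    (hasDerivAt_id z.1).prodMk (hasDerivAt_const z.1 z.2)
  exact HasFDerivAt.comp_hasDerivAt (l := f) z.1 (by simpa using h.hasFDerivAt) h1

lemma hasDerivAt_snd_of_differentiableAt (h : DifferentiableAt ℝ f z) :
    HasDerivAt (fun u => f (z.1, u)) (fderiv ℝ f z (0, 1)) z.2 := by
  have h1 : HasDerivAt (fun u : ℝ => (z.1, u)) ((0 : ℝ), (1 : ℝ)) z.2 :=
    (hasDerivAt_const z.2 z.1).prodMk (hasDerivAt_id z.2)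
  exact HasFDerivAt.comp_hasDerivAt (l := f) z.2 (by simpa using h.hasFDerivAt) h1

lemma dx_eq_fderiv (h : DifferentiableAt ℝ f z) : dx f z = fderiv ℝ f z (1, 0) :=
  (hasDerivAt_fst_of_differentiableAt h).deriv

lemma dy_eq_fderiv (h : DifferentiableAt ℝ f z) : dy f z = fderiv ℝ f z (0, 1) :=
  (hasDerivAt_snd_of_differentiableAt h).deriv

lemma hasDerivAt_dx (h : DifferentiableAt ℝ f z) :
    HasDerivAt (fun u => f (u, z.2)) (dx f z) z.1 := by
  rw [dx_eq_fderiv h]; exact hasDerivAt_fst_of_differentiableAt h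

lemma hasDerivAt_dy (h : DifferentiableAt ℝ f z) :
    HasDerivAt (fun u => f (z.1, u)) (dy f z) z.2 := by
  rw [dy_eq_fderiv h]; exact hasDerivAt_snd_of_differentiableAt h

lemma dx_congr (h : f =ᶠ[𝓝 z] g) : dx f z = dx g z := by
  have hc : ContinuousAt (fun u : ℝ => (u, z.2)) z.1 := by fun_prop
  exact EventuallyEq.deriv_eq (h.comp_tendsto hc.tendsto)

lemma dy_congr (h : f =ᶠ[𝓝 z] g) : dy f z = dy g z := by
  have hc : ContinuousAt (fun u : ℝ => (z.1, u)) z.2 := by fun_prop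
  exact EventuallyEq.deriv_eq (h.comp_tendsto hc.tendsto)

lemma _root_.ContDiffOn.differentiableAt_of_isOpen (hf : ContDiffOn ℝ ∞ f D) (hD : IsOpen D)
    (hz : z ∈ D) : DifferentiableAt ℝ f z :=
  (hf.contDiffAt (hD.mem_nhds hz)).differentiableAt (by simp)

lemma contDiffOn_dx (hf : ContDiffOn ℝ ∞ f D) (hD : IsOpen D) : ContDiffOn ℝ ∞ (dx f) D := by
  have h1 : ContDiffOn ℝ ∞ (fun z => fderiv ℝ f z (1, 0)) D :=
    (hf.fderiv_of_isOpen hD (by simp)).clm_apply contDiffOn_const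
  exact h1.congr fun z hz => dx_eq_fderiv (hf.differentiableAt_of_isOpen hD hz)

lemma contDiffOn_dy (hf : ContDiffOn ℝ ∞ f D) (hD : IsOpen D) : ContDiffOn ℝ ∞ (dy f) D := by
  have h1 : ContDiffOn ℝ ∞ (fun z => fderiv ℝ f z (0, 1)) D :=
    (hf.fderiv_of_isOpen hD (by simp)).clm_apply contDiffOn_const
  exact h1.congr fun z hz => dy_eq_fderiv (hf.differentiableAt_of_isOpen hD hz)

lemma dx_dy_comm (hf : ContDiffOn ℝ ∞ f D) (hD : IsOpen D) (hz : z ∈ D) :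
    dx (dy f) z = dy (dx f) z := by
  have hdiff : ∀ᶠ y in 𝓝 z, DifferentiableAt ℝ f y := by
    filter_upwards [hD.mem_nhds hz] with y hy
    exact hf.differentiableAt_of_isOpen hD hy
  have hd : DifferentiableAt ℝ (fderiv ℝ f) z :=
    (hf.fderiv_of_isOpen hD (m := ∞) (by simp)).differentiableAt_of_isOpen hD hz
  have hx : DifferentiableAt ℝ (fun y => fderiv ℝ f y (1, 0)) z :=
    hd.clm_apply (differentiableAt_const _)
  have hy : DifferentiableAt ℝ (fun y => fderiv ℝ f y (0, 1)) z :=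
    hd.clm_apply (differentiableAt_const _)
  have hsymm := second_derivative_symmetric_of_eventually
    (f' := fderiv ℝ f) (hdiff.mono fun y hy => hy.hasFDerivAt) hd.hasFDerivAt (1, 0) (0, 1)
  rw [dx_congr (hdiff.mono fun y hy => dy_eq_fderiv hy),
    dy_congr (hdiff.mono fun y hy => dx_eq_fderiv hy), dx_eq_fderiv hy, dy_eq_fderiv hx,
    fderiv_clm_apply hd (differentiableAt_const _), fderiv_clm_apply hd (differentiableAt_const _)]
  simpa using hsymm

lemma dx_clm_comp (T : V →L[ℝ] V') (h : DifferentiableAt ℝ f z) :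
    dx (fun w => T (f w)) z = T (dx f z) :=
  (T.hasFDerivAt.comp_hasDerivAt z.1 (hasDerivAt_dx h)).deriv

lemma dy_clm_comp (T : V →L[ℝ] V') (h : DifferentiableAt ℝ f z) :
    dy (fun w => T (f w)) z = T (dy f z) :=
  (T.hasFDerivAt.comp_hasDerivAt z.2 (hasDerivAt_dy h)).deriv

lemma dx_sub (hf : DifferentiableAt ℝ f z) (hg : DifferentiableAt ℝ g z) :
    dx (fun w => f w - g w) z = dx f z - dx g z :=
  ((hasDerivAt_dx hf).fun_sub (hasDerivAt_dx hg)).deriv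

lemma dy_sub (hf : DifferentiableAt ℝ f z) (hg : DifferentiableAt ℝ g z) :
    dy (fun w => f w - g w) z = dy f z - dy g z :=
  ((hasDerivAt_dy hf).fun_sub (hasDerivAt_dy hg)).deriv

end Partial

lemma dx_apply {r : ℝ × ℝ → Fin 3 → ℝ} {z : ℝ × ℝ} (h : DifferentiableAt ℝ r z) (i : Fin 3) :
    dx (fun w => r w i) z = dx r z i :=
  dx_clm_comp (ContinuousLinearMap.proj (R := ℝ) (φ := fun _ : Fin 3 => ℝ) i) h

lemma dy_apply {r : ℝ × ℝ → Fin 3 → ℝ} {z : ℝ × ℝ} (h : DifferentiableAt ℝ r z) (i : Fin 3) :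
    dy (fun w => r w i) z = dy r z i :=
  dy_clm_comp (ContinuousLinearMap.proj (R := ℝ) (φ := fun _ : Fin 3 => ℝ) i) h

lemma dz_ofReal {g : ℝ × ℝ → ℝ} {z : ℝ × ℝ} (h : DifferentiableAt ℝ g z) :
    dz (fun w => (g w : ℂ)) z = (((dx g z : ℝ) : ℂ) - Complex.I * ((dy g z : ℝ) : ℂ)) / 2 := by
  have h1 : dx (fun w => (g w : ℂ)) z = ((dx g z : ℝ) : ℂ) := dx_clm_comp Complex.ofRealCLM h
  have h2 : dy (fun w => (g w : ℂ)) z = ((dy g z : ℝ) : ℂ) := dy_clm_comp Complex.ofRealCLM h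
  rw [dz, h1, h2]

lemma dzbar_ofReal {g : ℝ × ℝ → ℝ} {z : ℝ × ℝ} (h : DifferentiableAt ℝ g z) :
    dzbar (fun w => (g w : ℂ)) z = (((dx g z : ℝ) : ℂ) + Complex.I * ((dy g z : ℝ) : ℂ)) / 2 := by
  have h1 : dx (fun w => (g w : ℂ)) z = ((dx g z : ℝ) : ℂ) := dx_clm_comp Complex.ofRealCLM h
  have h2 : dy (fun w => (g w : ℂ)) z = ((dy g z : ℝ) : ℂ) := dy_clm_comp Complex.ofRealCLM h
  rw [dzbar, h1, h2]

lemma dx_complex_combination {a b : ℝ × ℝ → ℝ} {z : ℝ × ℝ} (c : ℂ) (ha : DifferentiableAt ℝ a z)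
    (hb : DifferentiableAt ℝ b z) :
    dx (fun w => ((a w : ℂ) + c * (b w : ℂ)) / 2) z = (((dx a z : ℝ) : ℂ) + c * ((dx b z : ℝ) : ℂ)) / 2 :=
  (((hasDerivAt_dx ha).ofReal_comp.add
    ((hasDerivAt_dx hb).ofReal_comp.const_mul c)).div_const 2).deriv

lemma dy_complex_combination {a b : ℝ × ℝ → ℝ} {z : ℝ × ℝ} (c : ℂ) (ha : DifferentiableAt ℝ a z)
    (hb : DifferentiableAt ℝ b z) :
    dy (fun w => ((a w : ℂ) + c * (b w : ℂ)) / 2) z = (((dy a z : ℝ) : ℂ) + c * ((dy b z : ℝ) : ℂ)) / 2 :=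
  (((hasDerivAt_dy ha).ofReal_comp.add
    ((hasDerivAt_dy hb).ofReal_comp.const_mul c)).div_const 2).deriv

lemma det3_eq {R : Type*} [CommRing R] (a b c : Fin 3 → R) :
    det3 a b c = a 0 * b 1 * c 2 - a 0 * b 2 * c 1 - a 1 * b 0 * c 2 + a 1 * b 2 * c 0 +
      a 2 * b 0 * c 1 - a 2 * b 1 * c 0 := by
  simp [det3, Matrix.det_fin_three]

lemma hasDerivAt_det3 {a b c : ℝ → Fin 3 → ℝ} {a' b' c' : Fin 3 → ℝ} {t : ℝ}
    (ha : HasDerivAt a a' t) (hb : HasDerivAt b b' t) (hc : HasDerivAt c c' t) :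
    HasDerivAt (fun t => det3 (a t) (b t) (c t))
      (det3 a' (b t) (c t) + det3 (a t) b' (c t) + det3 (a t) (b t) c') t := by
  have ha := hasDerivAt_pi.mp ha
  have hb := hasDerivAt_pi.mp hb
  have hc := hasDerivAt_pi.mp hc
  simp only [det3_eq]
  refine ((((((((ha 0).mul (hb 1)).mul (hc 2)).sub (((ha 0).mul (hb 2)).mul (hc 1))).sub
    (((ha 1).mul (hb 0)).mul (hc 2))).add (((ha 1).mul (hb 2)).mul (hc 0))).add
    (((ha 2).mul (hb 0)).mul (hc 1))).sub (((ha 2).mul (hb 1)).mul (hc 0))).congr_deriv ?_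
  simp only [Pi.mul_apply]
  ring

/-! ### The second derivatives of a surface in isothermal coordinates -/

section Isothermal

variable {D : Set (ℝ × ℝ)} {r : ℝ × ℝ → Fin 3 → ℝ} {W : ℝ × ℝ → ℝ} {z : ℝ × ℝ}

lemma affineNormal_of_isothermal (hD : IsOpen D) (hpos : ∀ z ∈ D, 0 < W z)
    (hE : ∀ z ∈ D, blaschkeE r z = W z) (hF : ∀ z ∈ D, blaschkeF r z = 0)
    (hG : ∀ z ∈ D, blaschkeG r z = W z) (hz : z ∈ D) :
    affineNormal r z = (1 / (2 * W z)) • (dx (dx r) z + dy (dy r) z) := by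
  have hs : ∀ w ∈ D, (√(blaschkeE r w * blaschkeG r w - blaschkeF r w ^ 2))⁻¹ = (W w)⁻¹ := by
    intro w hw
    rw [hE w hw, hF w hw, hG w hw, zero_pow two_ne_zero, sub_zero,
      Real.sqrt_mul_self (hpos w hw).le]
  rw [affineNormal, laplaceBeltrami, hs z hz]
  have h1 : dx (fun w => (√(blaschkeE r w * blaschkeG r w - blaschkeF r w ^ 2))⁻¹ •
      (blaschkeG r w • dx r w - blaschkeF r w • dy r w)) z = dx (dx r) z := by
    refine dx_congr ?_
    filter_upwards [hD.mem_nhds hz] with w hw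
    rw [hs w hw, hF w hw, hG w hw, zero_smul, sub_zero, smul_smul,
      inv_mul_cancel₀ (hpos w hw).ne', one_smul]
  have h2 : dy (fun w => (√(blaschkeE r w * blaschkeG r w - blaschkeF r w ^ 2))⁻¹ •
      (blaschkeE r w • dy r w - blaschkeF r w • dx r w)) z = dy (dy r) z := by
    refine dy_congr ?_
    filter_upwards [hD.mem_nhds hz] with w hw
    rw [hs w hw, hF w hw, hE w hw, zero_smul, sub_zero, smul_smul,
      inv_mul_cancel₀ (hpos w hw).ne', one_smul]
  rw [h1, h2, smul_smul]
  congr 1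
  ring

lemma dz_apply (hr : DifferentiableAt ℝ r z) (i : Fin 3) :
    dz (fun w => (r w i : ℂ)) z = ((dx r z i : ℂ) + -Complex.I * (dy r z i : ℂ)) / 2 := by
  have hi : DifferentiableAt ℝ (fun w => r w i) z := (differentiableAt_pi.mp hr) i
  rw [dz_ofReal hi, dx_apply hr, dy_apply hr]
  ring

lemma dzbar_apply (hr : DifferentiableAt ℝ r z) (i : Fin 3) :
    dzbar (fun w => (r w i : ℂ)) z = ((dx r z i : ℂ) + Complex.I * (dy r z i : ℂ)) / 2 := by
  have hi : DifferentiableAt ℝ (fun w => r w i) z := (differentiableAt_pi.mp hr) i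
  rw [dzbar_ofReal hi, dx_apply hr, dy_apply hr]

lemma dx_combination_apply (hD : IsOpen D) (hr : ContDiffOn ℝ ∞ r D) (hz : z ∈ D) (c : ℂ)
    (i : Fin 3) : dx (fun w => ((dx r w i : ℂ) + c * (dy r w i : ℂ)) / 2) z =
      ((dx (dx r) z i : ℂ) + c * (dy (dx r) z i : ℂ)) / 2 := by
  have hx := (contDiffOn_dx hr hD).differentiableAt_of_isOpen hD hz
  have hy := (contDiffOn_dy hr hD).differentiableAt_of_isOpen hD hz
  rw [dx_complex_combination c (differentiableAt_pi.mp hx i) (differentiableAt_pi.mp hy i),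
    dx_apply hx, dx_apply hy, dx_dy_comm hr hD hz]

lemma dy_combination_apply (hD : IsOpen D) (hr : ContDiffOn ℝ ∞ r D) (hz : z ∈ D) (c : ℂ)
    (i : Fin 3) : dy (fun w => ((dx r w i : ℂ) + c * (dy r w i : ℂ)) / 2) z =
      ((dy (dx r) z i : ℂ) + c * (dy (dy r) z i : ℂ)) / 2 := by
  have hx := (contDiffOn_dx hr hD).differentiableAt_of_isOpen hD hz
  have hy := (contDiffOn_dy hr hD).differentiableAt_of_isOpen hD hz
  rw [dy_complex_combination c (differentiableAt_pi.mp hx i) (differentiableAt_pi.mp hy i),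
    dy_apply hx, dy_apply hy]

lemma dz_dz_apply (hD : IsOpen D) (hr : ContDiffOn ℝ ∞ r D) (hz : z ∈ D) (i : Fin 3) :
    dz (dz fun w => (r w i : ℂ)) z =
      ((dx (dx r) z i : ℂ) - (dy (dy r) z i : ℂ) - 2 * Complex.I * (dy (dx r) z i : ℂ)) / 4 := by
  have h : (dz fun w => (r w i : ℂ)) =ᶠ[𝓝 z]
      fun w => ((dx r w i : ℂ) + -Complex.I * (dy r w i : ℂ)) / 2 := by
    filter_upwards [hD.mem_nhds hz] with w hw
    exact dz_apply (hr.differentiableAt_of_isOpen hD hw) i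
  rw [dz, dx_congr h, dy_congr h, dx_combination_apply hD hr hz, dy_combination_apply hD hr hz]
  linear_combination ((dy (dy r) z i : ℂ) / 4) * Complex.I_sq

lemma dz_dzbar_apply (hD : IsOpen D) (hr : ContDiffOn ℝ ∞ r D) (hz : z ∈ D) (i : Fin 3) :
    dz (dzbar fun w => (r w i : ℂ)) z =
      ((dx (dx r) z i : ℂ) + (dy (dy r) z i : ℂ)) / 4 := by
  have h : (dzbar fun w => (r w i : ℂ)) =ᶠ[𝓝 z]
      fun w => ((dx r w i : ℂ) + Complex.I * (dy r w i : ℂ)) / 2 := by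
    filter_upwards [hD.mem_nhds hz] with w hw
    exact dzbar_apply (hr.differentiableAt_of_isOpen hD hw) i
  rw [dz, dx_congr h, dy_congr h, dx_combination_apply hD hr hz, dy_combination_apply hD hr hz]
  linear_combination (-(dy (dy r) z i : ℂ) / 4) * Complex.I_sq

lemma dzbar_dz_apply (hD : IsOpen D) (hr : ContDiffOn ℝ ∞ r D) (hz : z ∈ D) (i : Fin 3) :
    dzbar (dz fun w => (r w i : ℂ)) z =
      ((dx (dx r) z i : ℂ) + (dy (dy r) z i : ℂ)) / 4 := by
  have h : (dz fun w => (r w i : ℂ)) =ᶠ[𝓝 z]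
      fun w => ((dx r w i : ℂ) + -Complex.I * (dy r w i : ℂ)) / 2 := by
    filter_upwards [hD.mem_nhds hz] with w hw
    exact dz_apply (hr.differentiableAt_of_isOpen hD hw) i
  rw [dzbar, dx_congr h, dy_congr h, dx_combination_apply hD hr hz, dy_combination_apply hD hr hz]
  linear_combination (-(dy (dy r) z i : ℂ) / 4) * Complex.I_sq

lemma dzbar_dzbar_apply (hD : IsOpen D) (hr : ContDiffOn ℝ ∞ r D) (hz : z ∈ D) (i : Fin 3) :
    dzbar (dzbar fun w => (r w i : ℂ)) z =
      ((dx (dx r) z i : ℂ) - (dy (dy r) z i : ℂ) + 2 * Complex.I * (dy (dx r) z i : ℂ)) / 4 := by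
  have h : (dzbar fun w => (r w i : ℂ)) =ᶠ[𝓝 z]
      fun w => ((dx r w i : ℂ) + Complex.I * (dy r w i : ℂ)) / 2 := by
    filter_upwards [hD.mem_nhds hz] with w hw
    exact dzbar_apply (hr.differentiableAt_of_isOpen hD hw) i
  rw [dzbar, dx_congr h, dy_congr h, dx_combination_apply hD hr hz, dy_combination_apply hD hr hz]
  linear_combination ((dy (dy r) z i : ℂ) / 4) * Complex.I_sq

lemma cubicCoeff_eq (hD : IsOpen D) (hr : ContDiffOn ℝ ∞ r D) (hz : z ∈ D) :
    cubicCoeff r z =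
      ((2 * det3 (dx r z) (dy (dx r) z) (r z) +
        det3 (dy r z) (dx (dx r) z - dy (dy r) z) (r z) : ℝ) : ℂ) / 8 +
      ((det3 (dx r z) (dx (dx r) z - dy (dy r) z) (r z) -
        2 * det3 (dy r z) (dy (dx r) z) (r z) : ℝ) : ℂ) / 8 * Complex.I := by
  rw [cubicCoeff]
  simp only [dz_dz_apply hD hr hz, dz_apply (hr.differentiableAt_of_isOpen hD hz), det3_eq,
    Pi.sub_apply]
  push_cast
  ring_nf
  simp only [Complex.I_sq, show Complex.I ^ 3 = -Complex.I from Complex.I_pow_three]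
  ring

end Isothermal

/-! ### The structure equations in real form -/

/-- The structure equations of an affine sphere with `H = -1`, affine metric `W (dx² + dy²)` and
cubic coefficient `A + i B`, for `∂W/∂x = Wx` and `∂W/∂y = 0`, in real coordinates. -/
structure GaussSystem {V : Type*} [NormedAddCommGroup V] [NormedSpace ℝ V] (D : Set (ℝ × ℝ))
    (r : ℝ × ℝ → V) (W Wx : ℝ × ℝ → ℝ) (A B : ℝ) : Prop where
  smooth : ContDiffOn ℝ ∞ r D
  xx : ∀ z ∈ D, dx (dx r) z = ((Wx z - 4 * A) / (2 * W z)) • dx r z + (2 * B / W z) • dy r z +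
    W z • r z
  xy : ∀ z ∈ D, dy (dx r) z = (2 * B / W z) • dx r z + ((Wx z + 4 * A) / (2 * W z)) • dy r z
  yy : ∀ z ∈ D, dy (dy r) z = -((Wx z - 4 * A) / (2 * W z)) • dx r z - (2 * B / W z) • dy r z +
    W z • r z

section GaussSystem

variable {D : Set (ℝ × ℝ)} {W Wx : ℝ × ℝ → ℝ} {A B : ℝ}

lemma blaschkeDenom_of_isothermal {r : ℝ × ℝ → Fin 3 → ℝ} {z : ℝ × ℝ} {w : ℝ} (hw : 0 < w)
    (hL : coeffL r z = w ^ 2) (hM : coeffM r z = 0) (hN : coeffN r z = w ^ 2) :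
    blaschkeDenom r z = w := by
  rw [blaschkeDenom, hL, hM, hN]
  have e : w ^ 2 * w ^ 2 - 0 ^ 2 = w ^ 4 := by ring
  rw [e, abs_of_pos (by positivity), ← Real.rpow_natCast, ← Real.rpow_mul hw.le]
  norm_num

/-- Once the second derivatives are replaced by the system, every determinant in the definitions of
the metric and of the cubic form is a multiple of |r_x, r_y, r| = W. -/
lemma GaussSystem.hasInvariants {r : ℝ × ℝ → Fin 3 → ℝ} (h : GaussSystem D r W Wx A B)
    (hD : IsOpen D) (hpos : ∀ z ∈ D, 0 < W z)
    (hdet : ∀ z ∈ D, det3 (dx r z) (dy r z) (r z) = W z) :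
    HasInvariants D r W (-1) ((A : ℂ) + (B : ℂ) * Complex.I) := by
  have hL : ∀ z ∈ D, coeffL r z = W z ^ 2 := fun z hz => by
    have e : coeffL r z = W z * det3 (dx r z) (dy r z) (r z) := by
      rw [coeffL, h.xx z hz]
      simp only [det3_eq, Pi.add_apply, Pi.smul_apply, smul_eq_mul]
      ring
    rw [e, hdet z hz, sq]
  have hM : ∀ z ∈ D, coeffM r z = 0 := fun z hz => by
    rw [coeffM, h.xy z hz]
    simp only [det3_eq, Pi.add_apply, Pi.smul_apply, smul_eq_mul]
    ring
  have hN : ∀ z ∈ D, coeffN r z = W z ^ 2 := fun z hz => by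
    have e : coeffN r z = W z * det3 (dx r z) (dy r z) (r z) := by
      rw [coeffN, h.yy z hz]
      simp only [det3_eq, Pi.add_apply, Pi.sub_apply, Pi.smul_apply, smul_eq_mul]
      ring
    rw [e, hdet z hz, sq]
  have hden : ∀ z ∈ D, blaschkeDenom r z = W z := fun z hz =>
    blaschkeDenom_of_isothermal (hpos z hz) (hL z hz) (hM z hz) (hN z hz)
  have hE : ∀ z ∈ D, blaschkeE r z = W z := fun z hz => by
    have := (hpos z hz).ne'
    rw [blaschkeE, hL z hz, hden z hz]; field_simp
  have hF : ∀ z ∈ D, blaschkeF r z = 0 := fun z hz => by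
    rw [blaschkeF, hM z hz, zero_div]
  have hG : ∀ z ∈ D, blaschkeG r z = W z := fun z hz => by
    have := (hpos z hz).ne'
    rw [blaschkeG, hN z hz, hden z hz]; field_simp
  refine ⟨h.smooth, hpos, hE, hF, hG, fun z hz => ?_, fun z hz => ?_⟩
  · rw [affineNormal_of_isothermal hD hpos hE hF hG hz, h.xx z hz, h.yy z hz]
    have := (hpos z hz).ne'
    ext i
    simp only [Pi.add_apply, Pi.sub_apply, Pi.smul_apply, smul_eq_mul]
    field_simp
    ring
  · have hW := (hpos z hz).ne'
    have e := hdet z hz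
    have e1 : 2 * det3 (dx r z) (dy (dx r) z) (r z) +
        det3 (dy r z) (dx (dx r) z - dy (dy r) z) (r z) = 8 * A := by
      have : 2 * det3 (dx r z) (dy (dx r) z) (r z) +
        det3 (dy r z) (dx (dx r) z - dy (dy r) z) (r z) =
          (8 * A / W z) * det3 (dx r z) (dy r z) (r z) := by
        rw [h.xx z hz, h.xy z hz, h.yy z hz]
        simp only [det3_eq, Pi.add_apply, Pi.sub_apply, Pi.smul_apply, smul_eq_mul]
        field_simp
        ring
      rw [this, e]; field_simp
    have e2 : det3 (dx r z) (dx (dx r) z - dy (dy r) z) (r z) -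
        2 * det3 (dy r z) (dy (dx r) z) (r z) = 8 * B := by
      have : det3 (dx r z) (dx (dx r) z - dy (dy r) z) (r z) -
        2 * det3 (dy r z) (dy (dx r) z) (r z) =
          (8 * B / W z) * det3 (dx r z) (dy r z) (r z) := by
        rw [h.xx z hz, h.xy z hz, h.yy z hz]
        simp only [det3_eq, Pi.add_apply, Pi.sub_apply, Pi.smul_apply, smul_eq_mul]
        field_simp
        ring
      rw [this, e]; field_simp
    rw [cubicCoeff_eq hD h.smooth hz, e1, e2]
    push_cast
    ring

lemma cramer3 {a b c : Fin 3 → ℝ} {w : ℝ} (hw : w ≠ 0) (h : det3 a b c = w) (v : Fin 3 → ℝ) :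
    v = (det3 v b c / w) • a + (det3 a v c / w) • b + (det3 a b v / w) • c := by
  subst h
  ext i
  simp only [Pi.add_apply, Pi.smul_apply, smul_eq_mul]
  field_simp
  simp only [det3_eq]
  fin_cases i <;> simp <;> ring

/-- The normal gives r_xx + r_yy = 2W r and the metric gives L = N = W², M = 0. Therefore 2W² = L +
N = 2W |r_x, r_y, r|, which is the determinant condition. In particular (r_x, r_y, r) is a basis,
and Cramer's rule yields the second derivatives once their determinants with this basis are known.
-/
lemma HasInvariants.det_and_gaussSystem {r : ℝ × ℝ → Fin 3 → ℝ}
    (h : HasInvariants D r W (-1) ((A : ℂ) + (B : ℂ) * Complex.I)) (hD : IsOpen D)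
    (hWx : ∀ z ∈ D, HasDerivAt (fun u => W (u, z.2)) (Wx z) z.1)
    (hWy : ∀ z ∈ D, HasDerivAt (fun u => W (z.1, u)) 0 z.2) :
    (∀ z ∈ D, det3 (dx r z) (dy r z) (r z) = W z) ∧ GaussSystem D r W Wx A B := by
  have hlap : ∀ z ∈ D, dx (dx r) z + dy (dy r) z = (2 * W z) • r z := fun z hz => by
    have h1 := h.normal z hz
    have hW := (h.pos z hz).ne'
    rw [affineNormal_of_isothermal hD h.pos h.metricE h.metricF h.metricG hz] at h1
    have h2 := congrArg (fun v => (2 * W z) • v) h1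
    simp only [smul_smul] at h2
    rw [mul_one_div_cancel (by positivity), one_smul] at h2
    simpa using h2
  have hLMN : ∀ z ∈ D, coeffL r z = W z ^ 2 ∧ coeffM r z = 0 ∧ coeffN r z = W z ^ 2 := by
    intro z hz
    have hW := h.pos z hz
    have hE := h.metricE z hz
    have hF := h.metricF z hz
    have hG := h.metricG z hz
    rw [blaschkeE] at hE
    rw [blaschkeF] at hF
    rw [blaschkeG] at hG
    have hd0 : blaschkeDenom r z ≠ 0 := by
      intro h0
      rw [h0, div_zero] at hE
      exact hW.ne hE
    have hM : coeffM r z = 0 := (div_eq_zero_iff.mp hF).resolve_right hd0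
    rw [div_eq_iff hd0] at hE hG
    have hdn : 0 ≤ blaschkeDenom r z := by rw [blaschkeDenom]; positivity
    -- With Δ the Blaschke denominator, L = N = WΔ and M = 0, so Δ⁴ = |LN - M²| = W²Δ². Hence Δ = W.
    have h4 : blaschkeDenom r z ^ 4 = W z ^ 2 * blaschkeDenom r z ^ 2 := by
      nth_rewrite 1 [blaschkeDenom]
      rw [hE, hG, hM, ← Real.rpow_natCast, ← Real.rpow_mul (abs_nonneg _)]
      norm_num
      rw [abs_of_pos hW, abs_of_nonneg hdn]
      ring
    have h5 : blaschkeDenom r z = W z := by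
      have h6 : blaschkeDenom r z ^ 2 * (blaschkeDenom r z ^ 2 - W z ^ 2) = 0 := by
        linear_combination h4
      have h7 := (mul_eq_zero.mp h6).resolve_left (pow_ne_zero 2 hd0)
      exact (sq_eq_sq₀ hdn hW.le).mp (sub_eq_zero.mp h7)
    exact ⟨by rw [hE, h5, sq], hM, by rw [hG, h5, sq]⟩
  have hdet : ∀ z ∈ D, det3 (dx r z) (dy r z) (r z) = W z := fun z hz => by
    obtain ⟨hL, -, hN⟩ := hLMN z hz
    have hW := (h.pos z hz).ne'
    have e : coeffL r z + coeffN r z = det3 (dx r z) (dy r z) (dx (dx r) z + dy (dy r) z) := by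
      simp only [coeffL, coeffN, det3_eq, Pi.add_apply]; ring
    rw [hL, hN, hlap z hz] at e
    have e2 : det3 (dx r z) (dy r z) ((2 * W z) • r z) =
        2 * W z * det3 (dx r z) (dy r z) (r z) := by
      simp only [det3_eq, Pi.smul_apply, smul_eq_mul]; ring
    rw [e2] at e
    have : 2 * W z * (det3 (dx r z) (dy r z) (r z) - W z) = 0 := by linear_combination -e
    exact sub_eq_zero.mp ((mul_eq_zero.mp this).resolve_left (by positivity))
  refine ⟨hdet, ?_⟩
  have hr := h.smooth
  -- The four determinants not given by L, M, N solve a linear system of four equations: the x and y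
  -- derivatives of |r_x, r_y, r| = W, and the real and imaginary parts of the cubic coefficient.
  have hcoef : ∀ z ∈ D, det3 (dx r z) (dx (dx r) z) (r z) = 2 * B ∧
      det3 (dy r z) (dy (dx r) z) (r z) = -2 * B ∧
      det3 (dx r z) (dy (dx r) z) (r z) = (4 * A + Wx z) / 2 ∧
      det3 (dy r z) (dx (dx r) z) (r z) = (4 * A - Wx z) / 2 := by
    intro z hz
    have hdx := (contDiffOn_dx hr hD).differentiableAt_of_isOpen hD hz
    have hdy := (contDiffOn_dy hr hD).differentiableAt_of_isOpen hD hz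
    have hd := hr.differentiableAt_of_isOpen hD hz
    have hyy : dy (dy r) z = (2 * W z) • r z - dx (dx r) z := by rw [← hlap z hz]; abel
    have e1 := hasDerivAt_det3 (hasDerivAt_dx hdx) (hasDerivAt_dx hdy) (hasDerivAt_dx hd)
    have e2 := hasDerivAt_det3 (hasDerivAt_dy hdx) (hasDerivAt_dy hdy) (hasDerivAt_dy hd)
    have c1 : ContinuousAt (fun u : ℝ => (u, z.2)) z.1 := by fun_prop
    have c2 : ContinuousAt (fun u : ℝ => (z.1, u)) z.2 := by fun_prop
    have f1 := e1.unique ((hWx z hz).congr_of_eventuallyEq (by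
      filter_upwards [c1.eventually (hD.mem_nhds hz)] with u hu
      exact hdet _ hu))
    have f2 := e2.unique ((hWy z hz).congr_of_eventuallyEq (by
      filter_upwards [c2.eventually (hD.mem_nhds hz)] with u hu
      exact hdet _ hu))
    have f3 := (cubicCoeff_eq hD hr hz).symm.trans (h.cubic z hz)
    have f4 := congrArg Complex.re f3
    have f5 := congrArg Complex.im f3
    rw [dx_dy_comm hr hD hz] at f1
    simp only [Complex.add_re, Complex.add_im, Complex.mul_re, Complex.mul_im, Complex.ofReal_re,
      Complex.ofReal_im, Complex.I_re, Complex.I_im, Complex.div_ofNat_re,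
      Complex.div_ofNat_im] at f4 f5
    rw [hyy] at f2 f4 f5
    simp only [det3_eq, Pi.sub_apply, Pi.smul_apply, smul_eq_mul, Prod.mk.eta] at f1 f2 f4 f5 ⊢
    refine ⟨?_, ?_, ?_, ?_⟩
    · linear_combination 2 * f5 - f2 / 2
    · linear_combination -2 * f5 - f2 / 2
    · linear_combination 2 * f4 + f1 / 2
    · linear_combination 2 * f4 - f1 / 2
  have hxx : ∀ z ∈ D, dx (dx r) z = ((Wx z - 4 * A) / (2 * W z)) • dx r z +
      (2 * B / W z) • dy r z + W z • r z := by
    intro z hz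
    obtain ⟨g1, g2, g3, g4⟩ := hcoef z hz
    have hW := (h.pos z hz).ne'
    have hL := (hLMN z hz).1
    rw [coeffL] at hL
    have e : det3 (dx (dx r) z) (dy r z) (r z) = -det3 (dy r z) (dx (dx r) z) (r z) := by
      simp only [det3_eq]; ring
    have key := cramer3 hW (hdet z hz) (dx (dx r) z)
    rw [e, g1, g4, hL] at key
    rw [key]
    congr 2
    · congr 1; field_simp; ring
    · field_simp
  refine ⟨hr, hxx, fun z hz => ?_, fun z hz => ?_⟩
  · obtain ⟨g1, g2, g3, g4⟩ := hcoef z hz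
    have hW := (h.pos z hz).ne'
    have hM := (hLMN z hz).2.1
    rw [coeffM] at hM
    have e : det3 (dy (dx r) z) (dy r z) (r z) = -det3 (dy r z) (dy (dx r) z) (r z) := by
      simp only [det3_eq]; ring
    have key := cramer3 hW (hdet z hz) (dy (dx r) z)
    rw [e, g2, g3, hM] at key
    rw [key, zero_div, zero_smul, add_zero]
    congr 2
    · ring
    · field_simp; ring
  · have hyy : dy (dy r) z = (2 * W z) • r z - dx (dx r) z := by rw [← hlap z hz]; abel
    rw [hyy, hxx z hz]
    module

end GaussSystem

/-! ### Solutions of the structure equations on a strip -/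

/-- Uniqueness for a total differential system: first along the axis y = 0, then along each vertical
line. Existence, which would need integrability conditions, is not at issue. -/
lemma eq_zero_on_strip {E : Type*} [NormedAddCommGroup E] [NormedSpace ℝ E] {w : ℝ} (hw : 0 < w)
    {F Fx Fy : ℝ × ℝ → E} {k : ℝ × ℝ → ℝ} (hk : ContinuousOn k (Ioo (-w) w ×ˢ univ))
    (hx : ∀ z ∈ Ioo (-w) w ×ˢ (univ : Set ℝ), HasDerivAt (fun u => F (u, z.2)) (Fx z) z.1)
    (hy : ∀ z ∈ Ioo (-w) w ×ˢ (univ : Set ℝ), HasDerivAt (fun u => F (z.1, u)) (Fy z) z.2)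
    (hbx : ∀ z ∈ Ioo (-w) w ×ˢ (univ : Set ℝ), ‖Fx z‖ ≤ k z * ‖F z‖)
    (hby : ∀ z ∈ Ioo (-w) w ×ˢ (univ : Set ℝ), ‖Fy z‖ ≤ k z * ‖F z‖)
    (h0 : F (0, 0) = 0) : ∀ z ∈ Ioo (-w) w ×ˢ (univ : Set ℝ), F z = 0 := by
  have hm : ∀ {x y : ℝ}, x ∈ Ioo (-w) w → (x, y) ∈ Ioo (-w) w ×ˢ (univ : Set ℝ) :=
    fun h => ⟨h, mem_univ _⟩
  have h1 : ∀ x ∈ Ioo (-w) w, F (x, 0) = 0 :=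
    eq_zero_of_norm_deriv_le (f := fun x => F (x, 0)) (f' := fun x => Fx (x, 0))
      (k := fun x => k (x, 0)) ordConnected_Ioo (fun x h => hx (x, 0) (hm h))
      (hk.comp (by fun_prop) fun x h => hm h) (fun x h => hbx (x, 0) (hm h))
      (x₀ := 0) ⟨by linarith, hw⟩ h0
  rintro ⟨x, y⟩ ⟨hx', -⟩
  exact eq_zero_of_norm_deriv_le (f := fun y => F (x, y)) (f' := fun y => Fy (x, y))
    (k := fun y => k (x, y)) (s := univ) ordConnected_univ (fun y _ => hy (x, y) (hm hx'))
    (hk.comp (by fun_prop) fun y _ => hm hx') (fun y _ => hby (x, y) (hm hx'))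
    (x₀ := 0) (mem_univ _) (h1 x hx') y (mem_univ _)

lemma isOpen_strip (w : ℝ) : IsOpen (Ioo (-w) w ×ˢ (univ : Set ℝ)) := isOpen_Ioo.prod isOpen_univ

namespace GaussSystem

variable {V V' : Type*} [NormedAddCommGroup V] [NormedSpace ℝ V] [NormedAddCommGroup V']
  [NormedSpace ℝ V'] {D : Set (ℝ × ℝ)} {W Wx : ℝ × ℝ → ℝ} {A B : ℝ} {r s : ℝ × ℝ → V}

lemma clm_comp (h : GaussSystem D r W Wx A B) (hD : IsOpen D) (T : V →L[ℝ] V') :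
    GaussSystem D (fun z => T (r z)) W Wx A B := by
  have hx : ∀ z ∈ D, dx (fun z => T (r z)) z = T (dx r z) := fun z hz =>
    dx_clm_comp T (h.smooth.differentiableAt_of_isOpen hD hz)
  have hy : ∀ z ∈ D, dy (fun z => T (r z)) z = T (dy r z) := fun z hz =>
    dy_clm_comp T (h.smooth.differentiableAt_of_isOpen hD hz)
  have hx' : ∀ z ∈ D, (dx fun z => T (r z)) =ᶠ[𝓝 z] fun z => T (dx r z) := fun z hz => by
    filter_upwards [hD.mem_nhds hz] with w hw using hx w hw
  have hy' : ∀ z ∈ D, (dy fun z => T (r z)) =ᶠ[𝓝 z] fun z => T (dy r z) := fun z hz => by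
    filter_upwards [hD.mem_nhds hz] with w hw using hy w hw
  have dX : ∀ z ∈ D, DifferentiableAt ℝ (dx r) z := fun z hz =>
    (contDiffOn_dx h.smooth hD).differentiableAt_of_isOpen hD hz
  have dY : ∀ z ∈ D, DifferentiableAt ℝ (dy r) z := fun z hz =>
    (contDiffOn_dy h.smooth hD).differentiableAt_of_isOpen hD hz
  refine ⟨T.contDiff.comp_contDiffOn h.smooth, fun z hz => ?_, fun z hz => ?_, fun z hz => ?_⟩
  · rw [dx_congr (hx' z hz), dx_clm_comp T (dX z hz), h.xx z hz, hx z hz, hy z hz]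
    simp
  · rw [dy_congr (hx' z hz), dy_clm_comp T (dX z hz), h.xy z hz, hx z hz, hy z hz]
    simp
  · rw [dy_congr (hy' z hz), dy_clm_comp T (dY z hz), h.yy z hz, hx z hz, hy z hz]
    simp

lemma sub (hr : GaussSystem D r W Wx A B) (hs : GaussSystem D s W Wx A B) (hD : IsOpen D) :
    GaussSystem D (fun z => r z - s z) W Wx A B := by
  have hx : ∀ z ∈ D, dx (fun z => r z - s z) z = dx r z - dx s z := fun z hz =>
    dx_sub (hr.smooth.differentiableAt_of_isOpen hD hz)
      (hs.smooth.differentiableAt_of_isOpen hD hz)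
  have hy : ∀ z ∈ D, dy (fun z => r z - s z) z = dy r z - dy s z := fun z hz =>
    dy_sub (hr.smooth.differentiableAt_of_isOpen hD hz)
      (hs.smooth.differentiableAt_of_isOpen hD hz)
  have hx' : ∀ z ∈ D, (dx fun z => r z - s z) =ᶠ[𝓝 z] fun z => dx r z - dx s z := fun z hz => by
    filter_upwards [hD.mem_nhds hz] with w hw using hx w hw
  have hy' : ∀ z ∈ D, (dy fun z => r z - s z) =ᶠ[𝓝 z] fun z => dy r z - dy s z := fun z hz => by
    filter_upwards [hD.mem_nhds hz] with w hw using hy w hw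
  have dX : ∀ {r : ℝ × ℝ → V}, GaussSystem D r W Wx A B → ∀ z ∈ D,
      DifferentiableAt ℝ (dx r) z := fun h z hz =>
    (contDiffOn_dx h.smooth hD).differentiableAt_of_isOpen hD hz
  have dY : ∀ {r : ℝ × ℝ → V}, GaussSystem D r W Wx A B → ∀ z ∈ D,
      DifferentiableAt ℝ (dy r) z := fun h z hz =>
    (contDiffOn_dy h.smooth hD).differentiableAt_of_isOpen hD hz
  refine ⟨hr.smooth.sub hs.smooth, fun z hz => ?_, fun z hz => ?_, fun z hz => ?_⟩
  · rw [dx_congr (hx' z hz), dx_sub (dX hr z hz) (dX hs z hz), hr.xx z hz, hs.xx z hz, hx z hz,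
      hy z hz]
    module
  · rw [dy_congr (hx' z hz), dy_sub (dX hr z hz) (dX hs z hz), hr.xy z hz, hs.xy z hz, hx z hz,
      hy z hz]
    module
  · rw [dy_congr (hy' z hz), dy_sub (dY hr z hz) (dY hs z hz), hr.yy z hz, hs.yy z hz, hx z hz,
      hy z hz]
    module

lemma pi {r : ℝ × ℝ → Fin 3 → ℝ} (h : ∀ i, GaussSystem D (fun z => r z i) W Wx A B)
    (hD : IsOpen D) : GaussSystem D r W Wx A B := by
  have hs : ContDiffOn ℝ ∞ r D := contDiffOn_pi.mpr fun i => (h i).smooth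
  have dr : ∀ z ∈ D, DifferentiableAt ℝ r z := fun z hz => hs.differentiableAt_of_isOpen hD hz
  have hx : ∀ i, ∀ z ∈ D, dx (fun z => r z i) z = dx r z i := fun i z hz => dx_apply (dr z hz) i
  have hy : ∀ i, ∀ z ∈ D, dy (fun z => r z i) z = dy r z i := fun i z hz => dy_apply (dr z hz) i
  have hx' : ∀ i, ∀ z ∈ D, (dx fun z => r z i) =ᶠ[𝓝 z] fun z => dx r z i := fun i z hz => by
    filter_upwards [hD.mem_nhds hz] with w hw using hx i w hw
  have hy' : ∀ i, ∀ z ∈ D, (dy fun z => r z i) =ᶠ[𝓝 z] fun z => dy r z i := fun i z hz => by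
    filter_upwards [hD.mem_nhds hz] with w hw using hy i w hw
  have dX : ∀ z ∈ D, DifferentiableAt ℝ (dx r) z := fun z hz =>
    (contDiffOn_dx hs hD).differentiableAt_of_isOpen hD hz
  have dY : ∀ z ∈ D, DifferentiableAt ℝ (dy r) z := fun z hz =>
    (contDiffOn_dy hs hD).differentiableAt_of_isOpen hD hz
  refine ⟨hs, fun z hz => ?_, fun z hz => ?_, fun z hz => ?_⟩ <;> ext i
  · have := (h i).xx z hz
    rw [dx_congr (hx' i z hz), dx_apply (dX z hz), hx i z hz, hy i z hz] at this
    simpa using this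
  · have := (h i).xy z hz
    rw [dy_congr (hx' i z hz), dy_apply (dX z hz), hx i z hz, hy i z hz] at this
    simpa using this
  · have := (h i).yy z hz
    rw [dy_congr (hy' i z hz), dy_apply (dY z hz), hx i z hz, hy i z hz] at this
    simpa using this

lemma norm_combination_le {x y v : V} (a b c : ℝ) :
    ‖a • x + b • y + c • v‖ ≤ (|a| + |b| + |c|) * ‖((x, y, v) : V × V × V)‖ := by
  have h1 : ‖x‖ ≤ ‖((x, y, v) : V × V × V)‖ := norm_fst_le (x, y, v)
  have h2 : ‖y‖ ≤ ‖((x, y, v) : V × V × V)‖ :=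
    (norm_fst_le (y, v)).trans (norm_snd_le (x, y, v))
  have h3 : ‖v‖ ≤ ‖((x, y, v) : V × V × V)‖ :=
    (norm_snd_le (y, v)).trans (norm_snd_le (x, y, v))
  refine (norm_add₃_le).trans ?_
  rw [norm_smul, norm_smul, norm_smul, add_mul, add_mul]
  simp only [Real.norm_eq_abs]
  gcongr

/-- The triple (r_x, r_y, r) satisfies a closed first order linear system, so it vanishes on the
strip if it vanishes at the origin. The function k is a crude sum of the coefficients that bounds
both partial derivatives. -/
lemma eq_zero {w : ℝ} (hw : 0 < w) (h : GaussSystem (Ioo (-w) w ×ˢ univ) r W Wx A B)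
    (hW : ContinuousOn W (Ioo (-w) w ×ˢ univ)) (hWx : ContinuousOn Wx (Ioo (-w) w ×ˢ univ))
    (hW0 : ∀ z ∈ Ioo (-w) w ×ˢ (univ : Set ℝ), W z ≠ 0)
    (h1 : dx r (0, 0) = 0) (h2 : dy r (0, 0) = 0) (h3 : r (0, 0) = 0) :
    ∀ z ∈ Ioo (-w) w ×ˢ (univ : Set ℝ), r z = 0 := by
  have hD := isOpen_strip w
  have dr : ∀ z ∈ Ioo (-w) w ×ˢ (univ : Set ℝ), DifferentiableAt ℝ r z := fun z hz =>
    h.smooth.differentiableAt_of_isOpen hD hz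
  have dX : ∀ z ∈ Ioo (-w) w ×ˢ (univ : Set ℝ), DifferentiableAt ℝ (dx r) z := fun z hz =>
    (contDiffOn_dx h.smooth hD).differentiableAt_of_isOpen hD hz
  have dY : ∀ z ∈ Ioo (-w) w ×ˢ (univ : Set ℝ), DifferentiableAt ℝ (dy r) z := fun z hz =>
    (contDiffOn_dy h.smooth hD).differentiableAt_of_isOpen hD hz
  have key := eq_zero_on_strip hw (F := fun z => (dx r z, dy r z, r z))
    (Fx := fun z => (dx (dx r) z, dx (dy r) z, dx r z))
    (Fy := fun z => (dy (dx r) z, dy (dy r) z, dy r z))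
    (k := fun z => |(Wx z - 4 * A) / (2 * W z)| + |2 * B / W z| + |W z| +
      |(Wx z + 4 * A) / (2 * W z)| + 1)
    (by fun_prop (disch := simpa using hW0))
    (fun z hz => (hasDerivAt_dx (dX z hz)).prodMk
      ((hasDerivAt_dx (dY z hz)).prodMk (hasDerivAt_dx (dr z hz))))
    (fun z hz => (hasDerivAt_dy (dX z hz)).prodMk
      ((hasDerivAt_dy (dY z hz)).prodMk (hasDerivAt_dy (dr z hz))))
    (fun z hz => ?_) (fun z hz => ?_) (by simp [h1, h2, h3])
  · intro z hz
    exact congrArg (fun v : V × V × V => v.2.2) (key z hz)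
  all_goals
    have nn := norm_nonneg ((dx r z, dy r z, r z) : V × V × V)
    have b1 := norm_combination_le (x := dx r z) (y := dy r z) (v := r z)
      ((Wx z - 4 * A) / (2 * W z)) (2 * B / W z) (W z)
    have b2 := norm_combination_le (x := dx r z) (y := dy r z) (v := r z)
      (2 * B / W z) ((Wx z + 4 * A) / (2 * W z)) 0
    have b3 := norm_combination_le (x := dx r z) (y := dy r z) (v := r z)
      (-((Wx z - 4 * A) / (2 * W z))) (-(2 * B / W z)) (W z)
    have b4 := norm_combination_le (x := dx r z) (y := dy r z) (v := r z) 1 0 0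
    have b5 := norm_combination_le (x := dx r z) (y := dy r z) (v := r z) 0 1 0
    rw [← h.xx z hz] at b1
    rw [zero_smul, add_zero, ← h.xy z hz] at b2
    rw [neg_smul (2 * B / W z), ← sub_eq_add_neg, ← h.yy z hz] at b3
    simp only [one_smul, zero_smul, add_zero, zero_add, abs_one, abs_zero, abs_neg] at b2 b3 b4 b5
    have p1 := abs_nonneg ((Wx z - 4 * A) / (2 * W z))
    have p2 := abs_nonneg (2 * B / W z)
    have p3 := abs_nonneg (W z)
    have p4 := abs_nonneg ((Wx z + 4 * A) / (2 * W z))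
  · rw [Prod.norm_def, Prod.norm_def]
    simp only [dx_dy_comm h.smooth hD hz]
    refine max_le (b1.trans ?_) (max_le (b2.trans ?_) (b4.trans ?_)) <;> gcongr ?_ * _ <;> linarith
  · rw [Prod.norm_def, Prod.norm_def]
    refine max_le (b2.trans ?_) (max_le (b3.trans ?_) (b5.trans ?_)) <;> gcongr ?_ * _ <;> linarith

/-- The traces of the two coefficient matrices of the frame system are W_x/W and 0, so the
difference of the determinant and W obeys a homogeneous linear equation. -/
lemma det_eq {r : ℝ × ℝ → Fin 3 → ℝ} {w : ℝ} (hw : 0 < w)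
    (h : GaussSystem (Ioo (-w) w ×ˢ univ) r W Wx A B)
    (hW : ContinuousOn W (Ioo (-w) w ×ˢ univ)) (hWx : ContinuousOn Wx (Ioo (-w) w ×ˢ univ))
    (hW0 : ∀ z ∈ Ioo (-w) w ×ˢ (univ : Set ℝ), W z ≠ 0)
    (hdx : ∀ z ∈ Ioo (-w) w ×ˢ (univ : Set ℝ), HasDerivAt (fun u => W (u, z.2)) (Wx z) z.1)
    (hdy : ∀ z ∈ Ioo (-w) w ×ˢ (univ : Set ℝ), HasDerivAt (fun u => W (z.1, u)) 0 z.2)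
    (h0 : det3 (dx r (0, 0)) (dy r (0, 0)) (r (0, 0)) = W (0, 0)) :
    ∀ z ∈ Ioo (-w) w ×ˢ (univ : Set ℝ), det3 (dx r z) (dy r z) (r z) = W z := by
  have hD := isOpen_strip w
  have dr : ∀ z ∈ Ioo (-w) w ×ˢ (univ : Set ℝ), DifferentiableAt ℝ r z := fun z hz =>
    h.smooth.differentiableAt_of_isOpen hD hz
  have dX : ∀ z ∈ Ioo (-w) w ×ˢ (univ : Set ℝ), DifferentiableAt ℝ (dx r) z := fun z hz =>
    (contDiffOn_dx h.smooth hD).differentiableAt_of_isOpen hD hz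
  have dY : ∀ z ∈ Ioo (-w) w ×ˢ (univ : Set ℝ), DifferentiableAt ℝ (dy r) z := fun z hz =>
    (contDiffOn_dy h.smooth hD).differentiableAt_of_isOpen hD hz
  have key := eq_zero_on_strip hw (F := fun z => det3 (dx r z) (dy r z) (r z) - W z)
    (Fx := fun z => Wx z / W z * (det3 (dx r z) (dy r z) (r z) - W z)) (Fy := fun z => 0)
    (k := fun z => |Wx z / W z|) (by fun_prop (disch := simpa using hW0))
    (fun z hz => by
      refine ((hasDerivAt_det3 (hasDerivAt_dx (dX z hz)) (hasDerivAt_dx (dY z hz))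
        (hasDerivAt_dx (dr z hz))).sub (hdx z hz)).congr_deriv ?_
      have := hW0 z hz
      rw [dx_dy_comm h.smooth hD hz, h.xx z hz, h.xy z hz]
      simp only [det3_eq, Pi.add_apply, Pi.smul_apply, smul_eq_mul, Prod.mk.eta]
      field_simp
      ring)
    (fun z hz => by
      refine ((hasDerivAt_det3 (hasDerivAt_dy (dX z hz)) (hasDerivAt_dy (dY z hz))
        (hasDerivAt_dy (dr z hz))).sub (hdy z hz)).congr_deriv ?_
      have := hW0 z hz
      rw [h.xy z hz, h.yy z hz]
      simp only [det3_eq, Pi.add_apply, Pi.sub_apply, Pi.smul_apply, smul_eq_mul, Prod.mk.eta]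
      field_simp
      ring)
    (fun z hz => by rw [norm_mul]; rfl)
    (fun z hz => by rw [norm_zero]; positivity) (by rw [h0, sub_self])
  exact fun z hz => sub_eq_zero.mp (key z hz)

/-- Two surfaces with the same invariants differ by a unimodular linear map. -/
lemma exists_matrix {r s : ℝ × ℝ → Fin 3 → ℝ} {w : ℝ} (hw : 0 < w)
    (hr : GaussSystem (Ioo (-w) w ×ˢ univ) r W Wx A B)
    (hs : GaussSystem (Ioo (-w) w ×ˢ univ) s W Wx A B)
    (hW : ContinuousOn W (Ioo (-w) w ×ˢ univ)) (hWx : ContinuousOn Wx (Ioo (-w) w ×ˢ univ))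
    (hW0 : ∀ z ∈ Ioo (-w) w ×ˢ (univ : Set ℝ), W z ≠ 0)
    (hrd : det3 (dx r (0, 0)) (dy r (0, 0)) (r (0, 0)) = W (0, 0))
    (hsd : det3 (dx s (0, 0)) (dy s (0, 0)) (s (0, 0)) = W (0, 0)) :
    ∃ M : Matrix (Fin 3) (Fin 3) ℝ, M.det = 1 ∧
      ∀ z ∈ Ioo (-w) w ×ˢ (univ : Set ℝ), r z = M.mulVec (s z) := by
  have hD := isOpen_strip w
  have hz0 : ((0 : ℝ), (0 : ℝ)) ∈ Ioo (-w) w ×ˢ (univ : Set ℝ) :=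
    ⟨⟨by simpa using hw, hw⟩, mem_univ _⟩
  have hne := hW0 _ hz0
  set R : Matrix (Fin 3) (Fin 3) ℝ := Matrix.of ![dx r (0, 0), dy r (0, 0), r (0, 0)] with hR
  set S : Matrix (Fin 3) (Fin 3) ℝ := Matrix.of ![dx s (0, 0), dy s (0, 0), s (0, 0)] with hS
  have hRd : R.det = W (0, 0) := hrd
  have hSd : S.det = W (0, 0) := hsd
  have hSu : IsUnit S.det := by rw [hSd]; exact isUnit_iff_ne_zero.mpr hne
  -- The frames at the origin are stored in rows, hence the transpose: M carries the frame of s to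
  -- that of r. The two frames have the same determinant, so M has determinant 1.
  set M : Matrix (Fin 3) (Fin 3) ℝ := (S⁻¹ * R).transpose with hM
  have hSM : S * M.transpose = R := by
    rw [hM, Matrix.transpose_transpose, ← Matrix.mul_assoc, Matrix.mul_nonsing_inv _ hSu,
      Matrix.one_mul]
  have hrow : ∀ i, M.mulVec (S i) = R i := fun i => by
    rw [← hSM, ← Matrix.vecMul_transpose]
    rfl
  set T : (Fin 3 → ℝ) →L[ℝ] (Fin 3 → ℝ) := LinearMap.toContinuousLinearMap M.mulVecLin with hT
  have hTa : ∀ v, T v = M.mulVec v := fun v => rfl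
  have hTs := hs.clm_comp hD T
  have ds := hs.smooth.differentiableAt_of_isOpen hD hz0
  have dTs := hTs.smooth.differentiableAt_of_isOpen hD hz0
  have drr := hr.smooth.differentiableAt_of_isOpen hD hz0
  have key := (hr.sub hTs hD).eq_zero hw hW hWx hW0
    (by rw [dx_sub drr dTs, dx_clm_comp T ds, hTa]; exact sub_eq_zero.mpr (hrow 0).symm)
    (by rw [dy_sub drr dTs, dy_clm_comp T ds, hTa]; exact sub_eq_zero.mpr (hrow 1).symm)
    (by rw [hTa]; exact sub_eq_zero.mpr (hrow 2).symm)
  refine ⟨M, ?_, fun z hz => sub_eq_zero.mp (key z hz)⟩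
  have := congrArg Matrix.det hSM
  rw [Matrix.det_mul, Matrix.det_transpose, hRd, hSd] at this
  exact mul_left_cancel₀ hne (by rw [this, mul_one])

/-- Separated solutions `X(x) exp(f y)` of the structure equations. -/
lemma separated {w : ℝ} {X X' U U' : ℝ → ℝ} {f : ℝ}
    (hsm : ContDiffOn ℝ ∞ X (Ioo (-w) w)) (hU : ∀ x ∈ Ioo (-w) w, 0 < U x)
    (hX : ∀ x ∈ Ioo (-w) w, HasDerivAt X (X' x) x)
    (hX' : ∀ x ∈ Ioo (-w) w, HasDerivAt X' ((2 * U x - f ^ 2) * X x) x)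
    (h1 : ∀ x ∈ Ioo (-w) w, f * (2 * U x * X' x) = f * (U' x + 4 * A) * X x + 4 * B * X' x)
    (h2 : ∀ x ∈ Ioo (-w) w, (U' x - 4 * A) * X' x =
      2 * (U x ^ 2 - f ^ 2 * U x - 2 * B * f) * X x) :
    GaussSystem (Ioo (-w) w ×ˢ univ) (fun z => X z.1 * Real.exp (f * z.2))
      (fun z => U z.1) (fun z => U' z.1) A B := by
  have hD := isOpen_strip w
  have hexp : ∀ y : ℝ, HasDerivAt (fun y => Real.exp (f * y)) (f * Real.exp (f * y)) y :=
    fun y => (((hasDerivAt_id y).const_mul f).exp).congr_deriv (by simp [mul_comm])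
  have ex : ∀ z ∈ Ioo (-w) w ×ˢ (univ : Set ℝ),
      dx (fun z => X z.1 * Real.exp (f * z.2)) z = X' z.1 * Real.exp (f * z.2) := fun z hz =>
    ((hX z.1 hz.1).mul_const (Real.exp (f * z.2))).deriv
  have ey : ∀ z : ℝ × ℝ,
      dy (fun z => X z.1 * Real.exp (f * z.2)) z = X z.1 * (f * Real.exp (f * z.2)) := fun z =>
    ((hexp z.2).const_mul (X z.1)).deriv
  have ex' : ∀ z ∈ Ioo (-w) w ×ˢ (univ : Set ℝ),
      (dx fun z => X z.1 * Real.exp (f * z.2)) =ᶠ[𝓝 z]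
        fun z => X' z.1 * Real.exp (f * z.2) := fun z hz => by
    filter_upwards [hD.mem_nhds hz] with v hv using ex v hv
  have exx : ∀ z ∈ Ioo (-w) w ×ˢ (univ : Set ℝ),
      dx (dx fun z => X z.1 * Real.exp (f * z.2)) z =
        (2 * U z.1 - f ^ 2) * X z.1 * Real.exp (f * z.2) := fun z hz => by
    rw [dx_congr (ex' z hz)]
    exact ((hX' z.1 hz.1).mul_const (Real.exp (f * z.2))).deriv
  have exy : ∀ z ∈ Ioo (-w) w ×ˢ (univ : Set ℝ),
      dy (dx fun z => X z.1 * Real.exp (f * z.2)) z =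
        X' z.1 * (f * Real.exp (f * z.2)) := fun z hz => by
    rw [dy_congr (ex' z hz)]
    exact ((hexp z.2).const_mul (X' z.1)).deriv
  have eyy : ∀ z : ℝ × ℝ, dy (dy fun z => X z.1 * Real.exp (f * z.2)) z =
        X z.1 * (f * (f * Real.exp (f * z.2))) := fun z => by
    rw [show (dy fun z : ℝ × ℝ => X z.1 * Real.exp (f * z.2)) = _ from funext ey]
    exact (((hexp z.2).const_mul f).const_mul (X z.1)).deriv
  refine ⟨?_, fun z hz => ?_, fun z hz => ?_, fun z hz => ?_⟩
  · exact (hsm.comp contDiffOn_fst fun z hz => hz.1).mul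
      (Real.contDiff_exp.comp (contDiff_const.mul contDiff_snd)).contDiffOn
  · have hp := (hU z.1 hz.1).ne'
    rw [exx z hz, ex z hz, ey z]
    simp only [smul_eq_mul]
    field_simp
    linear_combination -(h2 z.1 hz.1)
  · have hp := (hU z.1 hz.1).ne'
    rw [exy z hz, ex z hz, ey z]
    simp only [smul_eq_mul]
    field_simp
    linear_combination h1 z.1 hz.1
  · have hp := (hU z.1 hz.1).ne'
    rw [eyy z, ex z hz, ey z]
    simp only [smul_eq_mul]
    field_simp
    linear_combination h2 z.1 hz.1

end GaussSystem

/-- Here 2 e^ψ = W, so e^ψ = W/2 and ψ_z = W_x/(2W). The frame equations are the real system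
rewritten with ∂/∂z and ∂/∂z̄; the determinant of r plays no role. -/
lemma GaussSystem.solvesFrameEquations {D : Set (ℝ × ℝ)} {W Wx : ℝ × ℝ → ℝ} {A B : ℝ}
    {r : ℝ × ℝ → Fin 3 → ℝ} (h : GaussSystem D r W Wx A B) (hD : IsOpen D)
    (hpos : ∀ z ∈ D, 0 < W z)
    (hdx : ∀ z ∈ D, HasDerivAt (fun u => W (u, z.2)) (Wx z) z.1)
    (hdy : ∀ z ∈ D, HasDerivAt (fun u => W (z.1, u)) 0 z.2) {U lam : ℂ}
    (hU : lam * U = A + B * Complex.I)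
    (hU' : lam⁻¹ * (starRingEnd ℂ) U = A - B * Complex.I) :
    SolvesFrameEquations D r (fun z => Real.log (W z / 2)) (-1) U lam := by
  have hr := h.smooth
  have px : ∀ z ∈ D, dx (fun w => ((Real.log (W w / 2) : ℝ) : ℂ)) z = (Wx z / W z : ℝ) :=
    fun z hz => by
      have hp := hpos z hz
      refine HasDerivAt.deriv (HasDerivAt.ofReal_comp ?_)
      refine (((hdx z hz).div_const 2).log (by positivity)).congr_deriv ?_
      simp only [Prod.mk.eta]; field_simp
  have py : ∀ z ∈ D, dy (fun w => ((Real.log (W w / 2) : ℝ) : ℂ)) z = 0 := fun z hz => by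
      have hp := hpos z hz
      refine HasDerivAt.deriv ((HasDerivAt.ofReal_comp (z := z.2)
        (f := fun u => Real.log (W (z.1, u) / 2)) (u := 0) ?_).congr_deriv (by simp))
      exact (((hdy z hz).div_const 2).log (by simp [hp.ne'])).congr_deriv (by simp)
  have e1 : ∀ z ∈ D, (Real.exp (Real.log (W z / 2)) : ℂ) = W z / 2 := fun z hz => by
    rw [Real.exp_log (by have := hpos z hz; positivity)]; push_cast; rfl
  have e2 : ∀ z ∈ D, (Real.exp (-Real.log (W z / 2)) : ℂ) = 2 / W z := fun z hz => by
    rw [Real.exp_neg, Real.exp_log (by have := hpos z hz; positivity)]; push_cast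
    rw [inv_div]
  have xx : ∀ z ∈ D, ∀ i, (dx (dx r) z i : ℂ) = (Wx z - 4 * A) / (2 * W z) * dx r z i +
      2 * B / W z * dy r z i + W z * r z i := fun z hz i => by
    have := congrFun (h.xx z hz) i
    simp only [Pi.add_apply, Pi.smul_apply, smul_eq_mul] at this
    rw [this]; push_cast; rfl
  have xy : ∀ z ∈ D, ∀ i, (dy (dx r) z i : ℂ) = 2 * B / W z * dx r z i +
      (Wx z + 4 * A) / (2 * W z) * dy r z i := fun z hz i => by
    have := congrFun (h.xy z hz) i
    simp only [Pi.add_apply, Pi.smul_apply, smul_eq_mul] at this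
    rw [this]; push_cast; rfl
  have yy : ∀ z ∈ D, ∀ i, (dy (dy r) z i : ℂ) = -((Wx z - 4 * A) / (2 * W z)) * dx r z i -
      2 * B / W z * dy r z i + W z * r z i := fun z hz i => by
    have := congrFun (h.yy z hz) i
    simp only [Pi.add_apply, Pi.sub_apply, Pi.smul_apply, smul_eq_mul] at this
    rw [this]; push_cast; rfl
  have f2 : ∀ i, (fun w => frame r (-1) w i 2) = fun w => (r w i : ℂ) := fun i => by
    ext w; simp [frame]
  refine ⟨hr, fun z hz => ?_, fun z hz => ?_⟩
  all_goals
    have dr := hr.differentiableAt_of_isOpen hD hz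
    have hp : (W z : ℂ) ≠ 0 := by exact_mod_cast (hpos z hz).ne'
    ext i j
    rw [e1 z hz, e2 z hz]
    simp only [neg_mul, hU, hU']
    fin_cases j
  · simp only [Fin.zero_eta, Fin.isValue, Matrix.of_apply, Matrix.mul_apply, Fin.sum_univ_three]
    change dz (dz fun w => (r w i : ℂ)) z = _
    simp [frame, dz_dz_apply hD hr hz, dz_apply dr, dzbar_apply dr, xx z hz, xy z hz, yy z hz]
    rw [dz, px z hz, py z hz, Complex.ofReal_div]
    field_simp
    ring_nf
    simp only [Complex.I_sq]
    ring
  · simp only [Fin.mk_one, Fin.isValue, Matrix.of_apply, Matrix.mul_apply, Fin.sum_univ_three]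
    change dz (dzbar fun w => (r w i : ℂ)) z = _
    simp [frame, dz_dzbar_apply hD hr hz, dz_apply dr, dzbar_apply dr, xx z hz, yy z hz]
    ring
  · simp only [Fin.reduceFinMk, Fin.isValue, Matrix.of_apply, Matrix.mul_apply, Fin.sum_univ_three,
      f2]
    simp [frame]
  · simp only [Fin.zero_eta, Fin.isValue, Matrix.of_apply, Matrix.mul_apply, Fin.sum_univ_three]
    change dzbar (dz fun w => (r w i : ℂ)) z = _
    simp [frame, dzbar_dz_apply hD hr hz, dz_apply dr, dzbar_apply dr, xx z hz, yy z hz]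
    ring
  · simp only [Fin.mk_one, Fin.isValue, Matrix.of_apply, Matrix.mul_apply, Fin.sum_univ_three]
    change dzbar (dzbar fun w => (r w i : ℂ)) z = _
    simp [frame, dzbar_dzbar_apply hD hr hz, dz_apply dr, dzbar_apply dr, xx z hz, xy z hz,
      yy z hz]
    rw [dzbar, px z hz, py z hz, Complex.ofReal_div]
    field_simp
    ring_nf
    simp only [Complex.I_sq]
    ring
  · simp only [Fin.reduceFinMk, Fin.isValue, Matrix.of_apply, Matrix.mul_apply, Fin.sum_univ_three,
      f2]
    simp [frame]

/-! ### The constants of the associated family -/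

lemma add_mem {w x : ℝ} (hx : x ∈ Ioo (-w) w) : x + w ∈ Ioo 0 (2 * w) :=
  ⟨by linarith [hx.1], by linarith [hx.2]⟩

/-- The standing hypotheses on the constants and on the lattice. -/
structure IsSetup (p q c : ℝ) (L : PeriodPair) (w : ℝ) : Prop where
  two_le : 2 ≤ p
  conjugate : 1 / p + 1 / q = 1
  lt_c : -2 * (p + q) < c
  c_neg : c < 0
  g2 : L.g₂ = (invg2 p q : ℂ)
  g3 : L.g₃ = (invg3 p q c : ℂ)
  halfPeriod : IsRealHalfPeriod L w

/-- The constant `(p² - p + 1) / (p - 1)`, equal to `p + q - 1`. -/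
def shape (p : ℝ) : ℝ := (p ^ 2 - p + 1) / (p - 1)

/-- The conformal factor as a function of the first coordinate. -/
def factor (p : ℝ) (L : PeriodPair) (w x : ℝ) : ℝ := realP L (x + w) + shape p / 12

/-- The derivative of the conformal factor. -/
def factor' (L : PeriodPair) (w x : ℝ) : ℝ := realP' L (x + w)

namespace IsSetup

variable {p q c : ℝ} {L : PeriodPair} {w : ℝ} (d : IsSetup p q c L w)
include d

lemma g2_im : L.g₂.im = 0 := by rw [d.g2, Complex.ofReal_im]

lemma g3_im : L.g₃.im = 0 := by rw [d.g3, Complex.ofReal_im]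

lemma pos : 0 < w := d.halfPeriod.1.1

lemma zero_mem : (0 : ℝ) ∈ Ioo (-w) w := ⟨by linarith [d.pos], d.pos⟩

lemma q_eq : q = p / (p - 1) := by
  have h := d.two_le
  have h1 : p ≠ 0 := by linarith
  have h2 : p - 1 ≠ 0 := by linarith
  have hq : q ≠ 0 := by
    rintro rfl
    have h3 := d.conjugate
    rw [div_zero, add_zero, div_eq_one_iff_eq h1] at h3
    linarith
  have h3 := d.conjugate
  field_simp at h3 ⊢
  linarith

lemma sub_one_pos : 0 < p - 1 := by linarith [d.two_le]

lemma p_pos : 0 < p := by linarith [d.two_le]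

lemma mul_eq : p * q = p + q := by
  have := d.sub_one_pos.ne'
  rw [d.q_eq]; field_simp; ring

lemma sum_eq : p + q = p ^ 2 / (p - 1) := by
  have := d.sub_one_pos.ne'
  rw [d.q_eq]; field_simp; ring

lemma shape_eq : shape p = p + q - 1 := by
  have := d.sub_one_pos.ne'
  rw [d.q_eq, shape]; field_simp; ring

lemma four_le : 4 ≤ p + q := by
  rw [d.sum_eq, le_div_iff₀ d.sub_one_pos]
  nlinarith [sq_nonneg (p - 2)]

lemma shape_pos : 0 < shape p := by
  rw [d.shape_eq]; linarith [d.four_le]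

lemma g2_re : L.g₂.re = shape p ^ 2 / 12 := by
  rw [d.g2, Complex.ofReal_re, invg2, b1, b2, d.mul_eq, d.shape_eq]; ring

/-- This identity makes 16 U'² the constant term of the equation for W'², and it turns the sign of
b₃ into a bound on U'. -/
lemma sq_modU : modU p c ^ 2 = shape p ^ 3 / 1728 + b3 p q c / 256 := by
  have h := d.sub_one_pos
  have h1 := d.p_pos
  rw [modU, Real.sq_sqrt (by positivity), b3, d.mul_eq, d.sum_eq, shape]
  field_simp
  ring

lemma g3_re : L.g₃.re = 1 / 16 * (-2 * (shape p / 3) ^ 3 - b3 p q c) := by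
  rw [d.g3, Complex.ofReal_re, invg3, b1, b2, d.mul_eq, d.shape_eq]; ring

/-- Since pq = p + q, b₃ = c²/(4(p + q)) - (p + q), which is negative exactly when |c| < 2(p + q).
The lower bound on c enters here. -/
lemma b3_neg : b3 p q c < 0 := by
  have h := d.four_le
  have h1 := d.lt_c
  have h2 := d.c_neg
  rw [b3, d.mul_eq, sub_neg, div_lt_iff₀ (by linarith)]
  nlinarith

lemma modU_pos : 0 < modU p c := by
  have h := d.sub_one_pos
  have h1 := d.p_pos
  have h2 := d.c_neg.ne
  refine Real.sqrt_pos.mpr (add_pos_of_pos_of_nonneg ?_ (by positivity))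
  positivity

lemma sq_modU_lt : modU p c ^ 2 < shape p ^ 3 / 1728 := by
  rw [d.sq_modU]; linarith [d.b3_neg]

lemma conformalFactor_eq (z : ℝ × ℝ) : conformalFactor p q L w z = factor p L w z.1 := by
  rw [conformalFactor, factor, realP, d.shape_eq, b1]
  push_cast
  ring

lemma hasDerivAt_factor {x : ℝ} (hx : x ∈ Ioo (-w) w) :
    HasDerivAt (factor p L w) (factor' L w x) x :=
  ((hasDerivAt_realP L (d.halfPeriod.notMem (add_mem hx))).comp_add_const x w).add_const _

lemma hasDerivAt_factor' {x : ℝ} (hx : x ∈ Ioo (-w) w) :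
    HasDerivAt (factor' L w) (6 * factor p L w x ^ 2 - shape p * factor p L w x) x := by
  refine ((hasDerivAt_realP' L d.g2_im d.g3_im
    (d.halfPeriod.notMem (add_mem hx))).comp_add_const x w).congr_deriv ?_
  rw [d.g2_re, factor]; ring

/-- The shift of ℘ by E/12 removes the linear term of the Weierstrass cubic. -/
lemma factor'_sq {x : ℝ} (hx : x ∈ Ioo (-w) w) : factor' L w x ^ 2 =
    4 * factor p L w x ^ 3 - shape p * factor p L w x ^ 2 + 16 * modU p c ^ 2 := by
  rw [factor', realP'_sq L d.g2_im d.g3_im (d.halfPeriod.notMem (add_mem hx)), d.g2_re, d.g3_re,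
    d.sq_modU, factor]
  ring

lemma factor'_zero : factor' L w 0 = 0 := by
  rw [factor', zero_add, realP'_halfPeriod d.halfPeriod]

/-- At W = E/6, the local minimum of 4W³ - E W² + 16 U'², the cubic has the value 16 U'² - E³/108 <
0. The cubic is positive above W(0) and vanishes at W(0), since W'(0) = 0; hence W(0) is larger than
E/6. -/
lemma lt_factor_zero : shape p / 6 < factor p L w 0 := by
  have h1 := d.sq_modU_lt
  have hE := d.shape_pos
  by_contra! hle
  rw [factor, zero_add] at hle
  rcases hle.lt_or_eq with h | h
  · have := cubic_pos_of_gt d.g2_im d.g3_im d.halfPeriod (v := shape p / 12) (by linarith)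
    rw [d.g2_re, d.g3_re] at this
    have h2 := d.sq_modU
    nlinarith
  · have h0 := d.factor'_sq d.zero_mem
    rw [d.factor'_zero, factor, zero_add, h] at h0
    nlinarith

lemma lt_factor {x : ℝ} (hx : x ∈ Ioo (-w) w) : shape p / 6 < factor p L w x := by
  refine d.lt_factor_zero.trans_le ?_
  rw [factor, factor, zero_add]
  linarith [realP_halfPeriod_le d.g2_im d.g3_im d.halfPeriod (add_mem hx)]

lemma factor_pos {x : ℝ} (hx : x ∈ Ioo (-w) w) : 0 < factor p L w x :=
  (div_pos d.shape_pos (by norm_num)).trans (d.lt_factor hx)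

/-- W'' is a polynomial in W, so the regularity of the pair (W, W') improves by one order at each
step. -/
lemma contDiffOn_factor : ContDiffOn ℝ ∞ (factor p L w) (Ioo (-w) w) ∧
    ContDiffOn ℝ ∞ (factor' L w) (Ioo (-w) w) := by
  have key : ∀ n : ℕ, ContDiffOn ℝ n (factor p L w) (Ioo (-w) w) ∧
      ContDiffOn ℝ n (factor' L w) (Ioo (-w) w) := by
    intro n
    induction n with
    | zero =>
      simp only [Nat.cast_zero, contDiffOn_zero]
      exact ⟨fun x hx => (d.hasDerivAt_factor hx).continuousAt.continuousWithinAt,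
        fun x hx => (d.hasDerivAt_factor' hx).continuousAt.continuousWithinAt⟩
    | succ n ih =>
      push_cast
      refine ⟨(contDiffOn_succ_iff_deriv_of_isOpen isOpen_Ioo).mpr ⟨fun x hx =>
        (d.hasDerivAt_factor hx).differentiableAt.differentiableWithinAt, by simp, ?_⟩,
        (contDiffOn_succ_iff_deriv_of_isOpen isOpen_Ioo).mpr ⟨fun x hx =>
        (d.hasDerivAt_factor' hx).differentiableAt.differentiableWithinAt, by simp, ?_⟩⟩
      · exact ih.2.congr fun x hx => (d.hasDerivAt_factor hx).deriv
      · exact ((contDiffOn_const.mul (ih.1.pow 2)).sub (contDiffOn_const.mul ih.1)).congr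
          fun x hx => (d.hasDerivAt_factor' hx).deriv
  exact ⟨contDiffOn_infty.mpr fun n => (key n).1, contDiffOn_infty.mpr fun n => (key n).2⟩

end IsSetup

/-! ### The exponents as the roots of a cubic -/

namespace IsSetup

variable {p q c : ℝ} {L : PeriodPair} {w : ℝ} (d : IsSetup p q c L w) (t : ℝ)
include d

lemma shape_div_twelve : (p ^ 2 - p + 1) / (12 * (p - 1)) = shape p / 12 := by
  have := d.sub_one_pos.ne'
  rw [shape]; field_simp

lemma abs_modU_lt (hS : |Real.sin (3 * t)| ≤ 1) :
    |modU p c * (-1) * Real.sin (3 * t) / √((shape p / 12) ^ 3)| < 1 := by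
  have hE := d.shape_pos
  have h1 : modU p c < √((shape p / 12) ^ 3) := by
    refine Real.lt_sqrt_of_sq_lt ?_
    have := d.sq_modU_lt
    linarith
  have h0 := d.modU_pos
  have h2 : 0 < √((shape p / 12) ^ 3) := h0.trans h1
  rw [abs_div, abs_of_pos h2, div_lt_one h2, abs_mul, abs_mul, abs_of_pos h0, abs_neg, abs_one,
    mul_one]
  nlinarith

lemma angle_div_three_mem : angle p c t / 3 ∈ Ioo 0 (Real.pi / 3) := by
  have h := abs_lt.mp (d.abs_modU_lt t (Real.abs_sin_le_one _))
  rw [angle, d.shape_div_twelve]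
  have h1 := Real.arccos_pos.mpr h.2
  have h2 : Real.arccos (modU p c * (-1) * Real.sin (3 * t) / √((shape p / 12) ^ 3)) < Real.pi := by
    refine lt_of_le_of_ne (Real.arccos_le_pi _) fun h3 => ?_
    linarith [Real.arccos_eq_pi.mp h3]
  exact ⟨by linarith, by linarith⟩

/-- Viète's solution of the cubic: with x = cos θ and y = sin θ the exponents are √(E/3) times the
cosines of θ + 2π/3, θ - 2π/3 and θ, and 4x³ - 3x = cos 3θ. The strict bounds 0 < θ < π/3 come from
U'² < E³/1728 and separate the roots. -/
lemma exists_expo_eq : ∃ x y : ℝ, x ^ 2 + y ^ 2 = 1 ∧ 0 < y ∧ y < √3 * x ∧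
    expo p c t = ![√(shape p / 3) * (-x / 2 - √3 / 2 * y), √(shape p / 3) * (-x / 2 + √3 / 2 * y),
      √(shape p / 3) * x] ∧
    √(shape p / 3) ^ 3 * (4 * x ^ 3 - 3 * x) = -8 * (modU p c * Real.sin (3 * t)) := by
  obtain ⟨h1, h2⟩ := d.angle_div_three_mem t
  set θ := angle p c t / 3 with hθ
  have hE := d.shape_pos
  have hr : 1 / √3 * √(shape p) = √(shape p / 3) := by
    rw [Real.sqrt_div hE.le]; ring
  have hcos : 1 / 2 < Real.cos θ := by
    rw [← Real.cos_pi_div_three]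
    exact Real.cos_lt_cos_of_nonneg_of_le_pi h1.le (by linarith [Real.pi_pos]) h2
  have hsin : Real.sin θ < √3 / 2 := by
    rw [← Real.sin_pi_div_three]
    exact Real.sin_lt_sin_of_lt_of_le_pi_div_two (by linarith [Real.pi_pos])
      (by linarith [Real.pi_pos]) h2
  refine ⟨Real.cos θ, Real.sin θ, Real.cos_sq_add_sin_sq θ,
    Real.sin_pos_of_pos_of_lt_pi h1 (by linarith [Real.pi_pos]), ?_, ?_, ?_⟩
  · have : 0 < √(3 : ℝ) := by positivity
    nlinarith
  · have e : 1 / 3 * angle p c t = θ := by rw [hθ]; ring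
    have hs : (p ^ 2 - p + 1) / (p - 1) = shape p := rfl
    rw [expo, e, hs, Real.sin_add, Real.cos_add, Real.sin_pi_div_six, Real.cos_pi_div_six,
      Real.sin_pi_div_three, Real.cos_pi_div_three, ← hr]
    congr 1
    · ring
    · congr 1; ring
  · have h3 := abs_lt.mp (d.abs_modU_lt t (Real.abs_sin_le_one _))
    have h4 : Real.cos (3 * θ) =
        modU p c * (-1) * Real.sin (3 * t) / √((shape p / 12) ^ 3) := by
      rw [hθ, show 3 * (angle p c t / 3) = angle p c t by ring, angle, d.shape_div_twelve,
        Real.cos_arccos h3.1.le h3.2.le]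
    have h5 : √(shape p / 3) ^ 3 = 8 * √((shape p / 12) ^ 3) := by
      rw [show shape p / 3 = 2 ^ 2 * (shape p / 12) by ring, Real.sqrt_mul (by positivity),
        Real.sqrt_sq (by norm_num), mul_pow, pow_succ (√(shape p / 12)), Real.sq_sqrt (by positivity),
        pow_succ (shape p / 12), Real.sqrt_mul (by positivity), Real.sqrt_sq (by positivity)]
      norm_num
    have h6 : 0 < √((shape p / 12) ^ 3) := by positivity
    rw [Real.cos_three_mul] at h4
    rw [h4, h5, mul_assoc 8, mul_div_cancel₀ _ h6.ne']
    ring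

lemma expo_cubic (i : Fin 3) : expo p c t i ^ 3 - shape p / 4 * expo p c t i +
    2 * (modU p c * Real.sin (3 * t)) = 0 := by
  obtain ⟨x, y, h1, -, -, h2, h3⟩ := d.exists_expo_eq t
  have hE := Real.sq_sqrt (show 0 ≤ shape p / 3 by have := d.shape_pos; positivity)
  have h4 : √3 ^ 2 = (3 : ℝ) := Real.sq_sqrt (by norm_num)
  set r := √(shape p / 3)
  rw [show shape p = 3 * r ^ 2 by rw [hE]; ring, h2]
  fin_cases i <;> simp
  · linear_combination h3 / 4 - r ^ 3 / 4 * (9 / 2 * x + 3 / 2 * √3 * y) * h1 -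
      r ^ 3 / 8 * (3 * x * y ^ 2 + √3 * y ^ 3) * h4
  · linear_combination h3 / 4 - r ^ 3 / 4 * (9 / 2 * x - 3 / 2 * √3 * y) * h1 -
      r ^ 3 / 8 * (3 * x * y ^ 2 - √3 * y ^ 3) * h4
  · linear_combination h3 / 4

lemma expo_sum : expo p c t 0 + expo p c t 1 + expo p c t 2 = 0 := by
  obtain ⟨x, y, -, -, -, h2, -⟩ := d.exists_expo_eq t
  rw [h2]; simp; ring

lemma expo_lt : expo p c t 0 < expo p c t 1 ∧ expo p c t 1 < expo p c t 2 := by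
  obtain ⟨x, y, -, h0, h1, h2, -⟩ := d.exists_expo_eq t
  have hr : 0 < √(shape p / 3) := Real.sqrt_pos.mpr (by have := d.shape_pos; positivity)
  have h3 : 0 < √(3 : ℝ) := by positivity
  have h4 : √3 ^ 2 = (3 : ℝ) := Real.sq_sqrt (by norm_num)
  rw [h2]
  refine ⟨mul_lt_mul_of_pos_left ?_ hr, mul_lt_mul_of_pos_left ?_ hr⟩
  · have := mul_pos h3 h0; linarith
  · nlinarith

/-- The square of the left side is the discriminant 4(E/4)³ - 27(2U' sin 3t)² of the cubic; the sign
follows from the order of the exponents. -/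
lemma expo_vandermonde : (expo p c t 0 - expo p c t 1) * (expo p c t 0 - expo p c t 2) *
    (expo p c t 1 - expo p c t 2) =
      -√(shape p ^ 3 / 16 - 108 * modU p c ^ 2 * Real.sin (3 * t) ^ 2) := by
  obtain ⟨h1, h2⟩ := d.expo_lt t
  have h3 := d.expo_sum t
  have c0 := d.expo_cubic t 0
  have c1 := d.expo_cubic t 1
  set f := expo p c t
  have e2 : f 0 ^ 2 + f 0 * f 1 + f 1 ^ 2 = shape p / 4 := by
    refine mul_left_cancel₀ (sub_ne_zero.mpr h1.ne) ?_
    linear_combination c0 - c1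
  have e3 : f 0 * f 1 * (f 0 + f 1) = 2 * (modU p c * Real.sin (3 * t)) := by
    linear_combination f 0 * e2 - c0
  have h4 : f 2 = -f 0 - f 1 := by linear_combination h3
  have hpos := mul_pos (mul_pos (sub_pos.mpr h1) (sub_pos.mpr (h1.trans h2))) (sub_pos.mpr h2)
  have hD : shape p ^ 3 / 16 - 108 * modU p c ^ 2 * Real.sin (3 * t) ^ 2 =
      ((f 0 - f 1) * (f 0 - f 2) * (f 1 - f 2)) ^ 2 := by
    rw [show shape p ^ 3 / 16 - 108 * modU p c ^ 2 * Real.sin (3 * t) ^ 2 = 4 * (shape p / 4) ^ 3 -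
      27 * (2 * (modU p c * Real.sin (3 * t))) ^ 2 by ring, ← e2, ← e3, h4]
    ring
  rw [hD, Real.sqrt_sq_eq_abs, abs_of_nonpos (by linarith), neg_neg]

end IsSetup

lemma sgnS_mul_cos {t : ℝ} : sgnS t * |Real.cos (3 * t)| = -Real.cos (3 * t) := by
  rw [sgnS]
  rcases lt_trichotomy (Real.cos (3 * t)) 0 with h | h | h
  · rw [Real.sign_of_neg h, abs_of_neg h]; ring
  · simp [h]
  · rw [Real.sign_of_pos h, abs_of_pos h]; ring

lemma sgnS_eq {t : ℝ} (ht : Real.cos (3 * t) ≠ 0) : sgnS t = 1 ∨ sgnS t = -1 := by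
  rw [sgnS]
  rcases ht.lt_or_gt with h | h
  · left; rw [Real.sign_of_neg h]; ring
  · right; rw [Real.sign_of_pos h]

/-! ### The parameters m attached to an exponent -/

section Parameter

variable {p q c : ℝ} {L : PeriodPair} {w : ℝ} (d : IsSetup p q c L w) {t f : ℝ}
  (hf : f ^ 3 - shape p / 4 * f + 2 * (modU p c * Real.sin (3 * t)) = 0) {m : ℂ}
include d hf

/-- At W = E/4 - f² the cubic equation for f reads fW = 2U' sin 3t, so 4W³ - E W² + 16 U'² = 16 U'²
- 4(fW)² = 16 U'² cos² 3t. -/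
lemma IsSetup.derivWeierstrassP_sq (hm : m ∉ L.lattice)
    (h : L.weierstrassP m = (shape p / 4 - f ^ 2 - shape p / 12 : ℝ)) :
    L.derivWeierstrassP m ^ 2 = ((4 * modU p c * |Real.cos (3 * t)|) ^ 2 : ℝ) := by
  have e2 : L.g₂ = (L.g₂.re : ℂ) := Complex.ext rfl (by simp [d.g2_im])
  have e3 : L.g₃ = (L.g₃.re : ℂ) := Complex.ext rfl (by simp [d.g3_im])
  rw [L.derivWeierstrassP_sq m hm, h, e2, e3, d.g2_re, d.g3_re, ← Complex.ofReal_pow,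
    ← Complex.ofReal_ofNat, ← Complex.ofReal_mul, ← Complex.ofReal_mul, ← Complex.ofReal_sub,
    ← Complex.ofReal_sub]
  congr 1
  rw [mul_pow, sq_abs]
  have h1 := d.sq_modU
  have h2 := Real.sin_sq_add_cos_sq (3 * t)
  linear_combination -16 * h1 - 16 * modU p c ^ 2 * h2 -
    4 * (f ^ 3 - shape p / 4 * f - 2 * (modU p c * Real.sin (3 * t))) * hf

/-- For f ≠ 0 the cubic gives 2U' sin 3t / f = E/4 - f². The right side also has the prescribed
value at f = 0, so the case distinction disappears. -/
lemma IsSetup.weierstrassP_eq_iff :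
    ((f ≠ 0 → L.weierstrassP m +
      ((b1 p q / 4 - 2 * modU p c * Real.sin (3 * t) / f : ℝ) : ℂ) = 0) ∧
    (f = 0 → L.weierstrassP m + ((b1 p q / 4 - (p ^ 2 - p + 1) / (4 * (p - 1)) : ℝ) : ℂ) = 0)) ↔
      L.weierstrassP m = (shape p / 4 - f ^ 2 - shape p / 12 : ℝ) := by
  have hb : b1 p q / 4 = shape p / 12 := by rw [b1, d.shape_eq]; ring
  by_cases h0 : f = 0
  · have e : (p ^ 2 - p + 1) / (4 * (p - 1)) = shape p / 4 := by
      have := d.sub_one_pos.ne'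
      rw [shape]; field_simp
    simp only [h0, ne_eq, not_true_eq_false, false_imp_iff, true_imp_iff, true_and, hb, e]
    rw [add_eq_zero_iff_eq_neg, ← Complex.ofReal_neg]
    congr! 2
    ring
  · have e : 2 * modU p c * Real.sin (3 * t) / f = shape p / 4 - f ^ 2 := by
      field_simp
      linear_combination 4 * hf
    simp only [h0, ne_eq, not_false_eq_true, false_imp_iff, true_imp_iff, and_true, hb, e]
    rw [add_eq_zero_iff_eq_neg, ← Complex.ofReal_neg]
    congr! 2
    ring

lemma isParameter_iff :
    IsParameter p q c t L f m ↔ m ∉ L.lattice ∧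
      L.weierstrassP m = (shape p / 4 - f ^ 2 - shape p / 12 : ℝ) ∧
      (L.derivWeierstrassP m).im = 0 ∧ (L.derivWeierstrassP m).re < 0 := by
  rw [← d.weierstrassP_eq_iff hf, IsParameter]
  tauto

lemma IsParameter.derivWeierstrassP_eq (h : IsParameter p q c t L f m) :
    L.derivWeierstrassP m = (-(4 * modU p c * |Real.cos (3 * t)|) : ℝ) := by
  obtain ⟨h1, h2, h3, h4⟩ := (isParameter_iff d hf).mp h
  have h5 := d.derivWeierstrassP_sq hf h1 h2
  have e : L.derivWeierstrassP m = ((L.derivWeierstrassP m).re : ℂ) :=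
    Complex.ext rfl (by simp [h3])
  rw [e] at h5 ⊢
  norm_cast at h5 ⊢
  have h6 : 0 ≤ 4 * modU p c * |Real.cos (3 * t)| := by have := d.modU_pos; positivity
  rcases sq_eq_sq_iff_eq_or_eq_neg.mp h5 with h | h
  · linarith
  · exact h

/-- ℘ takes the required value at some m. There ℘'(m)² is real and positive, and since ℘' is odd, m
or -m has negative derivative. -/
lemma exists_isParameter (ht : Real.cos (3 * t) ≠ 0) : ∃ m, IsParameter p q c t L f m := by
  obtain ⟨m, h1, h2⟩ := exists_weierstrassP_eq L (shape p / 4 - f ^ 2 - shape p / 12 : ℝ)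
  have h5 := d.derivWeierstrassP_sq hf h1 h2
  have h6 : 0 < 4 * modU p c * |Real.cos (3 * t)| := by have := d.modU_pos; positivity
  rw [Complex.ofReal_pow] at h5
  rcases sq_eq_sq_iff_eq_or_eq_neg.mp h5 with h | h
  · refine ⟨-m, (isParameter_iff d hf).mpr ⟨fun h => h1 (by simpa using h), ?_, ?_, ?_⟩⟩
    · rw [L.weierstrassP_neg, h2]
    · rw [L.derivWeierstrassP_neg, h, ← Complex.ofReal_neg, Complex.ofReal_im]
    · rw [L.derivWeierstrassP_neg, h, ← Complex.ofReal_neg, Complex.ofReal_re]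
      linarith
  · refine ⟨m, (isParameter_iff d hf).mpr ⟨h1, h2, ?_, ?_⟩⟩
    · rw [h, ← Complex.ofReal_neg, Complex.ofReal_im]
    · rw [h, ← Complex.ofReal_neg, Complex.ofReal_re]
      linarith

end Parameter

/-! ### The associated family -/

lemma weierstrassZeta_sgn_mul (L : PeriodPair) {s : ℝ} (hs : s = 1 ∨ s = -1) (m : ℂ) :
    weierstrassZeta L (s * m) = s * weierstrassZeta L m := by
  rcases hs with rfl | rfl
  · simp
  · simp [weierstrassZeta_neg]

lemma IsParameter.sgnS_mul_notMem {p q c t f : ℝ} {L : PeriodPair} {m : ℂ}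
    (hm : IsParameter p q c t L f m) (ht : Real.cos (3 * t) ≠ 0) :
    (sgnS t : ℂ) * m ∉ L.lattice := by
  rcases sgnS_eq ht with h | h <;> simpa [h] using hm.1

namespace IsSetup

variable {p q c : ℝ} {L : PeriodPair} {w : ℝ} (d : IsSetup p q c L w)
include d

/-- The mixed equation of the system is a multiple of the first order relation. The pure ones follow
from its derivative, in which X'' and W'' are replaced by their values. -/
lemma gaussSystem_separated {X X' : ℝ → ℝ} {f A B : ℝ} (hf : f * (shape p / 4 - f ^ 2) = 2 * B)
    (hsm : ContDiffOn ℝ ∞ X (Ioo (-w) w)) (hX : ∀ x ∈ Ioo (-w) w, HasDerivAt X (X' x) x)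
    (hX' : ∀ x ∈ Ioo (-w) w, HasDerivAt X' ((2 * factor p L w x - f ^ 2) * X x) x)
    (h : ∀ x ∈ Ioo (-w) w, (factor p L w x - (shape p / 4 - f ^ 2)) * X' x =
      1 / 2 * (factor' L w x + 4 * A) * X x) :
    GaussSystem (Ioo (-w) w ×ˢ univ) (fun z => X z.1 * Real.exp (f * z.2))
      (fun z => factor p L w z.1) (fun z => factor' L w z.1) A B := by
  refine GaussSystem.separated hsm (fun x hx => d.factor_pos hx) hX hX' (fun x hx => ?_)
    fun x hx => ?_
  · linear_combination 2 * f * h x hx + 2 * X' x * hf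
  · have h1 := (((d.hasDerivAt_factor hx).sub_const (shape p / 4 - f ^ 2)).mul
      (hX' x hx)).sub ((((d.hasDerivAt_factor' hx).add_const (4 * A)).const_mul (1 / 2)).mul
      (hX x hx))
    have h2 := h1.unique ((hasDerivAt_const x (0 : ℝ)).congr_of_eventuallyEq (by
      filter_upwards [isOpen_Ioo.mem_nhds hx] with y hy
      simpa [sub_eq_zero] using h y hy))
    linear_combination 2 * h2 - 2 * f * X x * hf

lemma hasDerivAt_re_normLame {a : ℂ} {x : ℝ} (hx : x ∈ Ioo (-w) w) :
    HasDerivAt (fun x => (normLame L w a x).re)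
      (normLame' L w a x).re x :=
  Complex.reCLM.hasFDerivAt.comp_hasDerivAt x (hasDerivAt_normLame d.halfPeriod hx)

lemma weierstrassP_add_eq (x : ℝ) :
    L.weierstrassP (x + w) = (factor p L w x - shape p / 12 : ℝ) := by
  rw [factor, add_sub_cancel_right, ofReal_realP L d.g2_im d.g3_im, Complex.ofReal_add]

variable {t : ℝ} (ht : Real.cos (3 * t) ≠ 0) {f : ℝ}
  (hf : f ^ 3 - shape p / 4 * f + 2 * (modU p c * Real.sin (3 * t)) = 0) {m : ℂ}
  (hm : IsParameter p q c t L f m)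
include ht hf hm

lemma weierstrassP_sgnS_mul :
    L.weierstrassP (sgnS t * m) = (shape p / 4 - f ^ 2 - shape p / 12 : ℝ) := by
  have := ((isParameter_iff d hf).mp hm).2.1
  rcases sgnS_eq ht with h | h <;> simpa [h] using this

/-- The normalization ℘'(m) < 0 fixes m up to periods as having derivative -4U'|cos 3t|. The sign s
restores the value 4A, A = U' cos 3t, that the first order relation requires. -/
lemma derivWeierstrassP_sgnS_mul :
    L.derivWeierstrassP (sgnS t * m) = (4 * (modU p c * Real.cos (3 * t)) : ℝ) := by
  have h1 := hm.derivWeierstrassP_eq d hf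
  have h2 : L.derivWeierstrassP (sgnS t * m) = sgnS t * L.derivWeierstrassP m := by
    rcases sgnS_eq ht with h | h <;> simp [h]
  rw [h2, h1, ← Complex.ofReal_mul]
  congr 1
  linear_combination -4 * modU p c * sgnS_mul_cos (t := t)

lemma normLame_sgnS_im {x : ℝ} (hx : x ∈ Ioo (-w) w) :
    (normLame L w (sgnS t * m) x).im = 0 ∧ (normLame' L w (sgnS t * m) x).im = 0 := by
  have h1 := d.weierstrassP_sgnS_mul ht hf hm
  have h2 := d.derivWeierstrassP_sgnS_mul ht hf hm
  refine normLame_im d.g2_im d.g3_im d.halfPeriod (hm.sgnS_mul_notMem ht)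
    (by rw [h1, Complex.ofReal_im]) (by rw [h2, Complex.ofReal_im]) ?_ hx
  rw [h2, Complex.ofReal_ne_zero]
  have := d.modU_pos.ne'
  positivity

lemma normLame_sgnS_zero : normLame L w (sgnS t * m) 0 = 1 := by
  refine normLame_zero d.halfPeriod ?_
  rw [d.derivWeierstrassP_sgnS_mul ht hf hm, Complex.ofReal_ne_zero]
  have := d.modU_pos.ne'
  positivity

lemma hasDerivAt_re_normLame' {x : ℝ} (hx : x ∈ Ioo (-w) w) :
    HasDerivAt (fun x => (normLame' L w (sgnS t * m) x).re)
      ((2 * factor p L w x - f ^ 2) * (normLame L w (sgnS t * m) x).re) x := by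
  refine (Complex.reCLM.hasFDerivAt.comp_hasDerivAt x (hasDerivAt_normLame' d.halfPeriod
    (hm.sgnS_mul_notMem ht) hx)).congr_deriv ?_
  rw [d.weierstrassP_sgnS_mul ht hf hm, d.weierstrassP_add_eq, ← Complex.ofReal_ofNat,
    ← Complex.ofReal_mul, ← Complex.ofReal_add, Complex.reCLM_apply, Complex.re_ofReal_mul]
  ring

lemma re_normLame_first_order {x : ℝ} (hx : x ∈ Ioo (-w) w) :
    (factor p L w x - (shape p / 4 - f ^ 2)) * (normLame' L w (sgnS t * m) x).re =
      1 / 2 * (factor' L w x + 4 * (modU p c * Real.cos (3 * t))) *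
        (normLame L w (sgnS t * m) x).re := by
  have h := normLame_first_order d.halfPeriod (hm.sgnS_mul_notMem ht) hx
  have h1 : L.derivWeierstrassP (x + w) = (factor' L w x : ℂ) := by
    rw [factor', ofReal_realP' L d.g2_im d.g3_im (d.halfPeriod.notMem (add_mem hx)),
      Complex.ofReal_add]
  rw [d.weierstrassP_sgnS_mul ht hf hm, d.weierstrassP_add_eq,
    d.derivWeierstrassP_sgnS_mul ht hf hm, h1, ← Complex.ofReal_ofNat, ← Complex.ofReal_sub,
    ← Complex.ofReal_add, ← Complex.ofReal_div] at h
  have h2 := congrArg Complex.re h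
  rw [Complex.re_ofReal_mul, Complex.re_ofReal_mul] at h2
  linear_combination h2

lemma gaussSystem_normLame (k : ℝ) :
    GaussSystem (Ioo (-w) w ×ˢ univ)
      (fun z => k * (normLame L w (sgnS t * m) z.1).re * Real.exp (f * z.2))
      (fun z => factor p L w z.1) (fun z => factor' L w z.1) (modU p c * Real.cos (3 * t))
      (modU p c * Real.sin (3 * t)) := by
  refine d.gaussSystem_separated (X := fun x => k * (normLame L w (sgnS t * m) x).re)
    (X' := fun x => k * (normLame' L w (sgnS t * m) x).re)
    (by linear_combination -hf) ?_ (fun x hx => ?_) (fun x hx => ?_) fun x hx => ?_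
  · refine contDiffOn_const.mul fun x hx => ?_
    exact (Complex.reCLM.contDiff.contDiffAt.comp x
      (contDiffAt_normLame d.halfPeriod hx)).contDiffWithinAt
  · exact (d.hasDerivAt_re_normLame hx).const_mul k
  · exact ((d.hasDerivAt_re_normLame' ht hf hm hx).const_mul k).congr_deriv (by ring)
  · linear_combination k * d.re_normLame_first_order ht hf hm hx

end IsSetup

/-- The constants in front of the coordinates of the family. -/
def familyConst (p c : ℝ) : Fin 3 → ℝ := ![1 / (3 * p), 1 / (3 * p), √3 * (p - 1) * c / 2]

lemma familyC_eq {p c t : ℝ} (ht : Real.cos (3 * t) ≠ 0) (L : PeriodPair) (w : ℝ)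
    (m : Fin 3 → ℂ) (z : ℝ × ℝ) (i : Fin 3) : familyC p c t L w m z i =
      (familyConst p c i : ℂ) * normLame L w (sgnS t * m i) z.1 *
        (Real.exp (expo p c t i * z.2) : ℂ) := by
  rw [familyC, familyConst, normLame, weierstrassZeta_sgn_mul L (sgnS_eq ht), Complex.exp_add,
    Complex.ofReal_exp, Complex.ofReal_mul]
  ring

lemma exp_three_mul_I_mul (t u : ℝ) : Complex.exp (3 * Complex.I * (t : ℂ)) * (u : ℂ) =
    ((u * Real.cos (3 * t) : ℝ) : ℂ) + ((u * Real.sin (3 * t) : ℝ) : ℂ) * Complex.I := by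
  rw [show 3 * Complex.I * (t : ℂ) = ((3 * t : ℝ) : ℂ) * Complex.I by push_cast; ring,
    Complex.exp_mul_I, ← Complex.ofReal_cos, ← Complex.ofReal_sin]
  push_cast
  ring

lemma exp_three_mul_I_inv_mul (t u : ℝ) :
    (Complex.exp (3 * Complex.I * (t : ℂ)))⁻¹ * (starRingEnd ℂ) (u : ℂ) =
      ((u * Real.cos (3 * t) : ℝ) : ℂ) - ((u * Real.sin (3 * t) : ℝ) : ℂ) * Complex.I := by
  rw [← Complex.exp_neg, show -(3 * Complex.I * (t : ℂ)) = 3 * Complex.I * ((-t : ℝ) : ℂ) by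
    push_cast; ring, Complex.conj_ofReal, exp_three_mul_I_mul, mul_neg, Real.cos_neg, Real.sin_neg]
  push_cast
  ring

/-! ### The determinant of the frame at the origin -/

lemma det_partial_fractions {a b c e x y z : ℝ} (h : a + b + c = 0)
    (hx : (e + a ^ 2) * x = 1) (hy : (e + b ^ 2) * y = 1) (hz : (e + c ^ 2) * z = 1) :
    (e + a ^ 2) * (e + b ^ 2) * (e + c ^ 2) * (x * (b - c) - y * (a - c) + z * (a - b)) =
      -((a - b) * (a - c) * (b - c)) * (e + (a ^ 2 + a * b + b ^ 2)) := by
  obtain rfl : c = -a - b := by linear_combination h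
  linear_combination (e + b ^ 2) * (e + (-a - b) ^ 2) * (b - (-a - b)) * hx -
    (e + a ^ 2) * (e + (-a - b) ^ 2) * (a - (-a - b)) * hy +
    (e + a ^ 2) * (e + b ^ 2) * (a - b) * hz

/-- At the origin W' = 0, so the first order relation expresses each X_i'(0) as 2A K_i/(V - E +
f_i²). The determinant becomes a sum of three partial fractions whose common denominator is the
product in the last hypothesis. Here E denotes f₀² + f₀f₁ + f₁². -/
lemma det3_of_first_order {f K g : Fin 3 → ℝ} {E V A : ℝ} (hs : f 0 + f 1 + f 2 = 0)
    (s2 : f 0 ^ 2 + f 0 * f 1 + f 1 ^ 2 = E) (hA : A ≠ 0)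
    (hg : ∀ i, (V - E + f i ^ 2) * g i = 2 * A * K i)
    (hprod : (V - E + f 0 ^ 2) * (V - E + f 1 ^ 2) * (V - E + f 2 ^ 2) = -4 * A ^ 2) :
    2 * A * det3 g (fun i => K i * f i) K =
      K 0 * K 1 * K 2 * ((f 0 - f 1) * (f 0 - f 2) * (f 1 - f 2)) * V := by
  have h0 : (V - E + f 0 ^ 2) * (V - E + f 1 ^ 2) * (V - E + f 2 ^ 2) ≠ 0 := by
    rw [hprod]
    exact mul_ne_zero (by norm_num) (pow_ne_zero 2 hA)
  have hne : ∀ i, V - E + f i ^ 2 ≠ 0 := by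
    simp only [ne_eq, mul_eq_zero, not_or] at h0
    intro i
    fin_cases i
    exacts [h0.1.1, h0.1.2, h0.2]
  have hgi : ∀ i, g i = 2 * A * K i * (V - E + f i ^ 2)⁻¹ := fun i => by
    rw [← div_eq_mul_inv, eq_div_iff (hne i)]
    linear_combination hg i
  have key := det_partial_fractions hs (mul_inv_cancel₀ (hne 0)) (mul_inv_cancel₀ (hne 1))
    (mul_inv_cancel₀ (hne 2))
  rw [hprod, s2] at key
  simp only [det3_eq, hgi]
  linear_combination -K 0 * K 1 * K 2 * key

/-- By the symmetric functions of the exponents the product is V³ - (E/4)V² + 4B². Since W'(0) = 0,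
the equation of W gives V³ - (E/4)V² = -4(A² + B²). -/
lemma IsSetup.prod_factor_zero {p q c : ℝ} {L : PeriodPair} {w : ℝ} (d : IsSetup p q c L w)
    {f : Fin 3 → ℝ} {A B : ℝ} (hAB : A ^ 2 + B ^ 2 = modU p c ^ 2) (hs : f 0 + f 1 + f 2 = 0)
    (s2 : f 0 ^ 2 + f 0 * f 1 + f 1 ^ 2 = shape p / 4) (hf : f 0 * (shape p / 4 - f 0 ^ 2) = 2 * B) :
    (factor p L w 0 - shape p / 4 + f 0 ^ 2) * (factor p L w 0 - shape p / 4 + f 1 ^ 2) *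
      (factor p L w 0 - shape p / 4 + f 2 ^ 2) = -4 * A ^ 2 := by
  have h0 := d.factor'_sq d.zero_mem
  rw [d.factor'_zero, ← hAB] at h0
  have h4 : f 2 = -f 0 - f 1 := by linear_combination hs
  have e3 : f 0 * f 1 * (f 0 + f 1) = 2 * B := by linear_combination f 0 * s2 + hf
  rw [h4, ← s2]
  linear_combination -(1 / 4) * h0 - factor p L w 0 ^ 2 * s2 +
    (f 0 * f 1 * (f 0 + f 1) + 2 * B) * e3

lemma GaussSystem.congr {V : Type*} [NormedAddCommGroup V] [NormedSpace ℝ V] {D : Set (ℝ × ℝ)}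
    {r s : ℝ × ℝ → V} {W Wx : ℝ × ℝ → ℝ} {A B : ℝ} (h : GaussSystem D s W Wx A B) (hD : IsOpen D)
    (e : ∀ z ∈ D, r z = s z) : GaussSystem D r W Wx A B := by
  have e0 : ∀ z ∈ D, r =ᶠ[𝓝 z] s := fun z hz => by
    filter_upwards [hD.mem_nhds hz] with v hv using e v hv
  have ex : ∀ z ∈ D, dx r =ᶠ[𝓝 z] dx s := fun z hz => by
    filter_upwards [hD.mem_nhds hz] with v hv using dx_congr (e0 v hv)
  have ey : ∀ z ∈ D, dy r =ᶠ[𝓝 z] dy s := fun z hz => by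
    filter_upwards [hD.mem_nhds hz] with v hv using dy_congr (e0 v hv)
  refine ⟨h.smooth.congr e, fun z hz => ?_, fun z hz => ?_, fun z hz => ?_⟩
  · rw [dx_congr (ex z hz), (ex z hz).eq_of_nhds, (ey z hz).eq_of_nhds, e z hz, h.xx z hz]
  · rw [dy_congr (ex z hz), (ex z hz).eq_of_nhds, (ey z hz).eq_of_nhds, h.xy z hz]
  · rw [dy_congr (ey z hz), (ex z hz).eq_of_nhds, (ey z hz).eq_of_nhds, e z hz, h.yy z hz]

namespace IsSetup

variable {p q c : ℝ} {L : PeriodPair} {w : ℝ} (d : IsSetup p q c L w)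
include d

lemma hasDerivAt_factor_fst {z : ℝ × ℝ} (hz : z ∈ Ioo (-w) w ×ˢ (univ : Set ℝ)) :
    HasDerivAt (fun u => factor p L w ((u, z.2) : ℝ × ℝ).1) (factor' L w z.1) z.1 :=
  d.hasDerivAt_factor hz.1

lemma hasInvariants_conformalFactor_iff {r : ℝ × ℝ → Fin 3 → ℝ} {U : ℂ} :
    HasInvariants (Ioo (-w) w ×ˢ univ) r (conformalFactor p q L w) (-1) U ↔
      HasInvariants (Ioo (-w) w ×ˢ univ) r (fun z => factor p L w z.1) (-1) U := by
  rw [show conformalFactor p q L w = fun z => factor p L w z.1 from funext d.conformalFactor_eq]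

variable {t : ℝ} (ht : Real.cos (3 * t) ≠ 0) {m : Fin 3 → ℂ}
  (hm : ∀ i, IsParameter p q c t L (expo p c t i) (m i))
include ht hm

lemma family_eq {z : ℝ × ℝ} (hz : z ∈ Ioo (-w) w ×ˢ (univ : Set ℝ)) (i : Fin 3) :
    (familyC p c t L w m z i).im = 0 ∧ family p c t L w m z i =
      familyConst p c i * (normLame L w (sgnS t * m i) z.1).re *
        Real.exp (expo p c t i * z.2) := by
  have h := (d.normLame_sgnS_im ht (d.expo_cubic t i) (hm i) hz.1).1
  rw [family, familyC_eq ht]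
  constructor
  · rw [Complex.im_mul_ofReal, Complex.im_ofReal_mul, h, mul_zero, zero_mul]
  · rw [Complex.re_mul_ofReal, Complex.re_ofReal_mul]

lemma gaussSystem_diag_family (v : Fin 3 → ℝ) :
    GaussSystem (Ioo (-w) w ×ˢ univ) (fun z i => v i * family p c t L w m z i)
      (fun z => factor p L w z.1) (fun z => factor' L w z.1) (modU p c * Real.cos (3 * t))
      (modU p c * Real.sin (3 * t)) := by
  refine GaussSystem.pi (fun i => ?_) (isOpen_strip w)
  have h := d.gaussSystem_normLame ht (d.expo_cubic t i) (hm i) (v i * familyConst p c i)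
  refine h.congr (isOpen_strip w) fun z hz => ?_
  rw [(d.family_eq ht hm hz i).2]; ring

lemma frameEquations_family : SolvesFrameEquations (Ioo (-w) w ×ˢ univ) (family p c t L w m)
    (fun z => Real.log (conformalFactor p q L w z / 2)) (-1) (modU p c : ℂ)
    (Complex.exp (3 * Complex.I * (t : ℂ))) := by
  have h := d.gaussSystem_diag_family ht hm 1
  simp only [Pi.one_apply, one_mul] at h
  simp only [d.conformalFactor_eq]
  exact h.solvesFrameEquations (isOpen_strip w) (fun z hz => d.factor_pos hz.1)
    (fun z hz => d.hasDerivAt_factor_fst hz) (fun z hz => hasDerivAt_const z.2 (factor p L w z.1))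
    (exp_three_mul_I_mul _ _) (exp_three_mul_I_inv_mul _ _)

lemma det_normalizedFamily_zero :
    det3 (dx (normalizedFamily p c t L w m) (0, 0)) (dy (normalizedFamily p c t L w m) (0, 0))
      (normalizedFamily p c t L w m (0, 0)) = factor p L w 0 := by
  set δ : Fin 3 → ℝ := ![1, 1, unimodularFactor p c t] with hδ
  set g : Fin 3 → ℝ := fun i => (normLame' L w (sgnS t * m i) 0).re with hg
  set f := expo p c t with hf
  have hz : ((0 : ℝ), (0 : ℝ)) ∈ Ioo (-w) w ×ˢ (univ : Set ℝ) := ⟨d.zero_mem, mem_univ _⟩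
  have hD := (isOpen_strip w).mem_nhds hz
  have sm : DifferentiableAt ℝ (normalizedFamily p c t L w m) (0, 0) := (d.gaussSystem_diag_family ht hm δ).smooth.differentiableAt_of_isOpen
    (isOpen_strip w) hz
  have e : ∀ i, (fun z => normalizedFamily p c t L w m z i) =ᶠ[𝓝 (0, 0)] fun z => δ i *
      (familyConst p c i * (normLame L w (sgnS t * m i) z.1).re * Real.exp (f i * z.2)) :=
    fun i => by
      filter_upwards [hD] with z hz
      rw [normalizedFamily, (d.family_eq ht hm hz i).2]
  have n0 : ∀ i, (normLame L w (sgnS t * m i) 0).re = 1 := fun i => by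
    rw [d.normLame_sgnS_zero ht (d.expo_cubic t i) (hm i), Complex.one_re]
  have e0 : ∀ i, normalizedFamily p c t L w m (0, 0) i = δ i * familyConst p c i := fun i => by
    rw [(e i).eq_of_nhds]; simp [n0]
  have e1 : ∀ i, dx (normalizedFamily p c t L w m) (0, 0) i = δ i * familyConst p c i * g i :=
    fun i => by
      rw [← dx_apply sm, dx_congr (e i)]
      refine (((((d.hasDerivAt_re_normLame d.zero_mem).const_mul
        (familyConst p c i)).mul_const (Real.exp (f i * 0))).const_mul (δ i)).congr_deriv ?_).deriv
      simp [hg]; ring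
  have e2 : ∀ i, dy (normalizedFamily p c t L w m) (0, 0) i = δ i * familyConst p c i * f i :=
    fun i => by
      rw [← dy_apply sm, dy_congr (e i)]
      refine ((((((hasDerivAt_id (0 : ℝ)).const_mul (f i)).exp).const_mul (familyConst p c i *
        (normLame L w (sgnS t * m i) 0).re)).const_mul (δ i)).congr_deriv ?_).deriv
      simp [n0]; ring
  have hU := d.modU_pos.ne'
  set A := modU p c * Real.cos (3 * t) with hA
  have hA0 : A ≠ 0 := mul_ne_zero hU ht
  set V := factor p L w 0 with hV
  have hs := d.expo_sum t
  have c0 := d.expo_cubic t 0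
  have c1 := d.expo_cubic t 1
  have hlt := (d.expo_lt t).1
  have s2 : f 0 ^ 2 + f 0 * f 1 + f 1 ^ 2 = shape p / 4 := by
    refine mul_left_cancel₀ (sub_ne_zero.mpr hlt.ne) ?_
    linear_combination c0 - c1
  have hdisc : 0 < √(shape p ^ 3 / 16 - 108 * modU p c ^ 2 * Real.sin (3 * t) ^ 2) := by
    have h1 := d.expo_vandermonde t
    have h2 := d.expo_lt t
    have := mul_pos (mul_pos (sub_pos.mpr h2.1) (sub_pos.mpr (h2.1.trans h2.2)))
      (sub_pos.mpr h2.2)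
    linarith
  have hδ2 : δ 2 = -(12 * √3 * p ^ 2 * modU p c * Real.cos (3 * t)) / ((p - 1) * c *
    √(shape p ^ 3 / 16 - 108 * modU p c ^ 2 * Real.sin (3 * t) ^ 2)) := rfl
  set R := √(shape p ^ 3 / 16 - 108 * modU p c ^ 2 * Real.sin (3 * t) ^ 2)
  -- This equation is what determines δ(t): by `det3_of_first_order`, 2A times the frame determinant
  -- is -R V times the product of the three constants, and it has to equal 2A V.
  have hk : δ 0 * familyConst p c 0 * (δ 1 * familyConst p c 1) * (δ 2 * familyConst p c 2) * R =
      -2 * A := by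
    have h1 := d.p_pos.ne'
    have h2 := d.sub_one_pos.ne'
    have h3 := d.c_neg.ne
    have h4 : √3 ^ 2 = (3 : ℝ) := Real.sq_sqrt (by norm_num)
    rw [hδ2]
    simp only [hδ, familyConst, Matrix.cons_val_zero, Matrix.cons_val_one, Matrix.cons_val]
    field_simp
    rw [h4]
    ring
  have hAB : A ^ 2 + (modU p c * Real.sin (3 * t)) ^ 2 = modU p c ^ 2 := by
    linear_combination modU p c ^ 2 * Real.sin_sq_add_cos_sq (3 * t)
  have key := det3_of_first_order (K := fun i => δ i * familyConst p c i)
    (g := fun i => δ i * familyConst p c i * g i) hs s2 hA0 (fun i => by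
      have := d.re_normLame_first_order ht (d.expo_cubic t i) (hm i) d.zero_mem
      rw [n0, d.factor'_zero] at this
      linear_combination δ i * familyConst p c i * this)
    (d.prod_factor_zero hAB hs s2 (by linear_combination -c0))
  rw [d.expo_vandermonde t] at key
  rw [show normalizedFamily p c t L w m (0, 0) = _ from funext e0,
    show dx (normalizedFamily p c t L w m) (0, 0) = _ from funext e1,
    show dy (normalizedFamily p c t L w m) (0, 0) = _ from funext e2]
  refine mul_left_cancel₀ (mul_ne_zero two_ne_zero hA0) (key.trans ?_)
  linear_combination -V * hk

lemma hasInvariants_normalizedFamily :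
    HasInvariants (Ioo (-w) w ×ˢ univ) (normalizedFamily p c t L w m)
      (conformalFactor p q L w) (-1) (Complex.exp (3 * Complex.I * (t : ℂ)) * (modU p c : ℂ)) := by
  have h := d.gaussSystem_diag_family ht hm ![1, 1, unimodularFactor p c t]
  have hc := d.contDiffOn_factor
  rw [d.hasInvariants_conformalFactor_iff, exp_three_mul_I_mul]
  exact h.hasInvariants (isOpen_strip w) (fun z hz => d.factor_pos hz.1)
    (h.det_eq d.pos (hc.1.continuousOn.comp continuousOn_fst fun z hz => hz.1)
      (hc.2.continuousOn.comp continuousOn_fst fun z hz => hz.1)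
      (fun z hz => (d.factor_pos hz.1).ne') (fun z hz => d.hasDerivAt_factor_fst hz)
      (fun z hz => hasDerivAt_const z.2 (factor p L w z.1)) (d.det_normalizedFamily_zero ht hm))

lemma exists_matrix_normalizedFamily {r : ℝ × ℝ → Fin 3 → ℝ}
    (hr : HasInvariants (Ioo (-w) w ×ˢ univ) r (conformalFactor p q L w) (-1)
      (Complex.exp (3 * Complex.I * (t : ℂ)) * (modU p c : ℂ))) :
    ∃ A : Matrix (Fin 3) (Fin 3) ℝ, A.det = 1 ∧
      ∀ z ∈ Ioo (-w) w ×ˢ (univ : Set ℝ), r z = A.mulVec (normalizedFamily p c t L w m z) := by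
  have h := d.gaussSystem_diag_family ht hm ![1, 1, unimodularFactor p c t]
  have hc := d.contDiffOn_factor
  rw [d.hasInvariants_conformalFactor_iff, exp_three_mul_I_mul] at hr
  obtain ⟨h1, h2⟩ := hr.det_and_gaussSystem (isOpen_strip w)
    (fun z hz => d.hasDerivAt_factor_fst hz) (fun z hz => hasDerivAt_const z.2 (factor p L w z.1))
  exact h2.exists_matrix d.pos h (hc.1.continuousOn.comp continuousOn_fst fun z hz => hz.1)
      (hc.2.continuousOn.comp continuousOn_fst fun z hz => hz.1)
      (fun z hz => (d.factor_pos hz.1).ne') (h1 _ ⟨d.zero_mem, mem_univ _⟩)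
      (d.det_normalizedFamily_zero ht hm)

end IsSetup

/-! ### Hildebrand's affine spheres -/

/-- Monotonicity and the infinite limits give a continuous global inverse s, and s' = 1/f'(s) then
raises its regularity step by step. -/
lemma exists_contDiff_inverse {a b : ℝ} (hab : a < b) {f f' : ℝ → ℝ}
    (hd : ∀ t ∈ Ioo a b, HasDerivAt f (f' t) t) (hf' : ContDiffOn ℝ ∞ f' (Ioo a b))
    (hpos : ∀ t ∈ Ioo a b, 0 < f' t) (hl : Tendsto f (𝓝[>] a) atBot)
    (hr : Tendsto f (𝓝[<] b) atTop) :
    ∃ s : ℝ → ℝ, ContDiff ℝ ∞ s ∧ (∀ y, s y ∈ Ioo a b) ∧ (∀ y, f (s y) = y) ∧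
      (∀ t ∈ Ioo a b, s (f t) = t) ∧ ∀ y, HasDerivAt s (f' (s y))⁻¹ y := by
  have hc : ContinuousOn f (Ioo a b) := fun t ht => (hd t ht).continuousAt.continuousWithinAt
  have hm : StrictMonoOn f (Ioo a b) := by
    refine strictMonoOn_of_deriv_pos (convex_Ioo a b) hc fun t ht => ?_
    rw [interior_Ioo] at ht
    rw [(hd t ht).deriv]
    exact hpos t ht
  have hsurj : ∀ y, ∃ t : Ioo a b, f t = y := by
    intro y
    obtain ⟨t₁, h1, h1'⟩ := ((hl.eventually_lt_atBot y).and (Ioo_mem_nhdsGT hab)).exists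
    obtain ⟨t₂, h2, h2'⟩ := ((hr.eventually_gt_atTop y).and (Ioo_mem_nhdsLT hab)).exists
    have h3 : t₁ < t₂ := (hm.lt_iff_lt h1' h2').mp (h1.trans h2)
    have hsub : Icc t₁ t₂ ⊆ Ioo a b := fun t ht => ⟨h1'.1.trans_le ht.1, ht.2.trans_lt h2'.2⟩
    obtain ⟨t, ht, rfl⟩ := intermediate_value_Icc h3.le (hc.mono hsub) ⟨h1.le, h2.le⟩
    exact ⟨⟨t, hsub ht⟩, rfl⟩
  set e : Ioo a b ≃o ℝ := StrictMono.orderIsoOfSurjective (fun t : Ioo a b => f t)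
    (fun x y h => hm x.2 y.2 h) hsurj with he
  set s : ℝ → ℝ := fun y => (e.symm y : ℝ) with hs
  have hs1 : ∀ y, s y ∈ Ioo a b := fun y => (e.symm y).2
  have hs2 : ∀ y, f (s y) = y := fun y => e.apply_symm_apply y
  have hsc : Continuous s := continuous_subtype_val.comp e.symm.continuous
  have hsd : ∀ y, HasDerivAt s (f' (s y))⁻¹ y := fun y =>
    HasDerivAt.of_local_left_inverse hsc.continuousAt (hd _ (hs1 y)) (hpos _ (hs1 y)).ne'
      (Eventually.of_forall hs2)
  refine ⟨s, ?_, hs1, hs2, fun t ht => ?_, hsd⟩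
  · refine contDiff_infty.mpr fun n => ?_
    induction n with
    | zero => exact contDiff_zero.mpr hsc
    | succ n ih =>
      push_cast
      refine contDiff_succ_iff_deriv.mpr ⟨fun y => (hsd y).differentiableAt, by simp, ?_⟩
      rw [show deriv s = fun y => (f' (s y))⁻¹ from funext fun y => (hsd y).deriv]
      exact ((hf'.of_le (by exact_mod_cast le_top)).comp_contDiff ih hs1).inv
        fun y => (hpos _ (hs1 y)).ne'
  · exact congrArg Subtype.val (e.symm_apply_apply ⟨t, ht⟩)

lemma exists_antiderivative {a b x₀ : ℝ} (hx₀ : x₀ ∈ Ioo a b) {g : ℝ → ℝ}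
    (hg : ContDiffOn ℝ ∞ g (Ioo a b)) : ∃ h : ℝ → ℝ, ContDiffOn ℝ ∞ h (Ioo a b) ∧
      ∀ x ∈ Ioo a b, HasDerivAt h (g x) x := by
  have hd : ∀ x ∈ Ioo a b, HasDerivAt (fun x => ∫ u in x₀..x, g u) (g x) x := fun x hx => by
    refine intervalIntegral.integral_hasDerivAt_right ?_ ?_
      (hg.continuousOn.continuousAt (isOpen_Ioo.mem_nhds hx))
    · exact (hg.continuousOn.mono (ordConnected_Ioo.uIcc_subset hx₀ hx)).intervalIntegrable
    · exact hg.continuousOn.stronglyMeasurableAtFilter isOpen_Ioo x hx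
  refine ⟨_, ?_, hd⟩
  refine (contDiffOn_infty_iff_deriv_of_isOpen isOpen_Ioo).mpr
    ⟨fun x hx => (hd x hx).differentiableAt.differentiableWithinAt,
      hg.congr fun x hx => (hd x hx).deriv⟩

lemma tendsto_factor'_left (L : PeriodPair) (w : ℝ) : Tendsto (factor' L w) (𝓝[>] (-w)) atBot := by
  refine (tendsto_realP'_zero L).comp (tendsto_nhdsWithin_iff.mpr ⟨?_, ?_⟩)
  · have h : ContinuousAt (fun x : ℝ => x + w) (-w) := by fun_prop
    have := h.tendsto
    rw [neg_add_cancel] at this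
    exact this.mono_left nhdsWithin_le_nhds
  · filter_upwards [self_mem_nhdsWithin] with x hx
    have : -w < x := hx
    exact mem_Ioi.mpr (by linarith)

lemma IsHildebrandSolution.hasDerivAt {p q c α : ℝ} {φ : ℝ → ℝ}
    (hφ : IsHildebrandSolution p q c α φ) {t : ℝ} (ht : t ∈ Ioo (-α) 1) : HasDerivAt φ (deriv φ t) t :=
  ((hφ.smooth.contDiffAt (isOpen_Ioo.mem_nhds ht)).differentiableAt (by simp)).hasDerivAt

namespace IsSetup

variable {p q c : ℝ} {L : PeriodPair} {w : ℝ} (d : IsSetup p q c L w)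
include d

lemma tendsto_factor'_right : Tendsto (factor' L w) (𝓝[<] w) atTop := by
  have h : Tendsto (fun x => w - x) (𝓝[<] w) (𝓝[>] 0) := by
    refine tendsto_nhdsWithin_iff.mpr ⟨?_, ?_⟩
    · have h : ContinuousAt (fun x : ℝ => w - x) w := by fun_prop
      have := h.tendsto
      rw [sub_self] at this
      exact this.mono_left nhdsWithin_le_nhds
    · filter_upwards [self_mem_nhdsWithin] with x hx
      exact mem_Ioi.mpr (sub_pos.mpr hx)
  refine (tendsto_neg_atBot_atTop.comp ((tendsto_realP'_zero L).comp h)).congr fun x => ?_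
  rw [factor', Function.comp_apply, Function.comp_apply, ← realP'_two_mul_sub d.halfPeriod]
  congr 1
  ring

variable {α : ℝ} {φ : ℝ → ℝ} (hφ : IsHildebrandSolution p q c α φ)
include hφ

/-- Multiply the differential equation by t exp φ and complete the square in t exp φ; the relation
pq = p + q turns the left side into a cubic in t φ' + 1. -/
lemma hildebrand_cubic {t : ℝ} (ht : t ∈ Ioo (-α) 1) :
    (t * deriv φ t + 1) ^ 3 + shape p * (t * deriv φ t + 1) ^ 2 + b3 p q c =
      (p + q) * (t * Real.exp (φ t) + c / (2 * (p + q))) ^ 2 := by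
  have h1 := hφ.ode t ht
  have h2 := d.mul_eq
  have h3 : (0 : ℝ) < p + q := by linarith [d.four_le]
  have h4 : Real.exp (-φ t) * Real.exp (φ t) = 1 := by rw [← Real.exp_add]; simp
  have h5 : c / (2 * (p + q)) * (p + q) = c / 2 := by field_simp
  have h6 : c ^ 2 / (4 * (p + q)) = (p + q) * (c / (2 * (p + q))) ^ 2 := by field_simp; ring
  rw [b3, h6, d.shape_eq]
  linear_combination t * Real.exp (φ t) * h1 - t * deriv φ t * (t * deriv φ t + p + 1) *
    (t * deriv φ t + q + 1) * h4 - 2 * t * Real.exp (φ t) * h5 -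
    (t * deriv φ t + 1) * h2

/-- A zero of K = t φ' + 1 would make the left side of the cubic relation equal to b₃ < 0, while the
right side is a square times p + q. As K = 1 at t = 0, connectedness gives K > 0. -/
lemma hildebrand_pos (hα : 0 < α) {t : ℝ} (ht : t ∈ Ioo (-α) 1) : 0 < t * deriv φ t + 1 := by
  have hne : ∀ t ∈ Ioo (-α) 1, t * deriv φ t + 1 ≠ 0 := by
    intro t ht h
    have h1 := d.hildebrand_cubic hφ ht
    have h2 := d.b3_neg
    rw [h] at h1
    have h3 : 0 ≤ (p + q) * (t * Real.exp (φ t) + c / (2 * (p + q))) ^ 2 := by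
      have := d.four_le; positivity
    linarith
  have hc : ContinuousOn (fun t => t * deriv φ t + 1) (Ioo (-α) 1) := by
    have := (hφ.smooth.continuousOn_deriv_of_isOpen isOpen_Ioo (by simp))
    fun_prop
  by_contra! hle
  have h0 : (0 : ℝ) ∈ Ioo (-α) 1 := ⟨by linarith, one_pos⟩
  obtain ⟨u, hu, h⟩ := isPreconnected_Ioo.intermediate_value ht h0 hc
    (show (0 : ℝ) ∈ Icc _ _ from ⟨hle, by simp⟩)
  exact hne u hu h

end IsSetup

/-! ### Reparametrization of Hildebrand's sphere by the isothermal coordinate -/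

lemma cubic_injective {e a b : ℝ} (he : 0 ≤ e) (ha : 0 < a) (hb : 0 < b)
    (h : a ^ 3 + e * a ^ 2 = b ^ 3 + e * b ^ 2) : a = b := by
  have h1 : (a - b) * (a ^ 2 + a * b + b ^ 2 + e * (a + b)) = 0 := by linear_combination h
  have h2 : 0 < a ^ 2 + a * b + b ^ 2 + e * (a + b) := by positivity
  exact sub_eq_zero.mp ((mul_eq_zero.mp h1).resolve_right h2.ne')

namespace IsSetup

variable {p q c : ℝ} {L : PeriodPair} {w : ℝ} (d : IsSetup p q c L w)
include d

/-- The map t ↦ t exp φ is increasing because t φ' + 1 > 0, and W' is increasing because W'' = W(6W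
- E) with W > E/6. Both are onto the line, so matching them through the second relation defines τ.
-/
lemma exists_hildebrand_reparametrization {α : ℝ} (hα : 0 < α) {φ : ℝ → ℝ}
    (hφ : IsHildebrandSolution p q c α φ) :
    ∃ τ : ℝ → ℝ, ContDiffOn ℝ ∞ τ (Ioo (-w) w) ∧ BijOn τ (Ioo (-w) w) (Ioo (-α) 1) ∧
      ∀ x ∈ Ioo (-w) w,
        HasDerivAt τ (6 * factor p L w x * Real.exp (-φ (τ x)) / √(p + q)) x ∧
        factor' L w x - c / (8 * √(p + q)) = √(p + q) / 4 * (τ x * Real.exp (φ (τ x))) ∧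
        4 * factor p L w x - 2 * shape p / 3 = τ x * deriv φ (τ x) + 1 := by
  set ρ := √(p + q) with hρ
  have hS : 0 < p + q := by linarith [d.four_le]
  have hρ0 : 0 < ρ := Real.sqrt_pos.mpr hS
  have hρ2 : ρ ^ 2 = p + q := Real.sq_sqrt hS.le
  have hE := d.shape_pos
  -- the function `t exp (φ t)` is a diffeomorphism onto the real line
  have hyd : ∀ t ∈ Ioo (-α) 1, HasDerivAt (fun t => t * Real.exp (φ t))
      (Real.exp (φ t) * (t * deriv φ t + 1)) t := fun t ht =>
    ((hasDerivAt_id t).mul (hφ.hasDerivAt ht).exp).congr_deriv (by simp; ring)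
  have hφ' : ContDiffOn ℝ ∞ (deriv φ) (Ioo (-α) 1) :=
    ((contDiffOn_infty_iff_deriv_of_isOpen isOpen_Ioo).mp hφ.smooth).2
  have hys : ContDiffOn ℝ ∞ (fun t => Real.exp (φ t) * (t * deriv φ t + 1)) (Ioo (-α) 1) :=
    hφ.smooth.exp.mul ((contDiffOn_id.mul hφ').add contDiffOn_const)
  have el : Tendsto (fun t => Real.exp (φ t)) (𝓝[>] (-α)) atTop :=
    Real.tendsto_exp_atTop.comp hφ.tendsto_left
  have er : Tendsto (fun t => Real.exp (φ t)) (𝓝[<] 1) atTop :=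
    Real.tendsto_exp_atTop.comp hφ.tendsto_right
  obtain ⟨s, hs, hs1, hs2, hs3, hs4⟩ := exists_contDiff_inverse (by linarith) hyd hys
    (fun t ht => mul_pos (Real.exp_pos _) (d.hildebrand_pos hφ hα ht))
    (Tendsto.neg_mul_atTop (neg_neg_iff_pos.mpr hα)
      (tendsto_id.mono_left nhdsWithin_le_nhds) el)
    (Tendsto.pos_mul_atTop one_pos (tendsto_id.mono_left nhdsWithin_le_nhds) er)
  -- so is the derivative of the conformal factor
  have hVd : ∀ x ∈ Ioo (-w) w, HasDerivAt (fun x => 4 / ρ * (factor' L w x - c / (8 * ρ)))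
      (4 / ρ * (6 * factor p L w x ^ 2 - shape p * factor p L w x)) x := fun x hx =>
    ((d.hasDerivAt_factor' hx).sub_const _).const_mul _
  have hVs : ContDiffOn ℝ ∞
      (fun x => 4 / ρ * (6 * factor p L w x ^ 2 - shape p * factor p L w x)) (Ioo (-w) w) := by
    have := d.contDiffOn_factor.1
    fun_prop
  obtain ⟨s', hs', hs1', hs2', hs3', hs4'⟩ := exists_contDiff_inverse
    (by linarith [d.pos] : -w < w) hVd hVs
    (fun x hx => by
      have h1 := d.factor_pos hx
      have h2 := d.lt_factor hx
      have h3 : 0 < factor p L w x * (6 * factor p L w x - shape p) := mul_pos h1 (by linarith)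
      refine mul_pos (by positivity) ?_
      linarith)
    ((tendsto_atBot_add_const_right _ (-(c / (8 * ρ)))
      (tendsto_factor'_left L w)).const_mul_atBot (by positivity))
    ((tendsto_atTop_add_const_right _ (-(c / (8 * ρ)))
      d.tendsto_factor'_right).const_mul_atTop (by positivity))
  set y : ℝ → ℝ := fun x => 4 / ρ * (factor' L w x - c / (8 * ρ)) with hy
  -- Both sides are positive solutions K of K³ + E K² + b₃ = 16 W'², and the left side of this
  -- equation is injective in K > 0.
  have hrel : ∀ x ∈ Ioo (-w) w,
      4 * factor p L w x - 2 * shape p / 3 = s (y x) * deriv φ (s (y x)) + 1 := by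
    intro x hx
    have h1 := d.hildebrand_cubic hφ (hs1 (y x))
    have h2 := d.hildebrand_pos hφ hα (hs1 (y x))
    have h3 := hs2 (y x)
    rw [h3] at h1
    refine cubic_injective hE.le (by linarith [d.lt_factor hx]) h2 ?_
    have h4 := d.factor'_sq hx
    have h5 := d.sq_modU
    have h6 : (p + q) * (y x + c / (2 * (p + q))) ^ 2 = 16 * factor' L w x ^ 2 := by
      rw [hy, ← hρ2]
      field_simp
      ring
    rw [h6] at h1
    linear_combination -16 * h4 - 256 * h5 - h1
  refine ⟨fun x => s (y x), ?_, ⟨fun x _ => hs1 _, fun x hx x' hx' h => ?_, fun t ht => ?_⟩,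
    fun x hx => ⟨?_, ?_, hrel x hx⟩⟩
  · have := d.contDiffOn_factor.2
    exact hs.comp_contDiffOn (by fun_prop)
  · have h1 := congrArg (fun t => t * Real.exp (φ t)) h
    simp only at h1
    have h2 := hs2 (y x)
    have h3 := hs2 (y x')
    rw [h2, h3] at h1
    rw [← hs3' x hx, ← hs3' x' hx']
    exact congrArg s' h1
  · refine ⟨s' (t * Real.exp (φ t)), hs1' _, ?_⟩
    have h := hs2' (t * Real.exp (φ t))
    simp only [hy]
    rw [h, hs3 t ht]
  · refine ((hs4 (y x)).comp x (hVd x hx)).congr_deriv ?_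
    have h1 := hrel x hx
    have h2 := d.lt_factor hx
    have h3 := d.hildebrand_pos hφ hα (hs1 (y x))
    rw [← h1] at h3 ⊢
    rw [Real.exp_neg]
    rw [show 6 * factor p L w x ^ 2 - shape p * factor p L w x =
      3 / 2 * (4 * factor p L w x - 2 * shape p / 3) * factor p L w x by ring]
    have := (Real.exp_pos (φ (s (y x)))).ne'
    generalize 4 * factor p L w x - 2 * shape p / 3 = K at h3
    have := h3.ne'
    field_simp
    ring
  · have h := hs2 (y x)
    rw [h, hy]
    field_simp

end IsSetup

/-- The real part of the cubic coefficient of Hildebrand's affine sphere. -/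
def hildebrandRe (p q c : ℝ) : ℝ := c / (32 * √(p + q))

/-- The imaginary part of the cubic coefficient of Hildebrand's affine sphere. -/
def hildebrandIm (p q : ℝ) : ℝ :=
  -(√3 * √(p + q) * ((p - 2) * (2 * p - 1) * (p + 1)) / (144 * p * (p - 1)))

/-- The exponents of `exp μ` in Hildebrand's affine sphere. -/
def hildebrandExpo (p : ℝ) : Fin 3 → ℝ :=
  ![(2 * p - 1) / (3 * p), -((p + 1) / (3 * p)), -((p - 2) / (3 * p))]

namespace IsSetup

variable {p q c : ℝ} {L : PeriodPair} {w : ℝ} (d : IsSetup p q c L w)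
include d

lemma sqrt_sum_pos : 0 < √(p + q) := Real.sqrt_pos.mpr (by linarith [d.four_le])

lemma sq_sqrt_sum : √(p + q) ^ 2 = p ^ 2 / (p - 1) := by
  rw [Real.sq_sqrt (by linarith [d.four_le]), d.sum_eq]

lemma hildebrandU_eq :
    hildebrandU p c = (hildebrandRe p q c : ℂ) + (hildebrandIm p q : ℂ) * Complex.I := by
  have h1 := d.sub_one_pos
  have h2 := d.p_pos
  have e1 : √(p + q) = p / √(p - 1) := by
    rw [d.sum_eq, Real.sqrt_div (sq_nonneg p), Real.sqrt_sq h2.le]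
  have h3 : 0 < √(p - 1) := Real.sqrt_pos.mpr h1
  have h4 : √(p - 1) ^ 2 = p - 1 := Real.sq_sqrt h1.le
  have h5 : √3 ^ 2 = (3 : ℝ) := Real.sq_sqrt (by norm_num)
  have e2 : (12 * (p - 1)) ^ (3 / 2 : ℝ) = 24 * √3 * (√(p - 1) * (p - 1)) := by
    have h6 : √(12 * (p - 1)) = 2 * √3 * √(p - 1) := by
      rw [show 12 * (p - 1) = 2 ^ 2 * 3 * (p - 1) by ring, Real.sqrt_mul (by norm_num),
        Real.sqrt_mul (by norm_num), Real.sqrt_sq (by norm_num)]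
    rw [show (3 / 2 : ℝ) = 1 / 2 * (3 : ℕ) by norm_num, Real.rpow_mul (by positivity),
      ← Real.sqrt_eq_rpow, Real.rpow_natCast, h6]
    linear_combination 24 * √3 * √(p - 1) * h4 + 8 * √3 * √(p - 1) ^ 3 * h5
  have e3 : hildebrandRe p q c = c * √(p - 1) / (32 * p) := by
    rw [hildebrandRe, e1]; field_simp
  have e4 : hildebrandIm p q =
      -((p - 2) * (2 * p - 1) * (p + 1) / (2 * (12 * (p - 1)) ^ (3 / 2 : ℝ))) := by
    rw [hildebrandIm, e1, e2]
    field_simp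
    rw [h5]
    ring
  rw [hildebrandU, e3, e4]
  push_cast
  ring

lemma sq_hildebrandRe_add : hildebrandRe p q c ^ 2 + hildebrandIm p q ^ 2 = modU p c ^ 2 := by
  have h1 := d.sub_one_pos
  have h2 := d.p_pos
  have h5 : √3 ^ 2 = (3 : ℝ) := Real.sq_sqrt (by norm_num)
  rw [modU, Real.sq_sqrt (by positivity), hildebrandRe, hildebrandIm, div_pow, mul_pow,
    d.sq_sqrt_sum, neg_sq, div_pow, mul_pow, mul_pow, d.sq_sqrt_sum, h5]
  field_simp
  ring

lemma hildebrandRe_neg : hildebrandRe p q c < 0 :=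
  div_neg_of_neg_of_pos d.c_neg (mul_pos (by norm_num) d.sqrt_sum_pos)

lemma hildebrandIm_nonpos : hildebrandIm p q ≤ 0 := by
  have h1 := d.sub_one_pos
  have h2 := d.p_pos
  have h3 : 0 ≤ p - 2 := by linarith [d.two_le]
  have h4 : 0 ≤ 2 * p - 1 := by linarith [d.two_le]
  rw [hildebrandIm, neg_nonpos]
  positivity

lemma sq_hildebrandExpo (i : Fin 3) : (√3 / 2 * √(p + q) * hildebrandExpo p i) ^ 2 =
    3 / 4 * (p ^ 2 / (p - 1)) * hildebrandExpo p i ^ 2 := by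
  have h5 : √3 ^ 2 = (3 : ℝ) := Real.sq_sqrt (by norm_num)
  rw [mul_pow, mul_pow, div_pow, h5, d.sq_sqrt_sum]
  ring

lemma shape_sub_sq_hildebrandExpo (i : Fin 3) :
    shape p / 4 - (√3 / 2 * √(p + q) * hildebrandExpo p i) ^ 2 =
      ![-((p - 2) * (p + 1)), (2 * p - 1) * (p - 2), (2 * p - 1) * (p + 1)] i /
        (12 * (p - 1)) := by
  have h1 := d.sub_one_pos.ne'
  have h2 := d.p_pos.ne'
  rw [d.sq_hildebrandExpo, shape]
  fin_cases i <;> simp [hildebrandExpo] <;> field_simp <;> ring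

/-- The numbers √3/2 √(p + q) times the exponents of μ in the sphere are thus the three roots f of
the cubic that belongs to Hildebrand's cubic coefficient. -/
lemma hildebrandExpo_mul (i : Fin 3) : √3 / 2 * √(p + q) * hildebrandExpo p i *
    (shape p / 4 - (√3 / 2 * √(p + q) * hildebrandExpo p i) ^ 2) = 2 * hildebrandIm p q := by
  have h1 := d.sub_one_pos.ne'
  have h2 := d.p_pos.ne'
  rw [d.shape_sub_sq_hildebrandExpo, hildebrandIm]
  fin_cases i <;> simp [hildebrandExpo] <;> field_simp <;> ring

variable {X : ℝ → ℝ} {f A B : ℝ}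

/-- A first order equation implies the second order one. -/
lemma hasDerivAt_of_first_order (hAB : A ^ 2 + B ^ 2 = modU p c ^ 2)
    (hf : f * (shape p / 4 - f ^ 2) = 2 * B)
    (hne : ∀ x ∈ Ioo (-w) w, factor p L w x - (shape p / 4 - f ^ 2) ≠ 0)
    (hX : ∀ x ∈ Ioo (-w) w, HasDerivAt X ((factor' L w x + 4 * A) /
      (2 * (factor p L w x - (shape p / 4 - f ^ 2))) * X x) x) {x : ℝ} (hx : x ∈ Ioo (-w) w) :
    HasDerivAt (fun x => (factor' L w x + 4 * A) /
      (2 * (factor p L w x - (shape p / 4 - f ^ 2))) * X x)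
      ((2 * factor p L w x - f ^ 2) * X x) x := by
  have hn := hne x hx
  refine ((((d.hasDerivAt_factor' hx).add_const (4 * A)).div
    (((d.hasDerivAt_factor hx).sub_const (shape p / 4 - f ^ 2)).const_mul 2)
    (mul_ne_zero two_ne_zero hn)).mul (hX x hx)).congr_deriv ?_
  have h1 := d.factor'_sq hx
  rw [← hAB] at h1
  simp only [Pi.div_apply]
  generalize factor p L w x = V at *
  obtain ⟨E, hE⟩ : ∃ E, V - (shape p / 4 - f ^ 2) = E := ⟨_, rfl⟩
  have hs : shape p = 4 * (V - E + f ^ 2) := by linear_combination -4 * hE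
  rw [hE] at hn ⊢
  rw [hs] at h1 hf ⊢
  field_simp
  linear_combination -X x * h1 + X x * hf * 4 * (f * (V - E) + 2 * B)

end IsSetup

/-! ### The coordinates of Hildebrand's sphere as separated solutions -/

namespace IsSetup

variable {p q c : ℝ} {L : PeriodPair} {w : ℝ} (d : IsSetup p q c L w)
include d

/-- The product of the differences between the conformal factor and its values at the first two
parameters. -/
abbrev rootProd (_ : IsSetup p q c L w) (x : ℝ) : ℝ :=
  (factor p L w x - (shape p / 4 - (√3 / 2 * √(p + q) * hildebrandExpo p 0) ^ 2)) *
    (factor p L w x - (shape p / 4 - (√3 / 2 * √(p + q) * hildebrandExpo p 1) ^ 2))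

/-- Put W_i = E/4 - f_i². Then W₀ = E/6 - p/4 and W₁ = E/6 - q/4 lie below E/6 < W. The value W₂ is
excluded, because W attains it. -/
lemma root_pos {i : Fin 3} (hi : i ≠ 2) {x : ℝ} (hx : x ∈ Ioo (-w) w) :
    0 < factor p L w x - (shape p / 4 - (√3 / 2 * √(p + q) * hildebrandExpo p i) ^ 2) := by
  have h1 := d.sub_one_pos
  have h2 := d.lt_factor hx
  have h3 : shape p / 4 - (√3 / 2 * √(p + q) * hildebrandExpo p i) ^ 2 < shape p / 6 := by
    rw [d.shape_sub_sq_hildebrandExpo, shape, div_div, div_lt_div_iff₀ (by positivity)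
      (by positivity)]
    have := d.two_le
    fin_cases i
    · simp; nlinarith
    · simp; nlinarith
    · exact absurd rfl hi
  linarith

lemma rootProd_eq (x : ℝ) : d.rootProd x = factor p L w x ^ 2 -
    (√3 / 2 * √(p + q) * hildebrandExpo p 2) ^ 2 * factor p L w x -
    (√3 / 2 * √(p + q) * hildebrandExpo p 2) ^ 2 *
      (shape p / 4 - (√3 / 2 * √(p + q) * hildebrandExpo p 2) ^ 2) := by
  have h1 := d.sub_one_pos.ne'
  have h2 := d.p_pos.ne'
  rw [rootProd, d.shape_sub_sq_hildebrandExpo, d.shape_sub_sq_hildebrandExpo,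
    d.shape_sub_sq_hildebrandExpo, d.sq_hildebrandExpo]
  simp [hildebrandExpo]
  field_simp
  ring

/-- W'² - 16A² = 4W³ - E W² + 16B², and W₀, W₁, W₂ are the roots of this cubic in W. -/
lemma factor'_mul_eq {x : ℝ} (hx : x ∈ Ioo (-w) w) :
    (factor' L w x - 4 * hildebrandRe p q c) * (factor' L w x + 4 * hildebrandRe p q c) =
      4 * d.rootProd x *
        (factor p L w x - (shape p / 4 - (√3 / 2 * √(p + q) * hildebrandExpo p 2) ^ 2)) := by
  have h1 := d.factor'_sq hx
  have h2 := d.hildebrandExpo_mul 2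
  rw [← d.sq_hildebrandRe_add] at h1
  rw [d.rootProd_eq]
  set f := √3 / 2 * √(p + q) * hildebrandExpo p 2
  linear_combination h1 - 4 * (f * (shape p / 4 - f ^ 2) + 2 * hildebrandIm p q) * h2

/-- The logarithmic derivative common to the coordinates of Hildebrand's affine sphere. -/
abbrev rate (x : ℝ) : ℝ := (factor' L w x + 4 * hildebrandRe p q c) / (4 * d.rootProd x)

lemma rootProd_pos {x : ℝ} (hx : x ∈ Ioo (-w) w) : 0 < d.rootProd x :=
  mul_pos (d.root_pos (by decide) hx) (d.root_pos (by decide) hx)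

lemma contDiffOn_rate : ContDiffOn ℝ ∞ d.rate (Ioo (-w) w) := by
  obtain ⟨h1, h2⟩ := d.contDiffOn_factor
  refine (h2.add contDiffOn_const).div (contDiffOn_const.mul ((h1.sub contDiffOn_const).mul
    (h1.sub contDiffOn_const))) fun x hx => ?_
  exact (mul_pos four_pos (d.rootProd_pos hx)).ne'

variable {F h : ℝ → ℝ} (hF : ∀ x ∈ Ioo (-w) w, HasDerivAt F (6 * factor p L w x * d.rate x) x)
  (hh : ∀ x ∈ Ioo (-w) w,
    HasDerivAt h (3 / 2 * (p ^ 2 / (p - 1)) * hildebrandExpo p 2 * d.rate x) x)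
include hF hh

/-- The exponents f_i have sum 0 and second symmetric function -E/4, so f₀f₂ = -W₁ and f₁f₂ = -W₀.
For i = 0 the logarithmic derivative is therefore 2(W - W₁) times `rate`; one of the two factors of
`rootProd` cancels and the first order relation appears. The case i = 1 is the same with 0 and 1
exchanged. -/
lemma hasDerivAt_hildebrand_exp {i : Fin 3} (hi : i ≠ 2) (k : ℝ) {x : ℝ} (hx : x ∈ Ioo (-w) w) :
    HasDerivAt (fun x => k * Real.exp (F x / 3 + hildebrandExpo p i * h x))
      ((factor' L w x + 4 * hildebrandRe p q c) / (2 * (factor p L w x -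
        (shape p / 4 - (√3 / 2 * √(p + q) * hildebrandExpo p i) ^ 2))) *
        (k * Real.exp (F x / 3 + hildebrandExpo p i * h x))) x := by
  refine (((((hF x hx).div_const 3).add ((hh x hx).const_mul
    (hildebrandExpo p i))).exp).const_mul k).congr_deriv ?_
  have h0 := (d.root_pos (i := 0) (by decide) hx).ne'
  have h1 := (d.root_pos (i := 1) (by decide) hx).ne'
  have hp1 := d.sub_one_pos.ne'
  have hp2 := d.p_pos.ne'
  have key : ∀ i j : Fin 3, (i = 0 ∧ j = 1 ∨ i = 1 ∧ j = 0) →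
      3 / 4 * (p ^ 2 / (p - 1)) * hildebrandExpo p 2 * hildebrandExpo p i =
        -(shape p / 4 - (√3 / 2 * √(p + q) * hildebrandExpo p j) ^ 2) := by
    rintro i j (⟨rfl, rfl⟩ | ⟨rfl, rfl⟩) <;> rw [d.shape_sub_sq_hildebrandExpo] <;>
      simp [hildebrandExpo] <;> field_simp <;> ring
  have k0 := key 0 1 (Or.inl ⟨rfl, rfl⟩)
  have k1 := key 1 0 (Or.inr ⟨rfl, rfl⟩)
  have e : ∀ i j : Fin 3, 3 / 4 * (p ^ 2 / (p - 1)) * hildebrandExpo p 2 * hildebrandExpo p i =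
        -(shape p / 4 - (√3 / 2 * √(p + q) * hildebrandExpo p j) ^ 2) →
      6 * factor p L w x * d.rate x / 3 + hildebrandExpo p i *
        (3 / 2 * (p ^ 2 / (p - 1)) * hildebrandExpo p 2 * d.rate x) = 2 * d.rate x *
        (factor p L w x - (shape p / 4 - (√3 / 2 * √(p + q) * hildebrandExpo p j) ^ 2)) :=
    fun i j h => by linear_combination 2 * d.rate x * h
  fin_cases i
  · simp only [Fin.zero_eta, Fin.isValue] at *
    rw [e 0 1 k0, rate, rootProd, Pi.add_apply]
    generalize factor p L w x - (shape p / 4 - (√3 / 2 * √(p + q) * hildebrandExpo p 0) ^ 2) = a at *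
    generalize factor p L w x - (shape p / 4 - (√3 / 2 * √(p + q) * hildebrandExpo p 1) ^ 2) = b at *
    field_simp
    ring
  · simp only [Fin.mk_one, Fin.isValue] at *
    rw [e 1 0 k1, rate, rootProd, Pi.add_apply]
    generalize factor p L w x - (shape p / 4 - (√3 / 2 * √(p + q) * hildebrandExpo p 0) ^ 2) = a at *
    generalize factor p L w x - (shape p / 4 - (√3 / 2 * √(p + q) * hildebrandExpo p 1) ^ 2) = b at *
    field_simp
    ring
  · exact absurd rfl hi

/-- The product of W' - 4A and `rate` is W - W₂, so no division by W - W₂ occurs. With W'' = 6W² - E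
W the bracket that remains is twice `rootProd`. -/
lemma hasDerivAt_hildebrand_two (k : ℝ) {x : ℝ} (hx : x ∈ Ioo (-w) w) :
    HasDerivAt (fun x => k * ((factor' L w x - 4 * hildebrandRe p q c) *
      Real.exp (-2 * F x / 3 + hildebrandExpo p 2 * h x)))
      (k * (2 * d.rootProd x * Real.exp (-2 * F x / 3 + hildebrandExpo p 2 * h x))) x := by
  refine ((((d.hasDerivAt_factor' hx).sub_const (4 * hildebrandRe p q c)).mul
    (((((hF x hx).const_mul (-2)).div_const 3).add ((hh x hx).const_mul
    (hildebrandExpo p 2))).exp)).const_mul k).congr_deriv ?_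
  have h1 := d.factor'_mul_eq hx
  have h2 := d.rootProd_pos hx
  have h3 := d.rootProd_eq x
  have h4 := d.sq_hildebrandExpo 2
  have h5 : (factor' L w x - 4 * hildebrandRe p q c) * d.rate x =
      factor p L w x - (shape p / 4 - (√3 / 2 * √(p + q) * hildebrandExpo p 2) ^ 2) := by
    rw [rate, mul_div_assoc', h1, mul_div_cancel_left₀ _ (by positivity)]
  set f := √3 / 2 * √(p + q) * hildebrandExpo p 2
  set Z := Real.exp (-2 * F x / 3 + hildebrandExpo p 2 * h x)
  linear_combination k * Z * (-4 * factor p L w x + 2 * f ^ 2) * h5 - 2 * k * Z * h3 -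
    2 * k * Z * (factor' L w x - 4 * hildebrandRe p q c) * d.rate x * h4

lemma hasDerivAt_hildebrand_two' (k : ℝ) {x : ℝ} (hx : x ∈ Ioo (-w) w) :
    HasDerivAt (fun x => k * (2 * d.rootProd x * Real.exp (-2 * F x / 3 + hildebrandExpo p 2 * h x)))
      ((2 * factor p L w x - (√3 / 2 * √(p + q) * hildebrandExpo p 2) ^ 2) *
        (k * ((factor' L w x - 4 * hildebrandRe p q c) *
      Real.exp (-2 * F x / 3 + hildebrandExpo p 2 * h x)))) x := by
  have hV := d.hasDerivAt_factor hx
  have h2 := d.rootProd_pos hx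
  have h4 := d.sq_hildebrandExpo 2
  have h5 : d.rate x * d.rootProd x = (factor' L w x + 4 * hildebrandRe p q c) / 4 := by
    rw [rate, div_mul_eq_mul_div, mul_div_mul_right _ _ h2.ne']
  have hfun : d.rootProd = fun x => factor p L w x ^ 2 -
    (√3 / 2 * √(p + q) * hildebrandExpo p 2) ^ 2 * factor p L w x -
    (√3 / 2 * √(p + q) * hildebrandExpo p 2) ^ 2 *
      (shape p / 4 - (√3 / 2 * √(p + q) * hildebrandExpo p 2) ^ 2) := funext d.rootProd_eq
  have hQ : HasDerivAt d.rootProd (2 * factor p L w x * factor' L w x -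
      (√3 / 2 * √(p + q) * hildebrandExpo p 2) ^ 2 * factor' L w x) x := by
    rw [hfun]
    exact (((hV.pow 2).sub (hV.const_mul _)).sub_const _).congr_deriv (by simp)
  refine (((hQ.const_mul 2).mul
    (((((hF x hx).const_mul (-2)).div_const 3).add ((hh x hx).const_mul
    (hildebrandExpo p 2))).exp)).const_mul k).congr_deriv ?_
  generalize d.rate x = R at *
  generalize d.rootProd x = Q at *
  set f := √3 / 2 * √(p + q) * hildebrandExpo p 2
  set Z := Real.exp (-2 * F x / 3 + hildebrandExpo p 2 * h x)
  linear_combination k * Z * (-8 * factor p L w x + 4 * f ^ 2) * h5 - 4 * k * Z * R * Q * h4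

end IsSetup

lemma det_prod_shear {f g : ℝ → ℝ} {f' g' k : ℝ} {z : ℝ × ℝ} (hf : HasDerivAt f f' z.1)
    (hg : HasDerivAt g g' z.1) :
    (fderiv ℝ (fun z : ℝ × ℝ => (f z.1, k * z.2 + g z.1)) z).det = f' * k := by
  have h1 : HasFDerivAt (fun z : ℝ × ℝ => f z.1) (f' • ContinuousLinearMap.fst ℝ ℝ ℝ) z :=
    hf.comp_hasFDerivAt z hasFDerivAt_fst
  have h2 : HasFDerivAt (fun z : ℝ × ℝ => g z.1) (g' • ContinuousLinearMap.fst ℝ ℝ ℝ) z :=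
    hg.comp_hasFDerivAt z hasFDerivAt_fst
  have h3 : HasFDerivAt (fun z : ℝ × ℝ => k * z.2 + g z.1)
      (g' • ContinuousLinearMap.fst ℝ ℝ ℝ + k • ContinuousLinearMap.snd ℝ ℝ ℝ) z := by
    rw [add_comm]
    exact ((hasFDerivAt_snd (p := z)).const_mul k).add h2
  have h4 : f' • ContinuousLinearMap.fst ℝ ℝ ℝ =
      f' • ContinuousLinearMap.fst ℝ ℝ ℝ + (0 : ℝ) • ContinuousLinearMap.snd ℝ ℝ ℝ := by
    rw [zero_smul, add_zero]
  rw [(h1.prodMk h3).fderiv, h4, ← Matrix.toLin_finTwoProd_toContinuousLinearMap,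
    LinearMap.det_toContinuousLinearMap, LinearMap.det_toLin, Matrix.det_fin_two_of]
  ring

namespace IsSetup

variable {p q c : ℝ} {L : PeriodPair} {w : ℝ} (d : IsSetup p q c L w)
include d

lemma hildebrandExpo_eq : hildebrandExpo p =
    ![(q + 1) / (3 * q), -((p + 1) / (3 * p)), -((p - q) / (3 * (p + q)))] := by
  have h1 := d.sub_one_pos.ne'
  have h2 := d.p_pos.ne'
  have e1 : (2 * p - 1) / (3 * p) = (q + 1) / (3 * q) := by
    rw [d.q_eq]; field_simp; ring
  have e2 : (p - 2) / (3 * p) = (p - q) / (3 * (p + q)) := by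
    rw [d.sum_eq, d.q_eq]; field_simp; ring
  rw [hildebrandExpo, e1, e2]

lemma hildebrandExpo_sum : hildebrandExpo p 0 + hildebrandExpo p 1 + hildebrandExpo p 2 = 0 := by
  have h2 := d.p_pos.ne'
  simp [hildebrandExpo]
  field_simp
  ring

lemma root_eq : shape p / 4 - (√3 / 2 * √(p + q) * hildebrandExpo p 0) ^ 2 = shape p / 6 - p / 4 ∧
    shape p / 4 - (√3 / 2 * √(p + q) * hildebrandExpo p 1) ^ 2 = shape p / 6 - q / 4 := by
  have h1 := d.sub_one_pos.ne'
  rw [d.shape_sub_sq_hildebrandExpo, d.shape_sub_sq_hildebrandExpo, d.q_eq, shape]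
  constructor <;> simp <;> field_simp <;> ring

variable {α : ℝ} {φ : ℝ → ℝ}

/-- Under the reparametrization the factors tφ' + p + 1 and tφ' + q + 1 of the differential equation
are 4(W - W₀) and 4(W - W₁), and its right side is 4√(p + q)(W' + 4A). -/
lemma sqrt_mul_rate (hφ : IsHildebrandSolution p q c α φ) {x t : ℝ} (hx : x ∈ Ioo (-w) w)
    (ht : t ∈ Ioo (-α) 1)
    (h1 : factor' L w x - c / (8 * √(p + q)) = √(p + q) / 4 * (t * Real.exp (φ t)))
    (h2 : 4 * factor p L w x - 2 * shape p / 3 = t * deriv φ t + 1) :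
    √(p + q) * d.rate x = Real.exp (-φ t) * deriv φ t := by
  have hρ := d.sqrt_sum_pos
  have hρ2 : √(p + q) ^ 2 = p + q := Real.sq_sqrt (by linarith [d.four_le])
  have hinv := mul_inv_cancel₀ hρ.ne'
  have h4 := hφ.ode t ht
  have e0 : 4 * (factor p L w x - (shape p / 4 - (√3 / 2 * √(p + q) * hildebrandExpo p 0) ^ 2)) =
      t * deriv φ t + p + 1 := by
    rw [d.root_eq.1]; linear_combination h2
  have e1 : 4 * (factor p L w x - (shape p / 4 - (√3 / 2 * √(p + q) * hildebrandExpo p 1) ^ 2)) =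
      t * deriv φ t + q + 1 := by
    rw [d.root_eq.2]; linear_combination h2
  have e2 : factor' L w x + 4 * hildebrandRe p q c =
      ((p + q) * t * Real.exp (φ t) + c) / (4 * √(p + q)) := by
    rw [eq_div_iff (by positivity), hildebrandRe]
    linear_combination 4 * √(p + q) * h1 + t * Real.exp (φ t) * hρ2 + c * hinv
  rw [← h4, ← e0, ← e1] at e2
  rw [rate, e2, rootProd]
  have := (d.root_pos (i := 0) (by decide) hx).ne'
  have := (d.root_pos (i := 1) (by decide) hx).ne'
  generalize factor p L w x - (shape p / 4 - (√3 / 2 * √(p + q) * hildebrandExpo p 0) ^ 2) = a at *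
  generalize factor p L w x - (shape p / 4 - (√3 / 2 * √(p + q) * hildebrandExpo p 1) ^ 2) = b at *
  field_simp

/-- The map is (x, y) ↦ (τ(x), κ y + h(x)). The shear h is the antiderivative that makes the
coordinates satisfy the first order relation; its constant of integration is immaterial, since it
only translates μ. -/
lemma exists_hildebrand_map (hα : 0 < α) (hφ : IsHildebrandSolution p q c α φ) :
    ∃ Φ : ℝ × ℝ → ℝ × ℝ,
      ContDiffOn ℝ ∞ Φ (Ioo (-w) w ×ˢ univ) ∧
      BijOn Φ (Ioo (-w) w ×ˢ univ) (Ioo (-α) 1 ×ˢ univ) ∧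
      (∀ z ∈ Ioo (-w) w ×ˢ (univ : Set ℝ), (fderiv ℝ Φ z).det ≠ 0) ∧
      HasInvariants (Ioo (-w) w ×ˢ univ) (fun z => (1 / √3) • hildebrandSphere p q φ (Φ z))
        (conformalFactor p q L w) (-1) (hildebrandU p c) := by
  obtain ⟨τ, hτs, hτb, hτ⟩ := d.exists_hildebrand_reparametrization hα hφ
  have hρ := d.sqrt_sum_pos
  have hρ2 : √(p + q) ^ 2 = p + q := Real.sq_sqrt (by linarith [d.four_le])
  have h3 : 0 < √(3 : ℝ) := by positivity
  have h32 : √3 ^ 2 = (3 : ℝ) := Real.sq_sqrt (by norm_num)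
  have hp1 := d.sub_one_pos
  have hp2 := d.p_pos
  obtain ⟨h, hhs, hh⟩ := exists_antiderivative d.zero_mem
    ((contDiffOn_const (c := 3 / 2 * (p ^ 2 / (p - 1)) * hildebrandExpo p 2)).mul d.contDiffOn_rate)
  set F : ℝ → ℝ := fun x => φ (τ x) with hFdef
  have hFs : ContDiffOn ℝ ∞ F (Ioo (-w) w) := hφ.smooth.comp hτs hτb.mapsTo
  have hrate : ∀ x ∈ Ioo (-w) w, √(p + q) * d.rate x = Real.exp (-F x) * deriv φ (τ x) :=
    fun x hx => d.sqrt_mul_rate hφ hx (hτb.mapsTo hx) (hτ x hx).2.1 (hτ x hx).2.2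
  have hF : ∀ x ∈ Ioo (-w) w, HasDerivAt F (6 * factor p L w x * d.rate x) x := fun x hx => by
    refine ((hφ.hasDerivAt (hτb.mapsTo hx)).comp x (hτ x hx).1).congr_deriv ?_
    have := hrate x hx
    simp only [hFdef] at this
    generalize d.rate x = R at *
    field_simp
    linear_combination -factor p L w x * this
  -- Writing t exp(φ/3) as (t exp φ) exp(-2φ/3) brings in W' - 4A, the image of t exp φ.
  have hτexp : ∀ x ∈ Ioo (-w) w, Real.exp (F x / 3) * τ x =
      4 / √(p + q) * ((factor' L w x - 4 * hildebrandRe p q c) * Real.exp (-2 * F x / 3)) := by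
    intro x hx
    have h1 := (hτ x hx).2.1
    have h2 : Real.exp (F x) * Real.exp (-2 * F x / 3) = Real.exp (F x / 3) := by
      rw [← Real.exp_add]; ring_nf
    have e : 4 * hildebrandRe p q c = c / (8 * √(p + q)) := by
      rw [hildebrandRe]; field_simp; ring
    have h5 : 4 / √(p + q) * (√(p + q) / 4) = 1 := by field_simp
    have h6 : φ (τ x) = F x := rfl
    rw [e, h1, ← h2, h6]
    linear_combination -Real.exp (F x) * Real.exp (-2 * F x / 3) * τ x * h5
  set κ := √3 / 2 * √(p + q) with hκ
  have hκ0 : 0 < κ := by positivity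
  have hκ2 : κ ^ 2 = 3 / 4 * (p ^ 2 / (p - 1)) := by
    rw [hκ, mul_pow, div_pow, h32, d.sq_sqrt_sum]; norm_num
  set k : Fin 3 → ℝ := ![1 / √3, 1 / √3, 4 / (√3 * √(p + q))] with hk
  -- The third coordinate is treated apart: it vanishes at t = 0, where W = W₂, so its derivative
  -- cannot be written as a quotient by W - W₂.
  set X : Fin 3 → ℝ → ℝ := fun i => if i = 2
    then fun x => k i * ((factor' L w x - 4 * hildebrandRe p q c) *
      Real.exp (-2 * F x / 3 + hildebrandExpo p 2 * h x))
    else fun x => k i * Real.exp (F x / 3 + hildebrandExpo p i * h x) with hX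
  set X' : Fin 3 → ℝ → ℝ := fun i => if i = 2
    then fun x => k i * (2 * d.rootProd x * Real.exp (-2 * F x / 3 + hildebrandExpo p 2 * h x))
    else fun x => (factor' L w x + 4 * hildebrandRe p q c) / (2 * (factor p L w x -
        (shape p / 4 - (κ * hildebrandExpo p i) ^ 2))) * X i x with hX'
  have hX_ne : ∀ i, i ≠ 2 → ∀ x, X i x = k i * Real.exp (F x / 3 + hildebrandExpo p i * h x) :=
    fun i hi x => by simp only [hX, hi, if_false]
  have hX_two : ∀ x, X 2 x = k 2 * ((factor' L w x - 4 * hildebrandRe p q c) *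
      Real.exp (-2 * F x / 3 + hildebrandExpo p 2 * h x)) := fun x => by
    simp only [hX, if_true]
  have hXd : ∀ i, ∀ x ∈ Ioo (-w) w, HasDerivAt (X i) (X' i x) x := fun i x hx => by
    by_cases hi : i = 2
    · simpa only [hX, hX', hi, if_true] using d.hasDerivAt_hildebrand_two hF hh (k 2) hx
    · simpa only [hX, hX', hi, if_false] using d.hasDerivAt_hildebrand_exp hF hh hi (k i) hx
  have hXd' : ∀ i, ∀ x ∈ Ioo (-w) w, HasDerivAt (X' i)
      ((2 * factor p L w x - (κ * hildebrandExpo p i) ^ 2) * X i x) x := fun i x hx => by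
    by_cases hi : i = 2
    · simpa only [hX, hX', hi, if_true] using d.hasDerivAt_hildebrand_two' hF hh (k 2) hx
    · have := d.hasDerivAt_of_first_order d.sq_hildebrandRe_add (d.hildebrandExpo_mul i)
        (X := X i) (fun x hx => (d.root_pos hi hx).ne')
        (fun x hx => (by simpa only [hX', hi, if_false] using hXd i x hx)) hx
      simpa only [hX', hi, if_false] using this
  have hR1 : ∀ i, ∀ x ∈ Ioo (-w) w,
      (factor p L w x - (shape p / 4 - (κ * hildebrandExpo p i) ^ 2)) * X' i x =
        1 / 2 * (factor' L w x + 4 * hildebrandRe p q c) * X i x := fun i x hx => by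
    by_cases hi : i = 2
    · simp only [hX, hX', hi, if_true]
      have := d.factor'_mul_eq hx
      linear_combination -(1 / 2) * k 2 *
        Real.exp (-2 * F x / 3 + hildebrandExpo p 2 * h x) * this
    · have h1 := (d.root_pos hi hx).ne'
      simp only [hX', hi, if_false]
      rw [← hκ] at h1
      generalize factor p L w x - (shape p / 4 - (κ * hildebrandExpo p i) ^ 2) = a at *
      field_simp
  have hXs : ∀ i, ContDiffOn ℝ ∞ (X i) (Ioo (-w) w) := fun i => by
    have := d.contDiffOn_factor.2
    by_cases hi : i = 2
    · simp only [hX, hi, if_true]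
      fun_prop
    · simp only [hX, hi, if_false]
      fun_prop
  set r : ℝ × ℝ → Fin 3 → ℝ := fun z i => X i z.1 * Real.exp (κ * hildebrandExpo p i * z.2) with hr
  have hG : GaussSystem (Ioo (-w) w ×ˢ univ) r (fun z => factor p L w z.1)
      (fun z => factor' L w z.1) (hildebrandRe p q c) (hildebrandIm p q) :=
    GaussSystem.pi (fun i => d.gaussSystem_separated (d.hildebrandExpo_mul i) (hXs i) (hXd i)
      (hXd' i) (hR1 i)) (isOpen_strip w)
  have hz : ((0 : ℝ), (0 : ℝ)) ∈ Ioo (-w) w ×ˢ (univ : Set ℝ) := ⟨d.zero_mem, mem_univ _⟩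
  have hdet : det3 (dx r (0, 0)) (dy r (0, 0)) (r (0, 0)) = factor p L w 0 := by
    have sm := hG.smooth.differentiableAt_of_isOpen (isOpen_strip w) hz
    have e0 : r (0, 0) = fun i => X i 0 := by ext i; simp [hr]
    have e1 : dx r (0, 0) = fun i => X' i 0 := by
      ext i
      rw [← dx_apply sm]
      refine (((hXd i 0 d.zero_mem).mul_const
        (Real.exp (κ * hildebrandExpo p i * 0))).congr_deriv (by simp)).deriv
    have e2 : dy r (0, 0) = fun i => X i 0 * (κ * hildebrandExpo p i) := by
      ext i
      rw [← dy_apply sm]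
      exact (((((hasDerivAt_id (0 : ℝ)).const_mul (κ * hildebrandExpo p i)).exp).const_mul
        (X i 0)).congr_deriv (by simp)).deriv
    rw [e0, e1, e2]
    have hA := d.hildebrandRe_neg.ne
    have hsum : κ * hildebrandExpo p 0 + κ * hildebrandExpo p 1 + κ * hildebrandExpo p 2 = 0 := by
      linear_combination κ * d.hildebrandExpo_sum
    have s2 : (κ * hildebrandExpo p 0) ^ 2 + κ * hildebrandExpo p 0 * (κ * hildebrandExpo p 1) +
        (κ * hildebrandExpo p 1) ^ 2 = shape p / 4 := by
      rw [show (κ * hildebrandExpo p 0) ^ 2 + κ * hildebrandExpo p 0 * (κ * hildebrandExpo p 1) +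
        (κ * hildebrandExpo p 1) ^ 2 = κ ^ 2 * (hildebrandExpo p 0 ^ 2 +
          hildebrandExpo p 0 * hildebrandExpo p 1 + hildebrandExpo p 1 ^ 2) by ring, hκ2, shape]
      simp [hildebrandExpo]
      field_simp
      ring
    have key := det3_of_first_order (f := fun i => κ * hildebrandExpo p i) (K := fun i => X i 0)
      (g := fun i => X' i 0) (V := factor p L w 0) hsum s2 hA (fun i => by
        have := hR1 i 0 d.zero_mem
        rw [d.factor'_zero] at this
        linear_combination this)
      (d.prod_factor_zero (f := fun i => κ * hildebrandExpo p i) d.sq_hildebrandRe_add hsum s2 (d.hildebrandExpo_mul 0))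
    have hvan : (κ * hildebrandExpo p 0 - κ * hildebrandExpo p 1) *
        (κ * hildebrandExpo p 0 - κ * hildebrandExpo p 2) *
        (κ * hildebrandExpo p 1 - κ * hildebrandExpo p 2) = -(3 / 4 * κ) := by
      rw [show (κ * hildebrandExpo p 0 - κ * hildebrandExpo p 1) *
        (κ * hildebrandExpo p 0 - κ * hildebrandExpo p 2) *
        (κ * hildebrandExpo p 1 - κ * hildebrandExpo p 2) = κ ^ 2 * κ *
        ((hildebrandExpo p 0 - hildebrandExpo p 1) * (hildebrandExpo p 0 - hildebrandExpo p 2) *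
        (hildebrandExpo p 1 - hildebrandExpo p 2)) by ring, hκ2]
      simp [hildebrandExpo]
      field_simp
      ring
    -- The exponentials cancel because the exponents of μ have sum 0, so the values F(0) and h(0)
    -- drop out; the factor W' - 4A reduces to -4A at the origin.
    have hprod : X 0 0 * X 1 0 * X 2 0 =
        -(16 / (3 * √3 * √(p + q))) * hildebrandRe p q c := by
      have hexp : Real.exp (F 0 / 3 + hildebrandExpo p 0 * h 0) *
          Real.exp (F 0 / 3 + hildebrandExpo p 1 * h 0) *
          Real.exp (-2 * F 0 / 3 + hildebrandExpo p 2 * h 0) = 1 := by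
        rw [← Real.exp_add, ← Real.exp_add, Real.exp_eq_one_iff]
        linear_combination h 0 * d.hildebrandExpo_sum
      have hk3 : k 0 * k 1 * k 2 = 4 / (3 * √3 * √(p + q)) := by
        simp only [hk, Matrix.cons_val_zero, Matrix.cons_val_one, Matrix.cons_val]
        field_simp
        rw [h32]
      rw [hX_ne 0 (by decide), hX_ne 1 (by decide), hX_two, d.factor'_zero]
      linear_combination -4 * hildebrandRe p q c * (k 0 * k 1 * k 2) * hexp -
        4 * hildebrandRe p q c * hk3
    rw [hvan, hprod] at key
    refine mul_left_cancel₀ (mul_ne_zero two_ne_zero hA) (key.trans ?_)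
    rw [hκ]
    field_simp
    norm_num
  have hc := d.contDiffOn_factor
  set S : ℝ × ℝ → Fin 3 → ℝ :=
    fun z => (1 / √3) • hildebrandSphere p q φ (τ z.1, κ * z.2 + h z.1) with hSdef
  have heq : ∀ z ∈ Ioo (-w) w ×ˢ (univ : Set ℝ), S z = r z := by
    intro z hz
    have hm : ∀ i, Real.exp (hildebrandExpo p i * (κ * z.2 + h z.1)) =
        Real.exp (hildebrandExpo p i * h z.1) * Real.exp (κ * hildebrandExpo p i * z.2) :=
      fun i => by rw [← Real.exp_add]; ring_nf
    have hS : S z = (1 / √3) • Real.exp (F z.1 / 3) •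
        ![Real.exp (hildebrandExpo p 0 * (κ * z.2 + h z.1)),
          Real.exp (hildebrandExpo p 1 * (κ * z.2 + h z.1)),
          Real.exp (hildebrandExpo p 2 * (κ * z.2 + h z.1)) * τ z.1] := by
      rw [d.hildebrandExpo_eq]; rfl
    rw [hS, hm, hm, hm]
    have h4 := hτexp z.1 hz.1
    ext i
    fin_cases i
    · simp [hr, hX_ne, hk, Real.exp_add]; ring
    · simp [hr, hX_ne, hk, Real.exp_add]; ring
    · simp only [Fin.reduceFinMk, Pi.smul_apply, smul_eq_mul, Matrix.cons_val, hr, hX_two, hk,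
        Real.exp_add]
      rw [mul_comm (_ * _) (τ z.1), ← mul_assoc (Real.exp (F z.1 / 3)), h4]
      field_simp
  have heq' : S =ᶠ[𝓝 (0, 0)] r := by
    filter_upwards [(isOpen_strip w).mem_nhds hz] with z hz using heq z hz
  have hG' := hG.congr (isOpen_strip w) heq
  rw [← heq _ hz, ← dx_congr heq', ← dy_congr heq'] at hdet
  have hI : HasInvariants (Ioo (-w) w ×ˢ univ) S (conformalFactor p q L w) (-1)
      (hildebrandU p c) := by
    rw [d.hasInvariants_conformalFactor_iff, d.hildebrandU_eq]
    exact hG'.hasInvariants (isOpen_strip w) (fun z hz => d.factor_pos hz.1)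
      (hG'.det_eq d.pos (hc.1.continuousOn.comp continuousOn_fst fun z hz => hz.1)
        (hc.2.continuousOn.comp continuousOn_fst fun z hz => hz.1)
        (fun z hz => (d.factor_pos hz.1).ne') (fun z hz => d.hasDerivAt_factor_fst hz)
        (fun z hz => hasDerivAt_const z.2 (factor p L w z.1)) hdet)
  refine ⟨fun z => (τ z.1, κ * z.2 + h z.1), ?_, ⟨fun z hz => ⟨hτb.mapsTo hz.1, mem_univ _⟩,
    fun z hz z' hz' e => ?_, fun u hu => ?_⟩, fun z hz => ?_, ?_⟩
  · exact (hτs.comp contDiffOn_fst fun z hz => hz.1).prodMk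
      ((contDiffOn_const.mul contDiffOn_snd).add (hhs.comp contDiffOn_fst fun z hz => hz.1))
  · obtain ⟨e1, e2⟩ := Prod.mk.inj e
    have e3 : z.1 = z'.1 := hτb.injOn hz.1 hz'.1 e1
    rw [e3] at e2
    exact Prod.ext e3 (mul_left_cancel₀ hκ0.ne' (add_right_cancel e2))
  · obtain ⟨x, hx, hxu⟩ := hτb.surjOn hu.1
    exact ⟨(x, (u.2 - h x) / κ), ⟨hx, mem_univ _⟩, Prod.ext hxu (by simp; field_simp; ring)⟩
  · rw [det_prod_shear (hτ z.1 hz.1).1 (hh z.1 hz.1)]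
    have := d.factor_pos hz.1
    positivity
  · exact hI

end IsSetup

/-- The coefficient has negative real part and non-positive imaginary part, so its argument 3t₀ can
be taken in [π, 3π/2) as π + arccos(-A/U'). -/
lemma IsSetup.exists_phase {p q c : ℝ} {L : PeriodPair} {w : ℝ} (d : IsSetup p q c L w) :
    ∃ t₀ ∈ Icc 0 (2 * Real.pi / 3), Real.cos (3 * t₀) ≠ 0 ∧
      hildebrandU p c = Complex.exp (3 * Complex.I * (t₀ : ℂ)) * (modU p c : ℂ) := by
  have hm := d.modU_pos
  have hA := d.hildebrandRe_neg
  have hB := d.hildebrandIm_nonpos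
  have hAB := d.sq_hildebrandRe_add
  set A := hildebrandRe p q c
  set B := hildebrandIm p q
  have h1 : 0 < -A / modU p c := div_pos (by linarith) hm
  have h2 : -A / modU p c ≤ 1 := by
    rw [div_le_one hm]
    nlinarith [sq_nonneg B]
  have hcos : Real.cos (Real.pi + Real.arccos (-A / modU p c)) = A / modU p c := by
    rw [add_comm, Real.cos_add_pi, Real.cos_arccos (by linarith) h2]; ring
  have hsin : Real.sin (Real.pi + Real.arccos (-A / modU p c)) = B / modU p c := by
    rw [add_comm, Real.sin_add_pi, Real.sin_arccos,
      show 1 - (-A / modU p c) ^ 2 = (B / modU p c) ^ 2 by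
        field_simp; linear_combination -hAB, Real.sqrt_sq_eq_abs,
      abs_of_nonpos (div_nonpos_of_nonpos_of_nonneg hB hm.le), neg_neg]
  have h3 : Real.arccos (-A / modU p c) ≤ Real.pi / 2 := Real.arccos_le_pi_div_two.mpr h1.le
  have e : 3 * ((Real.pi + Real.arccos (-A / modU p c)) / 3) =
      Real.pi + Real.arccos (-A / modU p c) := by ring
  refine ⟨(Real.pi + Real.arccos (-A / modU p c)) / 3, ⟨?_, ?_⟩, ?_, ?_⟩
  · have := Real.arccos_nonneg (-A / modU p c)
    have := Real.pi_pos
    positivity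
  · linarith [Real.pi_pos]
  · rw [e, hcos]
    exact (div_neg_of_neg_of_pos hA hm).ne
  · rw [exp_three_mul_I_mul, e, hcos, hsin, mul_div_cancel₀ _ hm.ne', mul_div_cancel₀ _ hm.ne',
      d.hildebrandU_eq]

end AffineSphere

end

theorem theorem3p2 (p q c α : ℝ) (φ : ℝ → ℝ) (L : PeriodPair) (ω₁ : ℝ)
    (hp : 2 ≤ p) (hpq : 1 / p + 1 / q = 1)
    (hc : -2 * (p + q) < c) (hc0 : c < 0) (hα : 0 < α)
    (hφ : IsHildebrandSolution p q c α φ)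
    (hg2 : L.g₂ = (invg2 p q : ℂ)) (hg3 : L.g₃ = (invg3 p q c : ℂ))
    (hω₁ : IsLeast {x : ℝ | 0 < x ∧ ((2 * x : ℝ) : ℂ) ∈ L.lattice} ω₁) :
    (∀ x ∈ Ioo (-ω₁) ω₁, (L.weierstrassP ((x : ℂ) + (ω₁ : ℂ))).im = 0) ∧
    (∃ Φ : ℝ × ℝ → ℝ × ℝ,
      ContDiffOn ℝ ∞ Φ (Ioo (-ω₁) ω₁ ×ˢ univ) ∧
      BijOn Φ (Ioo (-ω₁) ω₁ ×ˢ univ) (Ioo (-α) 1 ×ˢ univ) ∧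
      (∀ z ∈ Ioo (-ω₁) ω₁ ×ˢ (univ : Set ℝ), (fderiv ℝ Φ z).det ≠ 0) ∧
      HasInvariants (Ioo (-ω₁) ω₁ ×ˢ univ) (fun z => (1 / √3) • hildebrandSphere p q φ (Φ z))
        (conformalFactor p q L ω₁) (-1) (hildebrandU p c)) ∧
    (∃ t₀ ∈ Icc 0 (2 * Real.pi / 3), Real.cos (3 * t₀) ≠ 0 ∧
      hildebrandU p c = Complex.exp (3 * Complex.I * (t₀ : ℂ)) * (modU p c : ℂ)) ∧
    ∀ t : ℝ, Real.cos (3 * t) ≠ 0 →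
      (∀ i : Fin 3, ∃ m : ℂ, IsParameter p q c t L (expo p c t i) m) ∧
      ∀ m : Fin 3 → ℂ, (∀ i, IsParameter p q c t L (expo p c t i) (m i)) →
        (∀ z ∈ Ioo (-ω₁) ω₁ ×ˢ (univ : Set ℝ), ∀ i, (familyC p c t L ω₁ m z i).im = 0) ∧
        SolvesFrameEquations (Ioo (-ω₁) ω₁ ×ˢ univ) (family p c t L ω₁ m)
          (fun z => Real.log (conformalFactor p q L ω₁ z / 2)) (-1) (modU p c : ℂ)
          (Complex.exp (3 * Complex.I * (t : ℂ))) ∧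
        HasInvariants (Ioo (-ω₁) ω₁ ×ˢ univ) (normalizedFamily p c t L ω₁ m)
          (conformalFactor p q L ω₁) (-1)
          (Complex.exp (3 * Complex.I * (t : ℂ)) * (modU p c : ℂ)) ∧
        ∀ r : ℝ × ℝ → Fin 3 → ℝ,
          HasInvariants (Ioo (-ω₁) ω₁ ×ˢ univ) r (conformalFactor p q L ω₁) (-1)
            (Complex.exp (3 * Complex.I * (t : ℂ)) * (modU p c : ℂ)) →
          ∃ A : Matrix (Fin 3) (Fin 3) ℝ, A.det = 1 ∧
            ∀ z ∈ Ioo (-ω₁) ω₁ ×ˢ (univ : Set ℝ),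
              r z = A.mulVec (normalizedFamily p c t L ω₁ m z) := by
  have d : IsSetup p q c L ω₁ := ⟨hp, hpq, hc, hc0, hg2, hg3, hω₁⟩
  refine ⟨fun x _ => ?_, d.exists_hildebrand_map hα hφ, d.exists_phase, fun t ht =>
    ⟨fun i => exists_isParameter d (d.expo_cubic t i) ht, fun m hm =>
      ⟨fun z hz i => (d.family_eq ht hm hz i).1, d.frameEquations_family ht hm,
        d.hasInvariants_normalizedFamily ht hm,
        fun r hr => d.exists_matrix_normalizedFamily ht hm hr⟩⟩⟩
  rw [← Complex.ofReal_add]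
  exact weierstrassP_ofReal_im L d.g2_im d.g3_im _
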